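/- **Setting.** Let $X$ be a compact tropical space, regular at infinity, with a unimodular triangulation: it is given by a finite set of vertices of sedentarity $0$ and divisorial directions, by cells of sedentarity $0$, each of which is determined by the vertices and divisorial directions that span it and is the product of a unimodular simplex and a unimodular cone (compactified by its faces at infinity), and by integral affine charts on the open stars of the vertices, in which $X$ is a balanced polyhedral complex. (Every unimodularly triangulated realizable smooth projective tropical manifold is of this kind; neither smoothness nor realizability is needed below.) All coefficients are rational. Fix a linear order on the vertices and divisorial directions; it orients all simplices. $\Delta$ denotes a finite simplex of sedentarity $0$. Let $\mathrm{Link}_l(\Delta)$ be the set of $l$-element sets $\bar q$ of vertices and divisorial directions, disjoint from $\Delta$, that span together with $\Delta$ a cell $\{\Delta\bar q\}$. *Propellers.* $H_{2l}(\Delta)$ is the space of combinations $c=\sum_{\bar q\in \mathrm{Link}_l(\Delta)}\rho_{\bar q}\{\Delta\bar q\}$ that are balanced along $\Delta$: for each $\bar r\in\mathrm{Link}_{l-1}(\Delta)$ the vectors from $\Delta$ to the vertices $q$ (or the divisorial vectors $q$), weighted by $\rho_{q\bar r}$, sum to $0$ modulo the linear span of $\{\Delta\bar r\}$. Let $H_{2l}(k)=\bigoplus_{\dim\Delta=k}H_{2l}(\Delta)$.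 Define $d''c=\sum_{q}\sum_{\bar r\in\mathrm{Link}_{l-1}(\Delta q)}\rho_{q\bar r}\{\Delta q\bar r\}$, where $q$ runs over the vertices such that $\Delta q=\Delta\cup\{q\}$ is a simplex, oriented by $[q,\Delta]$. For a facet $\Delta'=\Delta\setminus v$, with $\Delta$ oriented by $[v,\Delta']$, the component of $d'c$ at $\Delta'$ is $\sum_{\bar q}\rho_{\bar q}\{\Delta'\bar q\}+\sum_{\bar r\in\mathrm{Link}_{l-1}(\Delta)}\rho_{v\bar r}\{\Delta\bar r\}$, where $\rho_{v\bar r}\in\mathbb Q$ is determined by $$\sum_q\rho_{q\bar r}\overrightarrow{(\Delta'q)}+\rho_{v\bar r}\overrightarrow{(\Delta'v)}=0\mod\{\Delta'\bar r\}.$$ *Barycentric chains.* $C^{bar}_q(X,\mathcal F_p)$ is the space of simplicial $q$-chains of the first barycentric subdivision of $X$ with coefficients in the cosheaf $\mathcal F_p\otimes\mathbb Q$ ($\mathcal F_p$ at a point is generated by the $p$-fold wedge products of vectors tangent to a single adjacent cell of the same sedentarity), with simplicial boundary $\partial$. For $c\in H_{2l}(\Delta)$, $\dim\Delta=k$ and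 $0\le r\le k$ put $$c[-r]=\sum_{\bar q\in\mathrm{Link}_l(\Delta)}\ \sum_{\Delta'\subseteq\Delta,\ \dim\Delta'=r}\big(\rho_{\bar q}\,\mathrm{Vol}_{\Delta'\bar q}\big)\,\hat\Delta'_{\Delta\bar q},$$ where $\hat\Delta'_{\Delta\bar q}$ is the dual cell of $\Delta'$ in $\{\Delta\bar q\}$ (the union of the simplices of the maximal flags of cells from $\Delta'$ to $\{\Delta\bar q\}$) and $\mathrm{Vol}_{\Delta'\bar q}$ is the integral volume element of $\{\Delta'\bar q\}$ oriented by $(\Delta',\bar q)$. The orientation of $\hat\Delta'_{\Delta\bar q}$ is $(-1)^{rk+r(r-1)/2}$ times the one which, preceded by $\Delta'$, gives the orientation $(\Delta,\bar q)$ of $\{\Delta\bar q\}$; so each term does not depend on the orientations of $\Delta'$ and $\bar q$. This extends linearly to $H_{2l}(k)$. Set $c[-r]=0$ for $r>k$, and let $K_l(k)[-r]$ be the image of $H_{2l}(k)$. *Complexes, for fixed $p$.* The Steenbrink–Illusie $E_1$ complex (in its description by propellers) has in degree $q\ge0$ the term $\bigoplus_r H_{2(p-r)}(q-p+2r)[-r]$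 over all $r$ with $0\le r\le p$ and $r\le q-p+2r$. Its differential is $d=d'+d''$, with $d':H_{2l}(k)[-r]\to H_{2l}(k-1)[-r]$ ($0$ if $r=k$) and $d'':H_{2l}(k)[-r]\to H_{2l-2}(k+1)[-r-1]$. The konstruktor in degree $q$ is the subspace of chains generated by all $K_l(k)[-r]$ with $r\le k$, $l+r=p$, $k+l-r=q$. **Proposition.** The barycentric chains form a complex; for $c \in H_{2l}(k)$ the coefficients $\rho_{v\bar r}$ exist and are unique (for $k,l\ge1$), $d'c$ and $d''c$ are propellers, in $H_{2l}(k-1)$ (zero if $k=0$) and $H_{2l-2}(k+1)$ (zero if $l=0$), and for $0\le r\le k$ the map $c\mapsto c[-r]$ is an injection $H_{2l}(k)\to C^{bar}_{k+l-r}(X,\mathcal F_{l+r})$. Moreover: 1. For every $c\in H_{2l}(k)$ and $0\le r\le k$, $$\partial(c[-r])=(d'c)[-r]+(d''c)[-r-1].$$ 2. For every $p$ we have $d^2=0$, the konstruktor is a subcomplex of $C^{bar}_\bullet(X,\mathcal F_p)$, and $(c_r)_r\mapsto\sum_r c_r[-r]$ is an isomorphism from the Steenbrink–Illusie $E_1$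 complex to the konstruktor. -/

import Mathlib

open Finset
open scoped Classical

noncomputable section

/-- A compact tropical space, regular at infinity, with a unimodular triangulation, given by its
cells and by integral affine charts on the open stars of its vertices of sedentarity zero.

`P` is the set of vertices of sedentarity zero together with the divisorial directions.
A finite set `E : Finset P` in `cells` stands for the cell of sedentarity zero
`conv (vertices in E) + cone (divisorial vectors in E)`, compactified by its faces at infinity,
so that its dimension is `E.card - 1`.  The cell with sedentarity `I ⊆ E` (`I` a set of divisorial
directions) is the face at infinity of `E` in the directions `I`.

`vec v x` is read in the chart at the vertex `v`, for `x` in the star of `v`: it is the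
vector from `v` to `x` if `x` is a vertex, and the divisorial vector `x` otherwise. -/
structure UnimodularTropicalSpace (P : Type*) [Fintype P] [LinearOrder P] where
  /-- the elements of `P` that are vertices; the other ones are divisorial directions -/
  IsVertex : P → Prop
  /-- the cells of sedentarity zero -/
  cells : Set (Finset P)
  exists_vertex : ∀ E ∈ cells, ∃ v ∈ E, IsVertex v
  down_closed : ∀ E ∈ cells, ∀ F, F ⊆ E → (∃ v ∈ F, IsVertex v) → F ∈ cells
  vertex_mem : ∀ v, IsVertex v → {v} ∈ cells
  /-- the dimension -/
  dim : ℕ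
  pure : ∀ E ∈ cells, ∃ G ∈ cells, E ⊆ G ∧ G.card = dim + 1
  /-- the dimension of the ambient space of the chart at a vertex -/
  N : P → ℕ
  vec : (v : P) → P → (Fin (N v) → ℤ)
  vec_self : ∀ v, IsVertex v → vec v v = 0
  /-- each cell is the product of a unimodular simplex and a unimodular cone: its edge vectors at a
  vertex and its divisorial vectors are a basis of a saturated sublattice -/
  unimodular : ∀ E ∈ cells, ∀ v ∈ E, IsVertex v →
    LinearIndepOn ℤ (vec v) (E.erase v : Set P) ∧
    ∀ (m : ℤ) (u : Fin (N v) → ℤ), m ≠ 0 →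
      m • u ∈ Submodule.span ℤ (vec v '' (E.erase v : Set P)) →
      u ∈ Submodule.span ℤ (vec v '' (E.erase v : Set P))
  /-- the chart at `v` is injective: the cones of any two cells meet in the cone of their
  common face -/
  embedded : ∀ E ∈ cells, ∀ E' ∈ cells, ∀ v ∈ E, v ∈ E' → IsVertex v → ∀ s t : P → ℝ,
    (∀ x, 0 ≤ s x) → (∀ x, 0 ≤ t x) → (∀ x ∉ E.erase v, s x = 0) → (∀ x ∉ E'.erase v, t x = 0) →
    (∀ i, ∑ x, s x * (vec v x i : ℝ) = ∑ x, t x * (vec v x i : ℝ)) → s = t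
  /-- the overlap maps, on the star of an edge, are integral affine -/
  transition : ∀ v w, IsVertex v → IsVertex w → ({v, w} : Finset P) ∈ cells →
    ∃ A : (Fin (N v) → ℤ) →ₗ[ℤ] (Fin (N w) → ℤ), ∀ x, ({v, w, x} : Finset P) ∈ cells →
      (IsVertex x → vec w x = A (vec v x - vec v w)) ∧ (¬ IsVertex x → vec w x = A (vec v x))
  /-- the balancing condition at the cells of codimension one -/
  balanced : ∀ E ∈ cells, E.card = dim → ∀ v ∈ E, IsVertex v →
    ∑ x ∈ univ.filter (fun x => x ∉ E ∧ insert x E ∈ cells), vec v x ∈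
      Submodule.span ℤ (vec v '' (E : Set P))

namespace UnimodularTropicalSpace

variable {P : Type*} [Fintype P] [LinearOrder P] (X : UnimodularTropicalSpace P)

/-! ### Tangent spaces

A rational tangent vector at a cell `E` is given by its components in the charts at all the
vertices of `E`; the components in the remaining charts are set to zero. -/

/-- Families of rational vectors, one for each chart. -/
abbrev Family : Type _ := (v : P) → (Fin (X.N v) → ℚ)

/-- Forget the components in charts at vertices outside `E`. On tangent vectors this is the map
from the tangent space at a cell to the tangent space at its face `E`. -/
def restrict (E : Finset P) : X.Family →ₗ[ℚ] X.Family :=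
  LinearMap.pi fun v => if v ∈ E then LinearMap.proj v else 0

/-- The tangent vector at the cell `E` which goes from the vertex `y` to `x` if `x` is a vertex,
and which is the divisorial vector `x` otherwise (then `y` is irrelevant). -/
def disp (E : Finset P) (y x : P) : X.Family :=
  X.restrict E fun v i =>
    if X.IsVertex v then
      if X.IsVertex x then (X.vec v x i : ℚ) - (X.vec v y i : ℚ) else (X.vec v x i : ℚ)
    else 0

/-- The linear space parallel to the cell `G`, as a subspace of the tangent space at `E`
(`G` and `E` are faces of one another, or lie in a common cell). -/
def cellSpan (E G : Finset P) : Submodule ℚ X.Family :=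
  Submodule.span ℚ {u | ∃ y ∈ G, X.IsVertex y ∧ ∃ x ∈ G, u = X.disp E y x}

/-- The span, in the tangent space at `E`, of the divisorial vectors in `B`. -/
def divSpan (E B : Finset P) : Submodule ℚ X.Family :=
  Submodule.span ℚ {u | ∃ x ∈ B, ¬ X.IsVertex x ∧ u = X.disp E x x}

/-! ### Barycentric chains

Each cell of sedentarity zero has a barycenter, which for an infinite cell is the barycenter of its
most sedentary face. The simplices of the barycentric subdivision are the flags of cells of
sedentarity zero. The relative interior of the simplex of a flag `E₀ ⊂ ⋯ ⊂ E_q` lies in the relative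
interior of the face at infinity of `E_q` whose sedentarity is the set of divisorial directions
of `E₀`. -/

/-- Flags of cells, that is, simplices of the barycentric subdivision. -/
def Flag : Type _ :=
  {s : Finset (Finset P) // s.Nonempty ∧ (∀ F ∈ s, F ∈ X.cells) ∧
    IsChain (· ⊆ ·) (s : Set (Finset P))}

instance : Fintype X.Flag := by unfold Flag; infer_instance

variable {X}

/-- The largest cell of a flag. -/
def Flag.top (σ : X.Flag) : Finset P := σ.1.sup id

/-- The smallest cell of a flag. -/
def Flag.bot (σ : X.Flag) : Finset P := σ.1.inf id

variable (X)

/-- The exterior algebra on the tangent space at the relative interior of the simplex `σ`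
(enlarged to all families): modulo the divisorial directions in its sedentarity. -/
abbrev Coef (σ : X.Flag) : Type _ :=
  ExteriorAlgebra ℚ (X.Family ⧸ X.divSpan σ.top σ.bot)

variable {X}

theorem restrict_disp {E E' : Finset P} (h : E' ⊆ E) (y x : P) :
    X.restrict E' (X.disp E y x) = X.disp E' y x := by
  funext v i
  by_cases hv : v ∈ E'
  · simp [disp, restrict, hv, h hv]
  · simp [disp, restrict, hv]

theorem divSpan_le {σ τ : X.Flag} (h : τ.1 ⊆ σ.1) :
    X.divSpan σ.top σ.bot ≤ (X.divSpan τ.top τ.bot).comap (X.restrict τ.top) := by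
  rw [divSpan, Submodule.span_le]
  rintro _ ⟨x, hx, hv, rfl⟩
  have h1 : τ.top ⊆ σ.top := Finset.sup_mono h
  have h2 : σ.bot ⊆ τ.bot := Finset.inf_mono h
  exact Submodule.subset_span ⟨x, h2 hx, hv, restrict_disp h1 x x⟩

/-- The coefficient map from a simplex to its face: inclusion of the tangent space into the
tangent space at a smaller cell, and projection along the new divisorial directions. -/
def push {σ τ : X.Flag} (h : τ.1 ⊆ σ.1) : X.Coef σ →ₗ[ℚ] X.Coef τ :=
  (ExteriorAlgebra.map
    (Submodule.mapQ _ _ (X.restrict τ.top) (divSpan_le h))).toLinearMap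

variable (X)

/-- The coefficient group `𝓕_p ⊗ ℚ` on the relative interior of `σ`: it is generated by
the products of `p` vectors tangent to one and the same cell `G` adjacent to `σ.top`. -/
def coefF (p : ℕ) (σ : X.Flag) : Submodule ℚ (X.Coef σ) :=
  Submodule.span ℚ {w | ∃ G ∈ X.cells, σ.top ⊆ G ∧ ∃ u : Fin p → X.Family,
    (∀ i, u i ∈ X.cellSpan σ.top G) ∧
    w = ExteriorAlgebra.ιMulti ℚ p fun i => (X.divSpan σ.top σ.bot).mkQ (u i)}

/-- Simplicial chains of the barycentric subdivision, of all degrees, with coefficients in the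
exterior algebras of the tangent spaces. The flag `E₀ ⊂ ⋯ ⊂ E_q` is oriented by this order of its
vertices. -/
abbrev Chain : Type _ := (σ : X.Flag) → X.Coef σ

/-- The tropical barycentric chains `C^bar_q(X; 𝓕_p) ⊗ ℚ`. -/
def barChains (p q : ℕ) : Submodule ℚ X.Chain where
  carrier := {a | ∀ σ, a σ ∈ X.coefF p σ ∧ (σ.1.card ≠ q + 1 → a σ = 0)}
  add_mem' ha hb σ := ⟨add_mem (ha σ).1 (hb σ).1, fun h => by
    simp [(ha σ).2 h, (hb σ).2 h]⟩
  zero_mem' σ := ⟨zero_mem _, fun _ => rfl⟩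
  smul_mem' r _ ha σ := ⟨Submodule.smul_mem _ r (ha σ).1, fun h => by simp [(ha σ).2 h]⟩

/-- The sign `(-1)^i`, where the face `τ` of `σ` omits the vertex number `i = 0, 1, …` of `σ`. -/
def faceSign (σ τ : X.Flag) : ℚ :=
  (-1) ^ (σ.1.filter fun G => ∃ F ∈ σ.1 \ τ.1, G ⊂ F).card

/-- The simplicial boundary `∂`. -/
def boundary : X.Chain →ₗ[ℚ] X.Chain :=
  LinearMap.pi fun τ => ∑ σ : X.Flag,
    if h : τ.1 ⊆ σ.1 ∧ τ.1.card + 1 = σ.1.card then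
      X.faceSign σ τ • (push h.1 ∘ₗ LinearMap.proj σ)
    else 0

/-! ### Propellers

Every finite simplex `Δ` is oriented by the linear order of its vertices. -/

/-- Finite simplices of sedentarity zero. -/
def IsSimplex (Δ : Finset P) : Prop := Δ ∈ X.cells ∧ ∀ x ∈ Δ, X.IsVertex x

/-- `q ∈ Link_l(Δ)`, where `l = q.card`: the finite simplex `Δ` together with `q` spans a cell. -/
def IsLink (Δ q : Finset P) : Prop := X.IsSimplex Δ ∧ Disjoint Δ q ∧ Δ ∪ q ∈ X.cells

variable (P) in
/-- Families of weights: `c Δ q` is the coefficient `ρ_q` of the cell `Δ ∪ q` in the component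
of `c` at the simplex `Δ`. -/
abbrev Weights : Type _ := Finset P → Finset P → ℚ

/-- The group `H_{2l}(k)`, the direct sum over the `k`-simplices `Δ` of the groups `H_{2l}(Δ)` of
propellers: rational combinations of the cells `Δ ∪ q`, `q ∈ Link_l(Δ)`, which are balanced along
`Δ`, that is, at each of the cells `Δ ∪ r`, `r ∈ Link_{l-1}(Δ)`. -/
def propellers (l k : ℕ) : Submodule ℚ (Weights P) where
  carrier := {c | (∀ Δ q, c Δ q ≠ 0 → Δ.card = k + 1 ∧ q.card = l ∧ X.IsLink Δ q) ∧
    ∀ Δ r, X.IsLink Δ r → r.card + 1 = l → ∀ y ∈ Δ,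
      ∑ x ∈ univ.filter (fun x => x ∉ Δ ∪ r), c Δ (insert x r) • X.disp (Δ ∪ r) y x ∈
        X.cellSpan (Δ ∪ r) (Δ ∪ r)}
  add_mem' {a b} ha hb := by
    refine ⟨fun Δ q h => ?_, fun Δ r h1 h2 y hy => ?_⟩
    · by_cases h' : a Δ q = 0
      · exact hb.1 Δ q fun h'' => h (by simp [h', h''])
      · exact ha.1 Δ q h'
    · simp only [Pi.add_apply, add_smul, Finset.sum_add_distrib]
      exact add_mem (ha.2 Δ r h1 h2 y hy) (hb.2 Δ r h1 h2 y hy)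
  zero_mem' := ⟨fun Δ q h => absurd rfl h, fun Δ r _ _ y _ => by simp⟩
  smul_mem' t a ha := by
    refine ⟨fun Δ q h => ha.1 Δ q fun h' => h (by simp [h']), fun Δ r h1 h2 y hy => ?_⟩
    simp only [Pi.smul_apply, smul_assoc, ← Finset.smul_sum]
    exact Submodule.smul_mem _ t (ha.2 Δ r h1 h2 y hy)

variable (P) in
/-- The sign of the oriented simplex `[x, S \ x]` relative to `S`, for `x ∈ S`. -/
def insertSign (S : Finset P) (x : P) : ℚ := (-1) ^ (S.filter fun w => w < x).card

/-- The Gysin map `d''`: restriction of the propeller at `Δ` to the finite simplices `Δ ∪ {x}`,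
oriented by `[x, Δ]`. The formula gives the component of `d'' c` at the simplex `Δ₁ = Δ ∪ {x}`. -/
def gysin (c : Weights P) : Weights P := fun Δ₁ r =>
  if X.IsLink Δ₁ r then
    ∑ x ∈ Δ₁, insertSign P Δ₁ x * c (Δ₁.erase x) (insert x r)
  else 0

/-- `a` is a coefficient `ρ_{v r}` for which the image of the propeller at `Δ` is balanced at the
cell `(Δ \ v) ∪ {v} ∪ r = Δ ∪ r`, modulo the span of `(Δ \ v) ∪ r`. -/
def IsDescent (c : Weights P) (Δ : Finset P) (v : P) (r : Finset P) (a : ℚ) : Prop :=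
  ∀ y ∈ Δ.erase v,
    ∑ x ∈ univ.filter (fun x => x ∉ Δ ∪ r), c Δ (insert x r) • X.disp (Δ ∪ r) y x
      + a • X.disp (Δ ∪ r) y v ∈ X.cellSpan (Δ ∪ r) (Δ.erase v ∪ r)

/-- The coefficient `ρ_{v r}` (a choice of it; it is unique for propellers). -/
def descent (c : Weights P) (Δ : Finset P) (v : P) (r : Finset P) : ℚ :=
  Classical.epsilon (X.IsDescent c Δ v r)

/-- The map `d'` induced by inclusions of strata, to the facets `Δ' = Δ \ v` of `Δ`, where
`Δ` is oriented by `[v, Δ']`. The image of `∑ ρ_q {Δ q}` is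
`∑ ρ_q {Δ' q} + ∑ ρ_{v r} {Δ r}`, where `{Δ r} = {Δ' v r}`. The formula
gives the component of `d' c` at `Δ'`. -/
def inclusion (c : Weights P) : Weights P := fun Δ' q =>
  if X.IsSimplex Δ' then
    ∑ v ∈ univ.filter (fun v => v ∉ Δ' ∧ X.IsSimplex (insert v Δ')),
      insertSign P (insert v Δ') v *
        (if v ∉ q then c (insert v Δ') q
          else if X.IsLink (insert v Δ') (q.erase v) then
            X.descent c (insert v Δ') v (q.erase v)
          else 0)
  else 0

/-! ### The Steenbrink–Illusie complex in terms of propellers -/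

/-- The term of degree `q` of the complex with index `p`: the direct sum over `r` of the groups
`H_{2l}(k)[-r]` with `l = p - r` and `k = q + 2 r - p`, over all `r` such that `l ≥ 0` and
`k ≥ r`. The entry `e r` is the component in `H_{2l}(k)[-r]`. -/
def siTerm (p q : ℕ) : Submodule ℚ (ℕ → Weights P) :=
  Submodule.pi Set.univ fun r =>
    if r ≤ p ∧ p ≤ q + r then X.propellers (p - r) (q + 2 * r - p) else ⊥

/-- The differential `d = d' + d''`, where `d'` maps `H_{2l}(k)[-r]` to `H_{2l}(k-1)[-r]` if
`r ≤ k - 1` (and to zero if `r = k`, the target being absent), and `d''` maps `H_{2l}(k)[-r]` to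
`H_{2l-2}(k+1)[-r-1]`. -/
def siDiff (e : ℕ → Weights P) : ℕ → Weights P := fun r Δ q =>
  (if r + 1 ≤ Δ.card then X.inclusion (e r) Δ q else 0) +
    (if 1 ≤ r then X.gysin (e (r - 1)) Δ q else 0)

/-! ### The konstruktor -/

/-- The volume element of the oriented cell spanned by a list that starts with a vertex `y`: the
product of the vectors from `y` to the vertices and of the divisorial vectors that follow. -/
def vol (σ : X.Flag) : List P → X.Coef σ
  | [] => 0
  | y :: L => (L.map fun x => ExteriorAlgebra.ι ℚ
      ((X.divSpan σ.top σ.bot).mkQ (X.disp σ.top y x))).prod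

/-- The order on the vertices and divisorial directions in the cell `σ.top` in which the elements
of `σ.bot` come first (in increasing order), followed by the elements that are added one by one
by the cells of the flag `σ`. -/
def flagBefore (σ : X.Flag) (x y : P) : Prop :=
  (σ.1.filter fun F => x ∉ F).card < (σ.1.filter fun F => y ∉ F).card ∨
    ((σ.1.filter fun F => x ∉ F).card = (σ.1.filter fun F => y ∉ F).card ∧ x < y)

variable (P) in
/-- The order on `Δ ∪ q` in which the elements of `Δ` come first. -/
def cellBefore (Δ : Finset P) (x y : P) : Prop :=
  (x ∈ Δ ∧ y ∉ Δ) ∨ ((x ∈ Δ ↔ y ∈ Δ) ∧ x < y)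

/-- The sign of the permutation between the two orders: the orientation of the simplex `σ` of
the dual cell of `σ.bot`, preceded by that of `σ.bot`, compared to the orientation of `σ.top`
given by `Δ` followed by the remaining elements. -/
def flagSign (Δ : Finset P) (σ : X.Flag) : ℚ :=
  (-1) ^ ((σ.top ×ˢ σ.top).filter fun z =>
    X.flagBefore σ z.1 z.2 ∧ cellBefore P Δ z.2 z.1).card

/-- The flag `σ` is one of the simplices of the dual cell of `Δ'` in the cell `E`: it starts at
`Δ'`, ends at `E` and is saturated. -/
def IsDualFlag (Δ' E : Finset P) (σ : X.Flag) : Prop :=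
  σ.bot = Δ' ∧ σ.top = E ∧ σ.1.card + Δ'.card = E.card + 1

/-- The chain `Vol_{Δ' q} · (dual cell of Δ' in Δ ∪ q)`, for a face `Δ'` of dimension `r` of the
`k`-simplex `Δ`. The product does not depend on the orientations of `Δ'` and `q`
(here the increasing ones are used). The last sign depends on `k` and `r` only and fixes which of
the two orientations of a dual cell is called consistent. -/
def framedDual (Δ q Δ' : Finset P) : X.Chain := fun σ =>
  if X.IsDualFlag Δ' (Δ ∪ q) σ then
    ((-1 : ℚ) ^ ((Δ'.card - 1) * (Δ.card - 1) + (Δ'.card - 1).choose 2) * X.flagSign Δ σ) •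
      X.vol σ (Δ'.sort (· ≤ ·) ++ q.sort (· ≤ ·))
  else 0

/-- The barycentric chain `c[-r]`. -/
def bracket (r : ℕ) : Weights P →ₗ[ℚ] X.Chain where
  toFun c := ∑ Δ : Finset P, ∑ q ∈ univ.filter (fun q => X.IsLink Δ q),
    ∑ Δ' ∈ Δ.powersetCard (r + 1), c Δ q • X.framedDual Δ q Δ'
  map_add' a b := by simp only [Pi.add_apply, add_smul, Finset.sum_add_distrib]
  map_smul' t a := by
    simp only [Pi.smul_apply, smul_assoc, ← Finset.smul_sum, RingHom.id_apply]

/-- The part of the konstruktor in `C^bar_q(X; 𝓕_p)`: it is generated by the groups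
`K_l(k)[-r]`, the images of `H_{2l}(k)` under `c ↦ c[-r]`, with `l + r = p` and `k + l - r = q`. -/
def konstruktor (p q : ℕ) : Submodule ℚ X.Chain :=
  ⨆ (l : ℕ) (k : ℕ) (r : ℕ) (_ : r ≤ k ∧ l + r = p ∧ k + l = q + r),
    (X.propellers l k).map (X.bracket r)

end UnimodularTropicalSpace

end

/-! ### Parity counts and exterior algebra. -/

noncomputable section

/-! ### Signs -/

/-! Everything is computed in homogeneous coordinates: a vertex becomes a vector with last
coordinate 1, a divisorial direction one with last coordinate 0 (`point`). Balancing along `Δ` at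
the cell `Δ ∪ r` then says that the weighted sum of the points `x` lies in the linear span of the
points of `Δ ∪ r`, with no base vertex to choose. Moving everything to one side gives a linear
relation, and the coefficient of `v ∈ Δ` in it is the number that defines `d'`; it is unique because
the points of a cell are linearly independent. Volume elements become contractions, with the last
coordinate, of products of points (`hullVol`). They live in one exterior algebra that maps to every
coefficient group compatibly with face maps (`push_toCoef`).

Apart from an orientation sign, the coefficient of `c[-r]` at a saturated flag depends only on its
smallest cell `B` and largest cell `T`: it is a signed sum over the simplices `Δ` between them
(`bracket_apply`). The boundary at a flag `τ` collects the flags with one more cell, and there are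
three kinds.

A cell inserted in the middle fills a gap of length two. There are two fillings, of opposite
orientation, and they cancel (`sum_ins_middle`).

A new smallest cell `B \ x` produces `d''`. The simplices that do not contain `x` give the terms of
`d''c` indexed by elements of `B`. The others give the remaining terms through the relation between
the volumes of the facets of a simplex, which is the vanishing of the square of a contraction
(`sum_hullVol_erase`, `stokes_between`, `bracketCoef_gysin`). If `B` contains a divisorial
direction, passing to the quotient by that direction kills all terms.

A new largest cell `T ∪ z` produces `d'`. The simplices that contain `z` give the terms `{Δ' q}`.
For the others the balancing relation, multiplied by the product of the points of `B ∪ (T \ Δ)` and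
contracted, gives the terms with the descent coefficients (`sum_coneVol_of_balance`,
`bracketCoef_inclusion`).

That `d''c` is balanced is an exchange of sums. For `d'c` the nontrivial case is a cell containing
the removed vertex, where the symmetry of the weights is needed (`sum_smul_mem_of_symmetric`).

Injectivity holds because the volume elements occurring at one flag are products over distinct
subsets of a linearly independent set. Different `r` use flags whose smallest cells have different
sizes, so the sum over `r` remains injective, and `d² = 0` is inherited from `∂² = 0`. -/

theorem neg_one_pow_eq_of_mod {m n : ℕ} (h : m % 2 = n % 2) : (-1 : ℚ) ^ m = (-1) ^ n := by
  rw [neg_one_pow_eq_pow_mod_two, h, ← neg_one_pow_eq_pow_mod_two]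

section Counting

variable {P : Type*} [LinearOrder P]

/-- The number of elements of `A` below `x`. -/
def countLT (A : Finset P) (x : P) : ℕ := (A.filter fun b => b < x).card

/-- The number of elements of `A` above `x`. -/
def countGT (A : Finset P) (x : P) : ℕ := (A.filter fun b => x < b).card

/-- The number of pairs in `A ×ˢ q` in the wrong order. -/
def crossings (A q : Finset P) : ℕ := ((A ×ˢ q).filter fun z => z.2 < z.1).card

theorem countLT_add_countGT {A : Finset P} {x : P} (h : x ∉ A) :
    countLT A x + countGT A x = A.card := by
  rw [countLT, countGT, ← card_union_of_disjoint, ← filter_or, filter_true_of_mem]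
  · intro b hb
    exact lt_or_gt_of_ne fun hbx => h (hbx ▸ hb)
  · rw [disjoint_filter]
    intro b _ h1 h2
    exact lt_asymm h1 h2

theorem countLT_union {A B : Finset P} (h : Disjoint A B) (x : P) :
    countLT (A ∪ B) x = countLT A x + countLT B x := by
  rw [countLT, filter_union, card_union_of_disjoint (disjoint_filter_filter h)]; rfl

theorem countGT_union {A B : Finset P} (h : Disjoint A B) (x : P) :
    countGT (A ∪ B) x = countGT A x + countGT B x := by
  rw [countGT, filter_union, card_union_of_disjoint (disjoint_filter_filter h)]; rfl

theorem countLT_insert_self (A : Finset P) (x : P) : countLT (insert x A) x = countLT A x := by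
  simp [countLT, filter_insert]

theorem insertSign_insert (A : Finset P) (x : P) :
    UnimodularTropicalSpace.insertSign P (insert x A) x = (-1) ^ countLT A x := by
  rw [← countLT_insert_self]; rfl

theorem countLT_erase_self (A : Finset P) (x : P) : countLT (A.erase x) x = countLT A x := by
  rw [countLT, filter_erase, erase_eq_of_notMem (by simp)]; rfl

theorem countGT_erase_self (A : Finset P) (x : P) : countGT (A.erase x) x = countGT A x := by
  rw [countGT, filter_erase, erase_eq_of_notMem (by simp)]; rfl

theorem crossings_union_left {A B : Finset P} (h : Disjoint A B) (q : Finset P) :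
    crossings (A ∪ B) q = crossings A q + crossings B q := by
  rw [crossings, union_product, filter_union, card_union_of_disjoint]; rfl
  exact disjoint_filter_filter (disjoint_product.2 (Or.inl h))

theorem crossings_union_right (A : Finset P) {q r : Finset P} (h : Disjoint q r) :
    crossings A (q ∪ r) = crossings A q + crossings A r := by
  rw [crossings, product_union, filter_union, card_union_of_disjoint]; rfl
  exact disjoint_filter_filter (disjoint_product.2 (Or.inr h))

theorem crossings_singleton_left (x : P) (q : Finset P) : crossings {x} q = countLT q x := by
  rw [crossings, countLT, singleton_product, filter_map, card_map]; rfl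

theorem crossings_singleton_right (A : Finset P) (x : P) : crossings A {x} = countGT A x := by
  rw [crossings, countGT, product_singleton, filter_map, card_map]; rfl

theorem crossings_insert_left {A : Finset P} {x : P} (h : x ∉ A) (q : Finset P) :
    crossings (insert x A) q = countLT q x + crossings A q := by
  rw [insert_eq, crossings_union_left (disjoint_singleton_left.2 h), crossings_singleton_left]

theorem crossings_insert_right (A : Finset P) {q : Finset P} {x : P} (h : x ∉ q) :
    crossings A (insert x q) = countGT A x + crossings A q := by
  rw [insert_eq, crossings_union_right _ (disjoint_singleton_left.2 h), crossings_singleton_right]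

end Counting

/-! ### Products of vectors in an exterior algebra -/

namespace ExteriorAlgebra

open CliffordAlgebra (contractLeft)

variable {R : Type*} [CommRing R] {M N : Type*} [AddCommGroup M] [Module R M]
  [AddCommGroup N] [Module R N]

theorem ι_mul_ι_mul (a b : M) (x : ExteriorAlgebra R M) :
    ι R a * (ι R b * x) = -(ι R b * (ι R a * x)) := by
  rw [← mul_assoc, ← mul_assoc, eq_neg_of_add_eq_zero_left (ι_add_mul_swap a b), neg_mul]

theorem ι_mul_ι_mul_self (a : M) (x : ExteriorAlgebra R M) : ι R a * (ι R a * x) = 0 := by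
  rw [← mul_assoc, ι_sq_zero, zero_mul]

theorem contract_ι_mul (d : Module.Dual R M) (a : M) (x : ExteriorAlgebra R M) :
    contractLeft (Q := 0) d (ι R a * x) = d a • x - ι R a * contractLeft (Q := 0) d x :=
  CliffordAlgebra.contractLeft_ι_mul d a x

section List

variable {I : Type*} (e : I → M)

/-- Next to the factor `e y`, multiples of `e y` in the other factors contribute squares and drop
out. -/
theorem ι_mul_prod_sub (h : I → R) (y : I) (L : List I) :
    ι R (e y) * (L.map fun x => ι R (e x - h x • e y)).prod =
      ι R (e y) * (L.map fun x => ι R (e x)).prod := by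
  induction L with
  | nil => simp
  | cons a L ih =>
    simp only [List.map_cons, List.prod_cons]
    rw [ι_mul_ι_mul, ih, map_sub, map_smul, sub_mul, smul_mul_assoc, ι_mul_ι_mul_self, smul_zero,
      sub_zero, ι_mul_ι_mul _ (e a)]

theorem contract_prod_eq_zero (d : Module.Dual R M) (L : List M) (hL : ∀ u ∈ L, d u = 0) :
    contractLeft (Q := 0) d (L.map fun u => ι R u).prod = 0 := by
  induction L with
  | nil => simp [CliffordAlgebra.contractLeft_one]
  | cons a L ih =>
    rw [List.map_cons, List.prod_cons, contract_ι_mul, hL a (by simp),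
      ih fun u hu => hL u (by simp [hu])]
    simp

/-- Once the other factors are corrected by multiples of `e y` so as to lie in the kernel of `d`,
only the factor `e y` contributes to the contraction. For `d` the last coordinate and `y` a vertex,
this is the passage from points to vectors based at `y`. -/
theorem contract_prod_cons (d : Module.Dual R M) (y : I) (hy : d (e y) = 1) (L : List I) :
    contractLeft (Q := 0) d ((y :: L).map fun x => ι R (e x)).prod =
      (L.map fun x => ι R (e x - d (e x) • e y)).prod := by
  have := contract_prod_eq_zero d (L.map fun x => e x - d (e x) • e y) (by simp [hy])
  rw [List.map_map] at this
  rw [List.map_cons, List.prod_cons, ← ι_mul_prod_sub e (fun x => d (e x)), contract_ι_mul, hy,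
    one_smul]
  erw [this]
  simp

end List

variable {P : Type*} [LinearOrder P]

/-- The product of the vectors `e x`, `x ∈ S`, in increasing order. -/
def wedge (e : P → M) (S : Finset P) : ExteriorAlgebra R M :=
  ((S.sort (· ≤ ·)).map fun x => ι R (e x)).prod

variable (e : P → M)

@[simp]
theorem wedge_empty : wedge (R := R) e ∅ = 1 := by simp [wedge]

theorem wedge_insert_of_lt {a : P} {S : Finset P} (h : ∀ b ∈ S, a < b) :
    wedge (R := R) e (insert a S) = ι R (e a) * wedge e S := by
  rw [wedge, sort_insert (r := (· ≤ ·)) (fun b hb => (h b hb).le) fun ha => (h a ha).false, List.map_cons,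
    List.prod_cons]; rfl

theorem map_wedge (g : M →ₗ[R] N) (S : Finset P) : map g (wedge e S) = wedge (g ∘ e) S := by
  simp [wedge, map_list_prod, Function.comp_def]

theorem ι_mul_wedge_of_notMem {z : P} {S : Finset P} (hz : z ∉ S) :
    ι R (e z) * wedge e S = (-1 : R) ^ countLT S z • wedge e (insert z S) := by
  induction S using Finset.induction_on_min with
  | empty => simp [countLT, wedge]
  | insert a S ha ih =>
    rw [mem_insert, not_or] at hz
    rcases lt_or_gt_of_ne hz.1 with h | h
    · have h' : ∀ b ∈ insert a S, z < b := by
        intro b hb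
        rcases mem_insert.1 hb with rfl | hb
        · exact h
        · exact h.trans (ha b hb)
      rw [wedge_insert_of_lt e h', countLT, filter_false_of_mem fun b hb => (h' b hb).not_gt]
      simp
    · have h' : ∀ b ∈ insert z S, a < b := by
        intro b hb
        rcases mem_insert.1 hb with rfl | hb
        · exact h
        · exact ha b hb
      rw [wedge_insert_of_lt e ha, ι_mul_ι_mul, ih hz.2, insert_comm z a, wedge_insert_of_lt e h',
        countLT, countLT, filter_insert, if_pos h, card_insert_of_notMem, pow_succ, mul_smul_comm]
      · simp
      · intro h1
        exact (ha a (mem_filter.1 h1).1).false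

theorem ι_mul_wedge_of_mem {z : P} {S : Finset P} (hz : z ∈ S) :
    ι R (e z) * wedge e S = 0 := by
  induction S using Finset.induction_on_min with
  | empty => simp at hz
  | insert a S ha ih =>
    rw [wedge_insert_of_lt e ha]
    rcases mem_insert.1 hz with rfl | hz
    · exact ι_mul_ι_mul_self _ _
    · rw [ι_mul_ι_mul, ih hz, mul_zero, neg_zero]

theorem wedge_insert_eq {z : P} {S : Finset P} (hz : z ∉ S) :
    wedge e (insert z S) = (-1 : R) ^ countLT S z • (ι R (e z) * wedge e S) := by
  rw [ι_mul_wedge_of_notMem e hz, smul_smul, ← mul_pow]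
  simp

theorem contract_wedge (d : Module.Dual R M) (S : Finset P) :
    contractLeft (Q := 0) d (wedge e S) =
      ∑ x ∈ S, ((-1 : R) ^ countLT S x * d (e x)) • wedge e (S.erase x) := by
  induction S using Finset.induction_on_min with
  | empty => simp [CliffordAlgebra.contractLeft_one]
  | insert a S ha ih =>
    have haS : a ∉ S := fun h => (ha a h).false
    rw [wedge_insert_of_lt e ha, contract_ι_mul, ih, sum_insert haS, erase_insert haS, countLT,
      filter_false_of_mem (by intro b hb; rcases mem_insert.1 hb with rfl | hb; exact lt_irrefl _; exact (ha b hb).not_gt),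
      card_empty, pow_zero, one_mul, sub_eq_add_neg, mul_sum, ← sum_neg_distrib]
    congr 1
    refine sum_congr rfl fun x hx => ?_
    have hxa : x ≠ a := fun h => haS (h ▸ hx)
    rw [erase_insert_of_ne hxa.symm,
      wedge_insert_of_lt e fun b hb => ha b (mem_of_mem_erase hb), countLT, countLT,
      filter_insert, if_pos (ha x hx), card_insert_of_notMem fun h => haS (mem_filter.1 h).1,
      mul_smul_comm, pow_succ]
    simp

theorem wedge_mul_wedge {A q : Finset P} (h : Disjoint A q) :
    wedge (R := R) e A * wedge e q = (-1 : R) ^ crossings A q • wedge e (A ∪ q) := by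
  induction A using Finset.induction_on_min with
  | empty => simp [crossings]
  | insert a A ha ih =>
    rw [disjoint_insert_left] at h
    have haA : a ∉ A := fun h => (ha a h).false
    have hA : countLT A a = 0 := by
      rw [countLT, filter_false_of_mem fun b hb => (ha b hb).not_gt, card_empty]
    rw [wedge_insert_of_lt e ha, mul_assoc, ih h.2, mul_smul_comm, insert_union,
      ι_mul_wedge_of_notMem e (by simp [haA, h.1]), countLT_union h.2, hA, zero_add, smul_smul,
      crossings_insert_left haA, pow_add, mul_comm]

theorem wedge_mul_wedge_of_mem {A q : Finset P} {x : P} (hA : x ∈ A) (hq : x ∈ q) :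
    wedge (R := R) e A * wedge e q = 0 := by
  have h1 : wedge e A = (-1 : R) ^ countLT (A.erase x) x • (ι R (e x) * wedge e (A.erase x)) := by
    rw [← wedge_insert_eq e (notMem_erase x A), insert_erase hA]
  by_cases hd : Disjoint (A.erase x) q
  · rw [h1, smul_mul_assoc, mul_assoc, wedge_mul_wedge e hd, mul_smul_comm,
      ι_mul_wedge_of_mem e (mem_union_right _ hq), smul_zero, smul_zero]
  · obtain ⟨y, hyA, hyq⟩ := not_disjoint_iff.1 hd
    rw [h1, smul_mul_assoc, mul_assoc, wedge_mul_wedge_of_mem hyA hyq, mul_zero, smul_zero]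
termination_by A.card
decreasing_by exact card_erase_lt_of_mem hA

section Field

variable {K V : Type*} [Field K] [AddCommGroup V] [Module K V] {e : P → V}

/-- A functional that vanishes on all vectors but the smallest one contracts the product to a
nonzero multiple of a shorter product. -/
theorem wedge_ne_zero {S : Finset P} (h : LinearIndepOn K e (S : Set P)) :
    wedge (R := K) e S ≠ 0 := by
  induction S using Finset.induction_on_min with
  | empty => simp
  | insert a S ha ih =>
    have haS : a ∉ S := fun h => (ha a h).false
    rw [coe_insert, linearIndepOn_insert (by simpa using haS)] at h
    obtain ⟨d, hd, hd'⟩ := Submodule.exists_le_ker_of_notMem h.2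
    intro h0
    refine ih h.1 ?_
    have h1 := congrArg (contractLeft (Q := 0) d) h0
    rw [wedge_insert_of_lt e ha, contract_ι_mul, contract_wedge,
      sum_eq_zero, mul_zero, sub_zero, map_zero] at h1
    · exact (smul_eq_zero.1 h1).resolve_left hd
    · intro x hx
      rw [show d (e x) = 0 from hd' (Submodule.subset_span ⟨x, hx, rfl⟩), mul_zero, zero_smul]

/-- Multiplication by the product over the complement of `S j` isolates the term `j`: any other
subset of the same size contains an element of that complement, so its term has a repeated factor.
-/
theorem eq_zero_of_sum_wedge_eq_zero {T : Finset P} (h : LinearIndepOn K e (T : Set P))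
    {J : Type*} {s : Finset J} {S : J → Finset P} {n : ℕ} (hS : ∀ j ∈ s, S j ⊆ T ∧ (S j).card = n)
    (hinj : Set.InjOn S s) (a : J → K) (h0 : ∑ j ∈ s, a j • wedge (R := K) e (S j) = 0) :
    ∀ j ∈ s, a j = 0 := by
  intro j hj
  have h1 := congrArg (wedge (R := K) e (T \ S j) * ·) h0
  simp only [mul_sum, mul_smul_comm, mul_zero] at h1
  rw [sum_eq_single_of_mem j hj, wedge_mul_wedge e sdiff_disjoint,
    sdiff_union_of_subset (hS j hj).1, smul_smul] at h1
  · have := (smul_eq_zero.1 h1).resolve_right (wedge_ne_zero h)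
    simpa using this
  · intro i hi hne
    obtain ⟨x, hx, hxS⟩ : ∃ x ∈ S i, x ∉ S j := by
      by_contra! hsub
      exact hne (hinj hi hj
        (eq_of_subset_of_card_le hsub (by rw [(hS i hi).2, (hS j hj).2])))
    rw [wedge_mul_wedge_of_mem e (mem_sdiff.2 ⟨(hS i hi).1 hx, hxS⟩) hx, smul_zero]

end Field

end ExteriorAlgebra

end

/-! ### Linear algebra of cells in homogeneous coordinates. -/

noncomputable section

namespace UnimodularTropicalSpace

variable {P : Type*} [Fintype P] [LinearOrder P] (X : UnimodularTropicalSpace P)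

/-! ### Homogeneous coordinates -/

/-- The last homogeneous coordinate: `1` for a vertex, `0` for a divisorial direction. -/
def height (x : P) : ℚ := if X.IsVertex x then 1 else 0

/-- The homogeneous coordinates of a vertex or divisorial direction in all charts. -/
def point (x : P) : X.Family × ℚ :=
  (fun v i => if X.IsVertex v then (X.vec v x i : ℚ) else 0, X.height x)

/-- The homogeneous coordinates in the charts at the vertices of `E`. -/
def pointAt (E : Finset P) (x : P) : X.Family × ℚ :=
  (X.restrict E).prodMap LinearMap.id (X.point x)

/-- The linear span of the points of `G`, in homogeneous coordinates at `E`. -/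
def hullSpan (E G : Finset P) : Submodule ℚ (X.Family × ℚ) :=
  Submodule.span ℚ (X.pointAt E '' (G : Set P))

variable {X}

theorem height_of_isVertex {x : P} (h : X.IsVertex x) : X.height x = 1 := if_pos h

theorem pointAt_snd (E : Finset P) (x : P) : (X.pointAt E x).2 = X.height x := rfl

theorem pointAt_mem_hullSpan {E G : Finset P} {x : P} (h : x ∈ G) :
    X.pointAt E x ∈ X.hullSpan E G :=
  Submodule.subset_span ⟨x, h, rfl⟩

theorem hullSpan_mono {E G G' : Finset P} (h : G ⊆ G') : X.hullSpan E G ≤ X.hullSpan E G' :=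
  Submodule.span_mono (Set.image_mono h)

theorem disp_eq (E : Finset P) (y x : P) :
    X.disp E y x = (X.pointAt E x).1 - X.height x • (X.pointAt E y).1 := by
  have : (fun v i => if X.IsVertex v then
      if X.IsVertex x then (X.vec v x i : ℚ) - (X.vec v y i : ℚ) else (X.vec v x i : ℚ)
      else 0 : X.Family) = (X.point x).1 - X.height x • (X.point y).1 := by
    funext v i
    by_cases hv : X.IsVertex v <;> by_cases hx : X.IsVertex x <;> simp [point, height, hv, hx]
  rw [disp, this, map_sub, map_smul]
  rfl

theorem restrict_restrict {E E' : Finset P} (h : E' ⊆ E) (u : X.Family) :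
    X.restrict E' (X.restrict E u) = X.restrict E' u := by
  funext v i
  by_cases hv : v ∈ E'
  · simp [restrict, hv, h hv]
  · simp [restrict, hv]

theorem prodMap_pointAt {E E' : Finset P} (h : E' ⊆ E) (x : P) :
    (X.restrict E').prodMap LinearMap.id (X.pointAt E x) = X.pointAt E' x := by
  simp [pointAt, restrict_restrict h]

theorem map_hullSpan {E E' : Finset P} (h : E' ⊆ E) (G : Finset P) :
    (X.hullSpan E G).map ((X.restrict E').prodMap LinearMap.id) = X.hullSpan E' G := by
  rw [hullSpan, Submodule.map_span, ← Set.image_comp]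
  congr 1
  exact Set.image_congr fun x _ => prodMap_pointAt h x

/-- The parallel space of a cell is the part of its linear hull at height 0; projecting from the
vertex `y` takes the point `x` to the displacement from `y` to `x`. -/
theorem mem_cellSpan_iff {E G : Finset P} {y : P} (hy : y ∈ G) (hv : X.IsVertex y)
    (u : X.Family) : u ∈ X.cellSpan E G ↔ (u, (0 : ℚ)) ∈ X.hullSpan E G := by
  constructor
  · intro h
    suffices X.cellSpan E G ≤ (X.hullSpan E G).comap (LinearMap.inl ℚ _ _) from this h
    rw [cellSpan, Submodule.span_le]
    rintro _ ⟨z, hz, hvz, x, hx, rfl⟩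
    have : LinearMap.inl ℚ X.Family ℚ (X.disp E z x) =
        X.pointAt E x - X.height x • X.pointAt E z := by
      ext1
      · simp [disp_eq]
      · simp [pointAt_snd, height_of_isVertex hvz]
    change LinearMap.inl ℚ X.Family ℚ (X.disp E z x) ∈ X.hullSpan E G
    rw [this]
    exact sub_mem (pointAt_mem_hullSpan hx) (Submodule.smul_mem _ _ (pointAt_mem_hullSpan hz))
  · intro h
    let f : X.Family × ℚ →ₗ[ℚ] X.Family :=
      LinearMap.fst ℚ _ _ - (LinearMap.snd ℚ _ _).smulRight (X.pointAt E y).1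
    suffices X.hullSpan E G ≤ (X.cellSpan E G).comap f by simpa [f] using this h
    rw [hullSpan, Submodule.span_le]
    rintro _ ⟨x, hx, rfl⟩
    refine Submodule.subset_span ⟨y, hy, hv, x, hx, ?_⟩
    rw [disp_eq]
    rfl

/-- The two sums differ by a multiple of the point `y`, which already lies in the hull. This removes
the base vertex from balancing conditions. -/
theorem sum_disp_mem_iff {E G : Finset P} {y : P} (hy : y ∈ G) (hv : X.IsVertex y)
    (s : Finset P) (a : P → ℚ) :
    ∑ x ∈ s, a x • X.disp E y x ∈ X.cellSpan E G ↔
      ∑ x ∈ s, a x • X.pointAt E x ∈ X.hullSpan E G := by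
  have : ((∑ x ∈ s, a x • X.disp E y x, (0 : ℚ)) : X.Family × ℚ) =
      ∑ x ∈ s, a x • X.pointAt E x - (∑ x ∈ s, a x * X.height x) • X.pointAt E y := by
    ext1
    · simp [disp_eq, Prod.fst_sum, smul_sub, Finset.sum_sub_distrib, Finset.sum_smul, smul_smul]
    · simp [Prod.snd_sum, pointAt_snd, height_of_isVertex hv]
  rw [mem_cellSpan_iff hy hv, this,
    (X.hullSpan E G).sub_mem_iff_left (Submodule.smul_mem _ _ (pointAt_mem_hullSpan hy))]

/-- In the chart at a vertex `y` of the cell, unimodularity controls all coefficients except that of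
`y`, whose vector is zero there; the last coordinate detects this one. -/
theorem linearIndepOn_pointAt {E : Finset P} (hE : E ∈ X.cells) :
    LinearIndepOn ℚ (X.pointAt E) (E : Set P) := by
  obtain ⟨y, hy, hv⟩ := X.exists_vertex E hE
  have h1 := (X.unimodular E hE y hy hv).1
  have h2 : LinearIndepOn ℚ (fun x i => (X.vec y x i : ℚ)) (E.erase y : Set P) := by
    rw [LinearIndepOn, ← LinearIndependent.iff_fractionRing ℤ ℚ]
    let f : (Fin (X.N y) → ℤ) →ₗ[ℤ] (Fin (X.N y) → ℚ) :=
      LinearMap.pi fun i => (Algebra.linearMap ℤ ℚ) ∘ₗ LinearMap.proj i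
    refine h1.linearIndependent.map' f ?_
    rw [LinearMap.ker_eq_bot]
    intro a b hab
    funext i
    have := congrFun hab i
    simpa [f] using this
  rw [linearIndepOn_finset_iff] at h2 ⊢
  intro g hg
  have h3 : ∀ x ∈ E.erase y, g x = 0 := by
    refine h2 g ?_
    have h4 : (∑ x ∈ E, g x • X.pointAt E x).1 y = 0 := by rw [hg]; rfl
    rw [← h4, ← Finset.add_sum_erase E _ hy]
    funext i
    simp [Prod.fst_sum, Finset.sum_apply, pointAt, point, restrict, hy, hv, X.vec_self y hv]
  intro x hx
  by_cases hxy : x = y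
  · have h4 : (∑ x ∈ E, g x • X.pointAt E x).2 = 0 := by rw [hg]; rfl
    rw [Prod.snd_sum, Finset.sum_eq_single_of_mem y hy] at h4
    · simpa [hxy, pointAt_snd, height_of_isVertex hv] using h4
    · intro b hb hby
      simp [h3 b (mem_erase.2 ⟨hby, hb⟩)]
  · exact h3 x (mem_erase.2 ⟨hxy, hx⟩)

end UnimodularTropicalSpace

end

/-! ### Balancing relations, descent coefficients and supports. -/

noncomputable section

/-- If a weight that is symmetric in two variables is balanced in each of them up to `u` and the
remaining variable, then the coefficients of `u` are balanced up to `u`. -/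
theorem sum_smul_mem_of_symmetric {I V : Type*} [AddCommGroup V] [Module ℚ V] {W : Submodule ℚ V}
    {u : V} (hu : u ∉ W) (e : I → V) (S : Finset I) (C : I → I → ℚ) (hC : ∀ x y, C x y = C y x)
    (a b : I → ℚ) (h : ∀ x ∈ S, ∑ y ∈ S, C x y • e y + a x • u + b x • e x ∈ W) :
    ∃ t : ℚ, ∑ x ∈ S, a x • e x - t • u ∈ W := by
  obtain ⟨f, hf, hfW⟩ := Submodule.exists_le_ker_of_notMem hu
  -- Two combinations are compared: the relations `h x` weighted by `f (e x)`, which lie in `W`, and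
  -- the vectors `e x` weighted by the values of `f` on the relations, which are zero. In the
  -- difference the `b` terms cancel identically and the `C` terms by symmetry. What remains is `f
  -- u` times the sum of the `a x • e x`, minus a multiple of `u`.
  have h1 := sum_mem (S := W) fun x (hx : x ∈ S) => Submodule.smul_mem W (f (e x)) (h x hx)
  have h2 : ∑ x ∈ S, f (∑ y ∈ S, C x y • e y + a x • u + b x • e x) • e x = 0 :=
    sum_eq_zero fun x hx => by
      rw [show f _ = 0 from hfW (h x hx), zero_smul]
  refine ⟨(f u)⁻¹ * ∑ x ∈ S, a x * f (e x), ?_⟩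
  rw [← Submodule.smul_mem_iff _ hf, smul_sub, smul_smul, ← mul_assoc, mul_inv_cancel₀ hf, one_mul]
  rw [← neg_mem_iff]
  convert h1 using 1
  rw [← sub_zero (∑ x ∈ S, f (e x) • _), ← h2]
  simp only [map_add, map_sum, map_smul, smul_add, add_smul, sum_add_distrib, smul_eq_mul,
    smul_sum, sum_smul, smul_smul]
  rw [sum_comm (s := S) (t := S) (f := fun x y => (C x y * f (e y)) • e x)]
  simp only [fun x y => hC y x, mul_comm (f _)]
  abel

namespace UnimodularTropicalSpace

variable {P : Type*} [Fintype P] [LinearOrder P] {X : UnimodularTropicalSpace P}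

/-! ### Balancing and descent in homogeneous coordinates -/

theorem IsSimplex.nonempty {Δ : Finset P} (h : X.IsSimplex Δ) : Δ.Nonempty := by
  obtain ⟨v, hv, -⟩ := X.exists_vertex Δ h.1
  exact ⟨v, hv⟩

theorem IsSimplex.subset {Δ Δ' : Finset P} (h : X.IsSimplex Δ) (h' : Δ' ⊆ Δ)
    (hne : Δ'.Nonempty) : X.IsSimplex Δ' := by
  obtain ⟨v, hv⟩ := hne
  exact ⟨X.down_closed _ h.1 _ h' ⟨v, hv, h.2 v (h' hv)⟩, fun x hx => h.2 x (h' hx)⟩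

theorem IsSimplex.cells_of_subset {Δ E F : Finset P} (h : X.IsSimplex Δ) (hE : E ∈ X.cells)
    (hΔ : Δ ⊆ F) (hF : F ⊆ E) : F ∈ X.cells := by
  obtain ⟨v, hv⟩ := h.nonempty
  exact X.down_closed _ hE _ hF ⟨v, hΔ hv, h.2 v hv⟩

theorem IsLink.subset {Δ q r : Finset P} (h : X.IsLink Δ q) (hr : r ⊆ q) : X.IsLink Δ r :=
  ⟨h.1, h.2.1.mono_right hr,
    h.1.cells_of_subset h.2.2 subset_union_left (union_subset_union_right hr)⟩

theorem isSimplex_of_subset_cell {Δ T : Finset P} (hT : T ∈ X.cells) (hΔ : Δ ⊆ T)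
    (hne : Δ.Nonempty) (hv : ∀ x ∈ Δ, X.IsVertex x) : X.IsSimplex Δ := by
  obtain ⟨v, hv'⟩ := hne
  exact ⟨X.down_closed _ hT _ hΔ ⟨v, hv', hv v hv'⟩, hv⟩

theorem propellers_balance {l k : ℕ} {c : Weights P} (hc : c ∈ X.propellers l k)
    {Δ r : Finset P} (h : X.IsLink Δ r) :
    ∑ x ∈ univ.filter (fun x => x ∉ Δ ∪ r), c Δ (insert x r) • X.pointAt (Δ ∪ r) x ∈
      X.hullSpan (Δ ∪ r) (Δ ∪ r) := by
  by_cases hr : r.card + 1 = l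
  · obtain ⟨y, hy⟩ := h.1.nonempty
    exact (sum_disp_mem_iff (mem_union_left _ hy) (h.1.2 y hy) _ _).1 (hc.2 Δ r h hr y hy)
  · rw [sum_eq_zero]
    · exact zero_mem _
    · intro x hx
      by_contra h0
      have h1 := (hc.1 _ _ (left_ne_zero_of_smul h0)).2.1
      rw [card_insert_of_notMem fun h => (mem_filter.1 hx).2 (mem_union_right _ h)] at h1
      exact hr h1

theorem mem_propellers {l k : ℕ} {c : Weights P}
    (h1 : ∀ Δ q, c Δ q ≠ 0 → Δ.card = k + 1 ∧ q.card = l ∧ X.IsLink Δ q)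
    (h2 : ∀ Δ r, X.IsLink Δ r → r.card + 1 = l →
      ∑ x ∈ univ.filter (fun x => x ∉ Δ ∪ r), c Δ (insert x r) • X.pointAt (Δ ∪ r) x ∈
        X.hullSpan (Δ ∪ r) (Δ ∪ r)) : c ∈ X.propellers l k :=
  ⟨h1, fun Δ r h hr y hy =>
    (sum_disp_mem_iff (mem_union_left _ hy) (h.1.2 y hy) _ _).2 (h2 Δ r h hr)⟩

/-- Giving `v` the weight `a` turns the condition into one sum over the complement of the cell
together with `v`, to which `sum_disp_mem_iff` applies for every base vertex. Without a vertex in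
`Δ.erase v` the condition `IsDescent` would be vacuous. -/
theorem isDescent_iff {c : Weights P} {Δ : Finset P} {v : P} {r : Finset P} {a : ℚ}
    (hΔ : X.IsSimplex Δ) (hv : v ∈ Δ) (hne : (Δ.erase v).Nonempty) :
    X.IsDescent c Δ v r a ↔
      ∑ x ∈ univ.filter (fun x => x ∉ Δ ∪ r), c Δ (insert x r) • X.pointAt (Δ ∪ r) x +
        a • X.pointAt (Δ ∪ r) v ∈ X.hullSpan (Δ ∪ r) (Δ.erase v ∪ r) := by
  have key : ∀ y ∈ Δ.erase v,
      (∑ x ∈ univ.filter (fun x => x ∉ Δ ∪ r), c Δ (insert x r) • X.disp (Δ ∪ r) y x +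
        a • X.disp (Δ ∪ r) y v ∈ X.cellSpan (Δ ∪ r) (Δ.erase v ∪ r) ↔
      ∑ x ∈ univ.filter (fun x => x ∉ Δ ∪ r), c Δ (insert x r) • X.pointAt (Δ ∪ r) x +
        a • X.pointAt (Δ ∪ r) v ∈ X.hullSpan (Δ ∪ r) (Δ.erase v ∪ r)) := by
    intro y hy
    have := sum_disp_mem_iff (E := Δ ∪ r) (G := Δ.erase v ∪ r) (mem_union_left _ hy)
      (hΔ.2 y (mem_of_mem_erase hy)) (insert v (univ.filter (fun x => x ∉ Δ ∪ r)))
      fun x => if x = v then a else c Δ (insert x r)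
    have hv' : v ∉ univ.filter (fun x => x ∉ Δ ∪ r) := by simp [hv]
    have hs : ∀ f : P → X.Family,
        ∑ x ∈ univ.filter (fun x => x ∉ Δ ∪ r), (if x = v then a else c Δ (insert x r)) • f x =
        ∑ x ∈ univ.filter (fun x => x ∉ Δ ∪ r), c Δ (insert x r) • f x := fun f =>
      sum_congr rfl fun x hx => by rw [if_neg fun h : x = v => hv' (h ▸ hx)]
    have hs' : ∀ f : P → X.Family × ℚ,
        ∑ x ∈ univ.filter (fun x => x ∉ Δ ∪ r), (if x = v then a else c Δ (insert x r)) • f x =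
        ∑ x ∈ univ.filter (fun x => x ∉ Δ ∪ r), c Δ (insert x r) • f x := fun f =>
      sum_congr rfl fun x hx => by rw [if_neg fun h : x = v => hv' (h ▸ hx)]
    rwa [sum_insert hv', sum_insert hv', if_pos rfl, hs, hs', add_comm, add_comm (a • _)] at this
  constructor
  · intro h
    obtain ⟨y, hy⟩ := hne
    exact (key y hy).1 (h y hy)
  · intro h y hy
    exact (key y hy).2 h

/-- One relation serves all `v ∈ Δ` simultaneously: its coefficients at the elements of `Δ` are the
descent coefficients, as `isDescent_of_balance` shows. The comparison of `d'` with the boundary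
relies on this. -/
theorem exists_balance {l k : ℕ} {c : Weights P} (hc : c ∈ X.propellers l k)
    {Δ r : Finset P} (h : X.IsLink Δ r) : ∃ a : P → ℚ,
      ∑ x ∈ univ.filter (fun x => x ∉ Δ ∪ r), c Δ (insert x r) • X.pointAt (Δ ∪ r) x +
        ∑ w ∈ Δ ∪ r, a w • X.pointAt (Δ ∪ r) w = 0 := by
  obtain ⟨b, hb⟩ := Submodule.mem_span_image_finset_iff_exists_fun' ℚ |>.1 (propellers_balance hc h)
  exact ⟨fun w => -b w, by rw [← hb]; simp⟩

theorem union_erase_of_isLink {Δ r : Finset P} (h : X.IsLink Δ r) {v : P} (hv : v ∈ Δ) :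
    Δ.erase v ∪ r = (Δ ∪ r).erase v := by
  rw [erase_union_distrib, erase_eq_of_notMem (disjoint_left.1 h.2.1 hv)]

theorem isDescent_of_balance {c : Weights P} {Δ r : Finset P} (h : X.IsLink Δ r) {a : P → ℚ}
    (ha : ∑ x ∈ univ.filter (fun x => x ∉ Δ ∪ r), c Δ (insert x r) • X.pointAt (Δ ∪ r) x +
        ∑ w ∈ Δ ∪ r, a w • X.pointAt (Δ ∪ r) w = 0) {v : P} (hv : v ∈ Δ)
    (hne : (Δ.erase v).Nonempty) : X.IsDescent c Δ v r (a v) := by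
  rw [isDescent_iff h.1 hv hne]
  rw [← add_sum_erase _ _ (mem_union_left r hv), ← add_assoc] at ha
  rw [eq_neg_of_add_eq_zero_left ha, union_erase_of_isLink h hv]
  exact neg_mem (sum_mem fun w hw => Submodule.smul_mem _ _ (pointAt_mem_hullSpan hw))

theorem pointAt_notMem_hullSpan {E : Finset P} (hE : E ∈ X.cells) {v : P} (hv : v ∈ E) :
    X.pointAt E v ∉ X.hullSpan E (E.erase v) := by
  have h1 := linearIndepOn_pointAt hE
  rw [← insert_erase hv, coe_insert, linearIndepOn_insert (by simp), insert_erase hv] at h1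
  exact h1.2

theorem IsDescent.unique {c : Weights P} {Δ r : Finset P} (h : X.IsLink Δ r) {v : P} (hv : v ∈ Δ)
    (hne : (Δ.erase v).Nonempty) {a b : ℚ} (ha : X.IsDescent c Δ v r a)
    (hb : X.IsDescent c Δ v r b) : a = b := by
  rw [isDescent_iff h.1 hv hne] at ha hb
  by_contra hab
  have := sub_mem ha hb
  rw [add_sub_add_left_eq_sub, ← sub_smul, union_erase_of_isLink h hv,
    Submodule.smul_mem_iff _ (sub_ne_zero.2 hab)] at this
  exact pointAt_notMem_hullSpan h.2.2 (mem_union_left _ hv) this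

theorem existsUnique_isDescent {l k : ℕ} {c : Weights P} (hc : c ∈ X.propellers l k)
    {Δ r : Finset P} (h : X.IsLink Δ r) {v : P} (hv : v ∈ Δ) (hne : (Δ.erase v).Nonempty) :
    ∃! a, X.IsDescent c Δ v r a := by
  obtain ⟨a, ha⟩ := exists_balance hc h
  exact ⟨a v, isDescent_of_balance h ha hv hne, fun b hb =>
    hb.unique h hv hne (isDescent_of_balance h ha hv hne)⟩

theorem isDescent_descent {l k : ℕ} {c : Weights P} (hc : c ∈ X.propellers l k)
    {Δ r : Finset P} (h : X.IsLink Δ r) {v : P} (hv : v ∈ Δ) (hne : (Δ.erase v).Nonempty) :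
    X.IsDescent c Δ v r (X.descent c Δ v r) :=
  Classical.epsilon_spec (existsUnique_isDescent hc h hv hne).exists

theorem IsDescent.descent_eq {c : Weights P} {Δ r : Finset P} (h : X.IsLink Δ r) {v : P}
    (hv : v ∈ Δ) (hne : (Δ.erase v).Nonempty) {a : ℚ} (ha : X.IsDescent c Δ v r a) :
    X.descent c Δ v r = a :=
  (Classical.epsilon_spec ⟨a, ha⟩ : X.IsDescent c Δ v r (X.descent c Δ v r)).unique h hv hne ha

theorem descent_eq_zero {c : Weights P} {Δ r : Finset P} (h : X.IsLink Δ r) {v : P}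
    (hv : v ∈ Δ) (hne : (Δ.erase v).Nonempty) (h0 : ∀ x ∉ Δ ∪ r, c Δ (insert x r) = 0) :
    X.descent c Δ v r = 0 := by
  refine IsDescent.descent_eq h hv hne ?_
  rw [isDescent_iff h.1 hv hne, sum_eq_zero]
  · simp
  · intro x hx
    rw [h0 x (mem_filter.1 hx).2, zero_smul]

/-! ### The maps `d'` and `d''` on propellers -/

theorem IsSimplex.erase_insert_nonempty {Δ : Finset P} (h : X.IsSimplex Δ) {v : P} (hv : v ∉ Δ) :
    ((insert v Δ).erase v).Nonempty := by
  rw [erase_insert hv]; exact h.nonempty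

theorem inclusion_support {l k : ℕ} {c : Weights P} (hc : c ∈ X.propellers l k) {Δ q : Finset P}
    (h : X.inclusion c Δ q ≠ 0) : Δ.card = k ∧ q.card = l ∧ X.IsLink Δ q := by
  rw [inclusion] at h
  split_ifs at h with hΔ
  · obtain ⟨v, hv, h1⟩ := exists_ne_zero_of_sum_ne_zero h
    obtain ⟨hvΔ, hs⟩ := (mem_filter.1 hv).2
    replace h1 := right_ne_zero_of_mul h1
    split_ifs at h1 with hvq hL
    · obtain ⟨x, hx, hx0⟩ : ∃ x ∉ insert v Δ ∪ q.erase v,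
          c (insert v Δ) (insert x (q.erase v)) ≠ 0 := by
        by_contra! h0
        exact h1 (descent_eq_zero hL (mem_insert_self _ _) (hΔ.erase_insert_nonempty hvΔ) h0)
      obtain ⟨h2, h3, h4⟩ := hc.1 _ _ hx0
      rw [card_insert_of_notMem hvΔ, add_left_inj] at h2
      rw [card_insert_of_notMem fun h => hx (mem_union_right _ h), card_erase_add_one hvq] at h3
      refine ⟨h2, h3, hΔ, ?_, ?_⟩
      · rw [← insert_erase hvq, disjoint_insert_right]
        exact ⟨hvΔ, hL.2.1.mono_left (subset_insert _ _)⟩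
      · have := hL.2.2
        rwa [insert_union, ← union_insert, insert_erase hvq] at this
    · exact absurd rfl h1
    · obtain ⟨h2, h3, h4⟩ := hc.1 _ _ h1
      rw [card_insert_of_notMem hvΔ, add_left_inj] at h2
      exact ⟨h2, h3, hΔ, h4.2.1.mono_left (subset_insert _ _),
        hΔ.cells_of_subset h4.2.2 subset_union_left
          (union_subset_union_left (subset_insert _ _))⟩
  · exact absurd rfl h

theorem gysin_support {l k : ℕ} {c : Weights P} (hc : c ∈ X.propellers l k) {Δ q : Finset P}
    (h : X.gysin c Δ q ≠ 0) : Δ.card = k + 2 ∧ q.card + 1 = l ∧ X.IsLink Δ q := by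
  rw [gysin] at h
  split_ifs at h with hL
  · obtain ⟨x, hx, h1⟩ := exists_ne_zero_of_sum_ne_zero h
    obtain ⟨h2, h3, h4⟩ := hc.1 _ _ (right_ne_zero_of_mul h1)
    rw [card_insert_of_notMem (disjoint_left.1 hL.2.1 hx)] at h3
    rw [← card_erase_add_one hx, h2]
    exact ⟨rfl, h3, hL⟩
  · exact absurd rfl h

theorem inclusion_eq_zero {l : ℕ} {c : Weights P} (hc : c ∈ X.propellers l 0) :
    X.inclusion c = 0 := by
  funext Δ q
  by_contra h
  obtain ⟨h1, -, h2⟩ := inclusion_support hc h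
  exact h2.1.nonempty.card_ne_zero h1

theorem gysin_eq_zero {k : ℕ} {c : Weights P} (hc : c ∈ X.propellers 0 k) :
    X.gysin c = 0 := by
  funext Δ q
  by_contra h
  exact absurd (gysin_support hc h).2.1 (by simp)

end UnimodularTropicalSpace

end

/-! ### The maps `d''` and `d'` preserve the balancing condition. -/

noncomputable section

namespace UnimodularTropicalSpace

variable {P : Type*} [Fintype P] [LinearOrder P] {X : UnimodularTropicalSpace P}

/-- The link test in `gysin` only discards zeros: a nonzero summand already makes `Δ ∪ q` a cell. -/
theorem gysin_apply {l k : ℕ} {c : Weights P} (hc : c ∈ X.propellers l k) {Δ q : Finset P}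
    (hΔ : X.IsSimplex Δ) (hd : Disjoint Δ q) :
    X.gysin c Δ q = ∑ z ∈ Δ, insertSign P Δ z * c (Δ.erase z) (insert z q) := by
  rw [gysin]
  split_ifs with h
  · rfl
  · refine (sum_eq_zero fun z hz => ?_).symm
    by_contra h0
    have h1 := (hc.1 _ _ (right_ne_zero_of_mul h0)).2.2.2.2
    rw [union_insert, ← insert_union, insert_erase hz] at h1
    exact h ⟨hΔ, hd, h1⟩

/-- For fixed `z` the summands form the balancing condition of `c` along `Δ \ z` at the cell of `r ∪
z`, and this is the same cell `Δ ∪ r`. Each `z` is therefore balanced separately. -/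
theorem gysin_mem {l k : ℕ} {c : Weights P} (hc : c ∈ X.propellers (l + 1) k) :
    X.gysin c ∈ X.propellers l (k + 1) := by
  refine mem_propellers (fun Δ q h => ?_) fun Δ r hL hr => ?_
  · obtain ⟨h1, h2, h3⟩ := gysin_support hc h
    exact ⟨h1, by simpa using h2, h3⟩
  · by_cases hcard : Δ.card = k + 2
    swap
    · rw [sum_eq_zero]
      · exact zero_mem _
      · intro x _
        by_contra h0
        exact hcard (gysin_support hc (left_ne_zero_of_smul h0)).1
    have hne : ∀ z ∈ Δ, (Δ.erase z).Nonempty := fun z hz => by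
      rw [← card_pos, card_erase_of_mem hz]; omega
    have hterm : ∀ x ∈ univ.filter (fun x => x ∉ Δ ∪ r),
        X.gysin c Δ (insert x r) • X.pointAt (Δ ∪ r) x = ∑ z ∈ Δ,
          insertSign P Δ z • c (Δ.erase z) (insert x (insert z r)) • X.pointAt (Δ ∪ r) x := by
      intro x hx
      rw [mem_filter, mem_union, not_or] at hx
      rw [gysin_apply hc hL.1 (disjoint_insert_right.2 ⟨hx.2.1, hL.2.1⟩), sum_smul]
      simp only [mul_smul, insert_comm x]
    rw [sum_congr rfl hterm, sum_comm]
    refine sum_mem fun z hz => ?_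
    rw [← smul_sum]
    refine Submodule.smul_mem _ _ ?_
    have hS : Δ.erase z ∪ insert z r = Δ ∪ r := by
      rw [union_insert, ← insert_union, insert_erase hz]
    have hl : X.IsLink (Δ.erase z) (insert z r) :=
      ⟨hL.1.subset (erase_subset _ _) (hne z hz), disjoint_insert_right.2
        ⟨notMem_erase _ _, hL.2.1.mono_left (erase_subset _ _)⟩, hS ▸ hL.2.2⟩
    have := propellers_balance hc hl
    rwa [hS] at this

/-- Each `v` is balanced separately. If `v ∉ r`, the condition is the defining relation of the
descent coefficient, restricted to a smaller cell. If `v ∈ r`, only descent coefficients occur;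
their relations involve the weights of `c` at two added elements, which are symmetric, so
`sum_smul_mem_of_symmetric` applies with `u` the point `v`. -/
theorem inclusion_mem {l k : ℕ} {c : Weights P} (hc : c ∈ X.propellers l (k + 1)) :
    X.inclusion c ∈ X.propellers l k := by
  refine mem_propellers (fun Δ q h => inclusion_support hc h) fun Δ r hL hr => ?_
  have hincl : ∀ x, X.inclusion c Δ (insert x r) =
      ∑ v ∈ univ.filter (fun v => v ∉ Δ ∧ X.IsSimplex (insert v Δ)),
        insertSign P (insert v Δ) v *
          (if v ∉ insert x r then c (insert v Δ) (insert x r)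
            else if X.IsLink (insert v Δ) ((insert x r).erase v) then
              X.descent c (insert v Δ) v ((insert x r).erase v)
            else 0) := fun x => by rw [inclusion, if_pos hL.1]
  simp only [hincl, sum_smul, mul_smul]
  rw [sum_comm]
  refine sum_mem fun v hv => ?_
  rw [← smul_sum]
  refine Submodule.smul_mem _ _ ?_
  obtain ⟨hvΔ, hs⟩ := (mem_filter.1 hv).2
  have hne := hL.1.erase_insert_nonempty hvΔ
  by_cases hvr : v ∈ r
  · -- the coefficients `descent c (insert v Δ) v (insert x s)` for `s = r.erase v`
    obtain ⟨s, hvs, rfl⟩ : ∃ s, v ∉ s ∧ insert v s = r := ⟨r.erase v, notMem_erase _ _, insert_erase hvr⟩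
    set S := Δ ∪ insert v s with hS
    have hS' : insert v Δ ∪ s = S := by rw [hS, insert_union, union_insert]
    have hW : (Δ ∪ s) = S.erase v := by
      rw [hS, union_insert, erase_insert (by simp [hvΔ, hvs])]
    have hvS : v ∈ S := by simp [hS]
    have hu : X.pointAt S v ∉ X.hullSpan S (Δ ∪ s) := by
      rw [hW]; exact pointAt_notMem_hullSpan hL.2.2 hvS
    set a : P → ℚ := fun x => if X.IsLink (insert v Δ) (insert x s) then
      X.descent c (insert v Δ) v (insert x s) else 0 with ha
    have hterm : ∀ x ∈ univ.filter (fun x => x ∉ S),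
        (if v ∉ insert x (insert v s) then c (insert v Δ) (insert x (insert v s))
            else if X.IsLink (insert v Δ) ((insert x (insert v s)).erase v) then
              X.descent c (insert v Δ) v ((insert x (insert v s)).erase v)
            else 0) • X.pointAt S x = a x • X.pointAt S x := by
      intro x hx
      have hxv : x ≠ v := fun h => (mem_filter.1 hx).2 (h ▸ hvS)
      rw [if_neg (by simp), insert_comm, erase_insert (by simp [hvs, hxv.symm])]
    rw [sum_congr rfl hterm]
    -- The descent relation at the larger cell `insert x S`, read in the charts of `S`. There the
    -- hull also contains the point `x`, and the unknown `b` is the multiple of this point that has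
    -- to be moved. The relation has no term `y = x`, hence the zero diagonal of the weight.
    have hb : ∀ x ∈ univ.filter (fun x => x ∉ S), ∃ b : ℚ,
        ∑ y ∈ univ.filter (fun x => x ∉ S),
          (if x = y then 0 else c (insert v Δ) (insert x (insert y s))) • X.pointAt S y +
          a x • X.pointAt S v + b • X.pointAt S x ∈ X.hullSpan S (Δ ∪ s) := by
      intro x hx
      have hxS := (mem_filter.1 hx).2
      by_cases hl : X.IsLink (insert v Δ) (insert x s)
      · have h1 := isDescent_descent hc hl (mem_insert_self v Δ) hne
        rw [isDescent_iff hl.1 (mem_insert_self v Δ) hne, erase_insert hvΔ, union_insert, hS'] at h1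
        have h2 := Submodule.mem_map_of_mem (f := (X.restrict S).prodMap LinearMap.id) h1
        rw [map_hullSpan (subset_insert _ _), map_add, map_sum, map_smul,
          prodMap_pointAt (subset_insert _ _)] at h2
        simp only [map_smul, prodMap_pointAt (subset_insert x S)] at h2
        rw [union_insert, hullSpan, coe_insert, Set.image_insert_eq,
          Submodule.mem_span_insert] at h2
        obtain ⟨t, w, hw, h3⟩ := h2
        refine ⟨-t, ?_⟩
        have h4 : ∑ y ∈ univ.filter (fun y => y ∉ S),
            (if x = y then 0 else c (insert v Δ) (insert x (insert y s))) • X.pointAt S y =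
            ∑ y ∈ univ.filter (fun y => y ∉ insert x S),
              c (insert v Δ) (insert y (insert x s)) • X.pointAt S y := by
          have h5 : univ.filter (fun y => y ∉ insert x S) =
              (univ.filter (fun y => y ∉ S)).erase x := by
            ext y; simp [not_or]
          rw [h5, ← add_sum_erase _ _ hx, if_pos rfl, zero_smul, zero_add]
          refine sum_congr rfl fun y hy => ?_
          rw [if_neg (ne_of_mem_erase hy).symm, insert_comm]
        rw [h4, show a x = _ from if_pos hl, h3]
        simpa [hullSpan] using hw
      · refine ⟨0, ?_⟩
        rw [show a x = 0 from if_neg hl, sum_eq_zero]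
        · simp
        · intro y _
          split_ifs with hxy
          · simp
          · by_contra h0
            -- Without a link at `insert x s` no weight at a larger set can be nonzero, so all terms
            -- vanish.
            exact hl ((hc.1 _ _ (left_ne_zero_of_smul h0)).2.2.subset
              (insert_subset_insert _ (subset_insert _ _)))
    choose! b hb using hb
    obtain ⟨t, ht⟩ := sum_smul_mem_of_symmetric hu (X.pointAt S) _
      (fun x y => if x = y then 0 else c (insert v Δ) (insert x (insert y s)))
      (fun x y => by simp only [eq_comm (a := x), insert_comm x]) a b hb
    have h1 := add_mem (hullSpan_mono (by rw [hW]; exact erase_subset _ _) ht)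
      (Submodule.smul_mem _ t (pointAt_mem_hullSpan (E := S) hvS))
    rwa [sub_add_cancel] at h1
  -- Here `x = v` contributes the descent coefficient and every other `x` an old weight, which
  -- together make up the relation defining that coefficient.
  · have hvS : v ∉ Δ ∪ r := by simp [hvΔ, hvr]
    rw [← add_sum_erase _ _ (show v ∈ univ.filter (fun x => x ∉ Δ ∪ r) by simpa using hvS),
      if_neg (by simp), erase_insert hvr]
    have hterm : ∀ x ∈ (univ.filter (fun x => x ∉ Δ ∪ r)).erase v,
        (if v ∉ insert x r then c (insert v Δ) (insert x r)
            else if X.IsLink (insert v Δ) ((insert x r).erase v) then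
              X.descent c (insert v Δ) v ((insert x r).erase v)
            else 0) • X.pointAt (Δ ∪ r) x =
        c (insert v Δ) (insert x r) • X.pointAt (Δ ∪ r) x := by
      intro x hx
      rw [if_pos]
      simp [(ne_of_mem_erase hx).symm, hvr]
    rw [sum_congr rfl hterm]
    by_cases hl : X.IsLink (insert v Δ) r
    · rw [if_pos hl]
      have h1 := isDescent_descent hc hl (mem_insert_self v Δ) hne
      rw [isDescent_iff hl.1 (mem_insert_self v Δ) hne, erase_insert hvΔ, insert_union] at h1
      have h2 := Submodule.mem_map_of_mem (f := (X.restrict (Δ ∪ r)).prodMap LinearMap.id) h1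
      rw [map_hullSpan (subset_insert _ _), map_add, map_sum, map_smul,
        prodMap_pointAt (subset_insert _ _)] at h2
      simp only [map_smul, prodMap_pointAt (subset_insert v (Δ ∪ r))] at h2
      rw [add_comm]
      convert h2 using 3
      ext y; simp [not_or]
    · rw [if_neg hl, zero_smul, zero_add, sum_eq_zero]
      · exact zero_mem _
      · intro x _
        by_contra h0
        exact hl ((hc.1 _ _ (left_ne_zero_of_smul h0)).2.2.subset (subset_insert _ _))

end UnimodularTropicalSpace

end

/-! ### Flags and the barycentric chain complex. -/

noncomputable section

namespace UnimodularTropicalSpace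

variable {P : Type*} [Fintype P] [LinearOrder P] {X : UnimodularTropicalSpace P}

/-! ### Flags -/

theorem Flag.ext {σ τ : X.Flag} (h : σ.1 = τ.1) : σ = τ := Subtype.ext h

theorem Flag.subset_or {σ : X.Flag} {F G : Finset P} (hF : F ∈ σ.1) (hG : G ∈ σ.1) :
    F ⊆ G ∨ G ⊆ F :=
  σ.2.2.2.total hF hG

theorem Flag.subset_of_card_le {σ : X.Flag} {F G : Finset P} (hF : F ∈ σ.1) (hG : G ∈ σ.1)
    (h : F.card ≤ G.card) : F ⊆ G := by
  rcases Flag.subset_or hF hG with h1 | h1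
  · exact h1
  · rw [eq_of_subset_of_card_le h1 h]

theorem Flag.bot_subset {σ : X.Flag} {F : Finset P} (hF : F ∈ σ.1) : σ.bot ⊆ F :=
  Finset.inf_le (f := id) hF

theorem Flag.subset_top {σ : X.Flag} {F : Finset P} (hF : F ∈ σ.1) : F ⊆ σ.top :=
  Finset.le_sup (f := id) hF

theorem Flag.bot_eq {σ : X.Flag} {F : Finset P} (hF : F ∈ σ.1) (h : ∀ G ∈ σ.1, F ⊆ G) :
    σ.bot = F :=
  (Flag.bot_subset hF).antisymm (Finset.le_inf h)

theorem Flag.top_eq {σ : X.Flag} {F : Finset P} (hF : F ∈ σ.1) (h : ∀ G ∈ σ.1, G ⊆ F) :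
    σ.top = F :=
  (Finset.sup_le h : σ.top ≤ F).antisymm (Flag.subset_top hF)

theorem Flag.bot_mem (σ : X.Flag) : σ.bot ∈ σ.1 := by
  obtain ⟨F, hF, h⟩ := exists_min_image σ.1 Finset.card σ.2.1
  rwa [Flag.bot_eq hF fun G hG => Flag.subset_of_card_le hF hG (h G hG)]

theorem Flag.top_mem (σ : X.Flag) : σ.top ∈ σ.1 := by
  obtain ⟨F, hF, h⟩ := exists_max_image σ.1 Finset.card σ.2.1
  rwa [Flag.top_eq hF fun G hG => Flag.subset_of_card_le hG hF (h G hG)]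

theorem Flag.bot_subset_top (σ : X.Flag) : σ.bot ⊆ σ.top := Flag.bot_subset σ.top_mem

theorem Flag.top_mem_cells (σ : X.Flag) : σ.top ∈ X.cells := σ.2.2.1 _ σ.top_mem

theorem Flag.bot_mem_cells (σ : X.Flag) : σ.bot ∈ X.cells := σ.2.2.1 _ σ.bot_mem

theorem Flag.injOn_card (σ : X.Flag) : Set.InjOn Finset.card (σ.1 : Set (Finset P)) :=
  fun _ hF _ hG h => (Flag.subset_of_card_le hF hG h.le).antisymm
    (Flag.subset_of_card_le hG hF h.ge)

/-- The cells which can be added to a flag. -/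
def IsCoface (τ : X.Flag) (F : Finset P) : Prop :=
  F ∉ τ.1 ∧ F ∈ X.cells ∧ ∀ G ∈ τ.1, F ⊆ G ∨ G ⊆ F

/-- The flag with a cell added, if possible. -/
def Flag.ins (τ : X.Flag) (F : Finset P) : X.Flag :=
  if h : IsCoface τ F then
    ⟨insert F τ.1, insert_nonempty _ _, by
      intro G hG
      rcases mem_insert.1 hG with rfl | hG
      · exact h.2.1
      · exact τ.2.2.1 G hG, by
      rw [coe_insert]
      exact τ.2.2.2.insert fun G hG _ => h.2.2 G hG⟩
  else τ

theorem IsCoface.ins_val {τ : X.Flag} {F : Finset P} (h : IsCoface τ F) :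
    (τ.ins F).1 = insert F τ.1 :=
  congrArg Subtype.val (dif_pos h)

theorem IsCoface.card_ins {τ : X.Flag} {F : Finset P} (h : IsCoface τ F) :
    (τ.ins F).1.card = τ.1.card + 1 := by
  rw [h.ins_val, card_insert_of_notMem h.1]

theorem exists_isCoface {σ τ : X.Flag} (h : τ.1 ⊆ σ.1) (hc : τ.1.card + 1 = σ.1.card) :
    ∃ F, IsCoface τ F ∧ σ = τ.ins F := by
  obtain ⟨F, hF, h1⟩ := exists_eq_insert_iff.2 ⟨h, hc⟩
  have hFσ : F ∈ σ.1 := h1 ▸ mem_insert_self _ _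
  have h2 : IsCoface τ F := ⟨hF, σ.2.2.1 F hFσ, fun G hG => Flag.subset_or hFσ (h hG)⟩
  exact ⟨F, h2, Flag.ext (by rw [h2.ins_val, h1])⟩

/-- Turns sums over flags into sums over the single cell that is added, which is how the boundary is
analysed throughout. -/
theorem sum_cofaces {M : Type*} [AddCommMonoid M] (τ : X.Flag) (f : X.Flag → M) :
    ∑ σ, (if τ.1 ⊆ σ.1 ∧ τ.1.card + 1 = σ.1.card then f σ else 0) =
      ∑ F ∈ univ.filter (IsCoface τ), f (τ.ins F) := by
  rw [← sum_filter]
  refine (sum_bij (fun F _ => τ.ins F) ?_ ?_ ?_ ?_).symm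
  · intro F hF
    have hF := (mem_filter.1 hF).2
    simp [hF.ins_val, hF.1]
  · intro F hF G hG h
    have hF := (mem_filter.1 hF).2
    have hG := (mem_filter.1 hG).2
    have h1 := congrArg Subtype.val h
    rw [hF.ins_val, hG.ins_val] at h1
    have h2 : F ∈ insert G τ.1 := h1 ▸ mem_insert_self _ _
    exact (mem_insert.1 h2).resolve_right hF.1
  · intro σ hσ
    obtain ⟨h1, h2⟩ := (mem_filter.1 hσ).2
    obtain ⟨F, hF, rfl⟩ := exists_isCoface h1 h2
    exact ⟨F, by simp [hF], rfl⟩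
  · intro F _
    rfl

theorem IsCoface.faceSign_eq {τ : X.Flag} {F : Finset P} (h : IsCoface τ F) :
    X.faceSign (τ.ins F) τ = (-1) ^ (τ.1.filter fun G => G ⊂ F).card := by
  rw [faceSign, h.ins_val]
  congr 2
  ext G
  simp only [mem_filter, mem_insert, mem_sdiff]
  constructor
  · rintro ⟨h1, K, ⟨rfl | h2, h3⟩, h4⟩
    · refine ⟨h1.resolve_left ?_, h4⟩
      rintro rfl
      exact ssubset_irrefl _ h4
    · exact absurd h2 h3
  · rintro ⟨h1, h2⟩
    exact ⟨Or.inr h1, F, ⟨Or.inl rfl, h.1⟩, h2⟩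

/-! ### The boundary -/

theorem push_push {σ τ υ : X.Flag} (h : τ.1 ⊆ σ.1) (h' : υ.1 ⊆ τ.1) (a : X.Coef σ) :
    push h' (push h a) = push (h'.trans h) a := by
  have : (ExteriorAlgebra.map (Submodule.mapQ _ _ (X.restrict υ.top) (divSpan_le h'))).comp
      (ExteriorAlgebra.map (Submodule.mapQ _ _ (X.restrict τ.top) (divSpan_le h))) =
      ExteriorAlgebra.map (Submodule.mapQ _ _ (X.restrict υ.top) (divSpan_le (h'.trans h))) := by
    rw [ExteriorAlgebra.map_comp_map]
    congr 1
    refine Submodule.linearMap_qext _ (LinearMap.ext fun u => ?_)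
    exact congrArg (Submodule.mkQ _)
      (restrict_restrict (Finset.sup_mono h' : υ.top ⊆ τ.top) u)
  exact DFunLike.congr_fun this a

/-- The coefficient map, extended by zero. -/
def pushOrZero (σ τ : X.Flag) : X.Coef σ →ₗ[ℚ] X.Coef τ :=
  if h : τ.1 ⊆ σ.1 then push h else 0

/-- The incidence number of two flags. -/
def incidence (σ τ : X.Flag) : ℚ :=
  if τ.1 ⊆ σ.1 ∧ τ.1.card + 1 = σ.1.card then X.faceSign σ τ else 0

theorem boundary_apply (a : X.Chain) (τ : X.Flag) :
    X.boundary a τ = ∑ σ, incidence σ τ • pushOrZero σ τ (a σ) := by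
  rw [boundary, LinearMap.pi_apply, LinearMap.sum_apply]
  refine sum_congr rfl fun σ _ => ?_
  by_cases h : τ.1 ⊆ σ.1 ∧ τ.1.card + 1 = σ.1.card
  · simp [incidence, pushOrZero, h]
  · rw [dif_neg h, incidence, if_neg h, zero_smul]; rfl

theorem coefF_push {p : ℕ} {σ τ : X.Flag} (h : τ.1 ⊆ σ.1) {a : X.Coef σ} (ha : a ∈ X.coefF p σ) :
    push h a ∈ X.coefF p τ := by
  suffices X.coefF p σ ≤ (X.coefF p τ).comap (push h) from this ha
  rw [coefF, Submodule.span_le]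
  rintro _ ⟨G, hG, hσG, u, hu, rfl⟩
  have htop : τ.top ⊆ σ.top := Finset.sup_mono h
  refine Submodule.subset_span ⟨G, hG, htop.trans hσG, fun i => X.restrict τ.top (u i), ?_, ?_⟩
  · intro i
    suffices X.cellSpan σ.top G ≤ (X.cellSpan τ.top G).comap (X.restrict τ.top) from this (hu i)
    rw [cellSpan, Submodule.span_le]
    rintro _ ⟨y, hy, hv, x, hx, rfl⟩
    exact Submodule.subset_span ⟨y, hy, hv, x, hx, restrict_disp htop y x⟩
  · change (ExteriorAlgebra.map _) _ = _
    rw [ExteriorAlgebra.map_apply_ιMulti]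
    rfl

theorem boundary_mem {p q : ℕ} {a : X.Chain} (ha : a ∈ X.barChains p (q + 1)) :
    X.boundary a ∈ X.barChains p q := by
  intro τ
  rw [boundary_apply]
  constructor
  · refine sum_mem fun σ _ => Submodule.smul_mem _ _ ?_
    rw [pushOrZero]
    split_ifs with h
    · exact coefF_push h (ha σ).1
    · exact zero_mem _
  · intro hτ
    refine sum_eq_zero fun σ _ => ?_
    rw [incidence]
    split_ifs with h
    · rw [(ha σ).2 (by omega), map_zero, smul_zero]
    · rw [zero_smul]

theorem boundary_eq_zero {p : ℕ} {a : X.Chain} (ha : a ∈ X.barChains p 0) : X.boundary a = 0 := by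
  funext τ
  rw [boundary_apply]
  refine sum_eq_zero fun σ _ => ?_
  rw [incidence]
  split_ifs with h
  · have := card_pos.2 τ.2.1
    rw [(ha σ).2 (by omega), map_zero, smul_zero]
  · rw [zero_smul]

/-- Between two flags whose sizes differ by two lie exactly two flags. Removing the smaller missing
cell shifts the position of the larger one by one, so the two products of signs are opposite. -/
theorem sum_incidence (σ υ : X.Flag) : ∑ τ, incidence σ τ * incidence τ υ = 0 := by
  have h1 : ∀ τ, incidence σ τ * incidence τ υ =
      if υ.1 ⊆ τ.1 ∧ υ.1.card + 1 = τ.1.card then incidence σ τ * X.faceSign τ υ else 0 := by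
    intro τ
    rw [incidence.eq_1 τ υ, mul_ite, mul_zero]
  rw [sum_congr rfl fun τ _ => h1 τ, sum_cofaces υ fun τ => incidence σ τ * X.faceSign τ υ]
  by_cases h : υ.1 ⊆ σ.1 ∧ υ.1.card + 2 = σ.1.card
  swap
  · refine sum_eq_zero fun F hF => ?_
    have hF := (mem_filter.1 hF).2
    rw [incidence, if_neg, zero_mul]
    rintro ⟨h2, h3⟩
    rw [hF.ins_val] at h2
    rw [hF.card_ins] at h3
    exact h ⟨(subset_insert _ _).trans h2, h3⟩
  have hcard : (σ.1 \ υ.1).card = 2 := by rw [card_sdiff_of_subset h.1]; omega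
  obtain ⟨F, G, hFG, hs⟩ : ∃ F G, F ⊂ G ∧ σ.1 \ υ.1 = {F, G} := by
    obtain ⟨F, G, hne, hs⟩ := card_eq_two.1 hcard
    have hF : F ∈ σ.1 := (mem_sdiff.1 (hs ▸ mem_insert_self F {G} : F ∈ σ.1 \ υ.1)).1
    have hG : G ∈ σ.1 := (mem_sdiff.1 (hs ▸ (by simp) : G ∈ σ.1 \ υ.1)).1
    rcases Flag.subset_or hF hG with h2 | h2
    · exact ⟨F, G, h2.ssubset_of_ne hne, hs⟩
    · exact ⟨G, F, h2.ssubset_of_ne hne.symm, by rw [hs, pair_comm]⟩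
  have hF : F ∈ σ.1 \ υ.1 := by rw [hs]; simp
  have hG : G ∈ σ.1 \ υ.1 := by rw [hs]; simp
  rw [mem_sdiff] at hF hG
  have hσ : σ.1 = insert F (insert G υ.1) := by
    rw [← sdiff_union_of_subset h.1, hs]; ext; simp
  have hcF : IsCoface υ F := ⟨hF.2, σ.2.2.1 F hF.1, fun H hH => Flag.subset_or hF.1 (h.1 hH)⟩
  have hcG : IsCoface υ G := ⟨hG.2, σ.2.2.1 G hG.1, fun H hH => Flag.subset_or hG.1 (h.1 hH)⟩
  have hcFG : IsCoface (υ.ins F) G := by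
    refine ⟨?_, hcG.2.1, fun H hH => Flag.subset_or hG.1 ?_⟩
    · rw [hcF.ins_val]; simp [hG.2, hFG.ne']
    · rw [hcF.ins_val] at hH
      rw [hσ]
      exact insert_subset_insert _ (subset_insert _ _) hH
  have hcGF : IsCoface (υ.ins G) F := by
    refine ⟨?_, hcF.2.1, fun H hH => Flag.subset_or hF.1 ?_⟩
    · rw [hcG.ins_val]; simp [hF.2, hFG.ne]
    · rw [hcG.ins_val] at hH
      rw [hσ]
      exact mem_insert_of_mem hH
  have e1 : (υ.ins F).ins G = σ := Flag.ext (by rw [hcFG.ins_val, hcF.ins_val, hσ, insert_comm])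
  have e2 : (υ.ins G).ins F = σ := Flag.ext (by rw [hcGF.ins_val, hcG.ins_val, hσ])
  have i1 : incidence σ (υ.ins F) = X.faceSign σ (υ.ins F) := by
    rw [incidence, if_pos]
    rw [← e1, hcFG.card_ins, hcFG.ins_val]
    exact ⟨subset_insert _ _, rfl⟩
  have i2 : incidence σ (υ.ins G) = X.faceSign σ (υ.ins G) := by
    rw [incidence, if_pos]
    rw [← e2, hcGF.card_ins, hcGF.ins_val]
    exact ⟨subset_insert _ _, rfl⟩
  rw [← sum_subset (s₁ := {F, G}), sum_pair hFG.ne, i1, i2, hcF.faceSign_eq, hcG.faceSign_eq]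
  · have f1 := hcFG.faceSign_eq
    have f2 := hcGF.faceSign_eq
    rw [e1] at f1
    rw [e2] at f2
    rw [f1, f2, hcF.ins_val, hcG.ins_val, filter_insert, if_pos hFG, filter_insert,
      if_neg hFG.not_gt, card_insert_of_notMem (by simp [hF.2])]
    ring
  · intro H hH
    rcases mem_insert.1 hH with rfl | hH
    · simp [hcF]
    · rw [mem_singleton.1 hH]; simp [hcG]
  · intro H hH hHFG
    have hH := (mem_filter.1 hH).2
    rw [incidence, if_neg, zero_mul]
    rintro ⟨h2, -⟩
    rw [hH.ins_val] at h2
    exact hHFG (hs ▸ mem_sdiff.2 ⟨h2 (mem_insert_self _ _), hH.1⟩)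

theorem boundary_boundary (a : X.Chain) : X.boundary (X.boundary a) = 0 := by
  funext υ
  rw [boundary_apply]
  have h1 : ∀ τ, incidence τ υ • pushOrZero τ υ (X.boundary a τ) =
      ∑ σ, (incidence σ τ * incidence τ υ) • pushOrZero σ υ (a σ) := by
    intro τ
    rw [boundary_apply, map_sum, smul_sum]
    refine sum_congr rfl fun σ _ => ?_
    rw [map_smul, smul_smul, mul_comm]
    by_cases h : τ.1 ⊆ σ.1 ∧ υ.1 ⊆ τ.1
    · rw [pushOrZero, dif_pos h.2, pushOrZero, dif_pos h.1, pushOrZero, dif_pos (h.2.trans h.1),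
        push_push]
    · have : incidence σ τ * incidence τ υ = 0 := by
        rw [not_and_or] at h
        rcases h with h | h
        · rw [incidence, if_neg fun h' => h h'.1, zero_mul]
        · rw [incidence.eq_1 τ υ, if_neg fun h' => h h'.1, mul_zero]
      rw [this, zero_smul, zero_smul]
  rw [sum_congr rfl fun τ _ => h1 τ, sum_comm]
  simp only [← sum_smul, sum_incidence, zero_smul, sum_const_zero]
  rfl

end UnimodularTropicalSpace

end

/-! ### Volumes as contractions, orientation signs, and the coefficients of `c[-r]`. -/

noncomputable section

namespace UnimodularTropicalSpace

variable {P : Type*} [Fintype P] [LinearOrder P] {X : UnimodularTropicalSpace P}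

open CliffordAlgebra (contractLeft)
open ExteriorAlgebra (wedge)

/-! ### Volume elements in homogeneous coordinates -/

variable (X) in
/-- The volume element of the increasingly ordered cell `S`: the contraction, with the last
coordinate, of the product of the homogeneous coordinates of its vertices and directions. -/
def hullVol (S : Finset P) : ExteriorAlgebra ℚ (X.Family × ℚ) :=
  contractLeft (Q := 0) (LinearMap.snd ℚ X.Family ℚ) (wedge X.point S)

/-- Forget the last coordinate and pass to the tangent space at a simplex. -/
def toTangent (σ : X.Flag) : X.Family × ℚ →ₗ[ℚ] X.Family ⧸ X.divSpan σ.top σ.bot :=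
  (X.divSpan σ.top σ.bot).mkQ ∘ₗ X.restrict σ.top ∘ₗ LinearMap.fst ℚ X.Family ℚ

/-- The map of exterior algebras induced by `toTangent`. -/
def toCoef (σ : X.Flag) : ExteriorAlgebra ℚ (X.Family × ℚ) →ₐ[ℚ] X.Coef σ :=
  ExteriorAlgebra.map (toTangent σ)

/-- Allows coefficients of different flags to be compared in one exterior algebra, with the face
maps becoming invisible. -/
theorem push_toCoef {σ τ : X.Flag} (h : τ.1 ⊆ σ.1) (a : ExteriorAlgebra ℚ (X.Family × ℚ)) :
    push h (toCoef σ a) = toCoef τ a := by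
  have : (ExteriorAlgebra.map (Submodule.mapQ _ _ (X.restrict τ.top) (divSpan_le h))).comp
      (toCoef σ) = toCoef τ := by
    rw [toCoef, toCoef, ExteriorAlgebra.map_comp_map]
    congr 1
    refine LinearMap.ext fun u => ?_
    exact congrArg (Submodule.mkQ _) (restrict_restrict (Finset.sup_mono h : τ.top ⊆ σ.top) u.1)
  exact DFunLike.congr_fun this a

theorem toTangent_point_sub (σ : X.Flag) (y x : P) :
    toTangent σ (X.point x - X.height x • X.point y) =
      (X.divSpan σ.top σ.bot).mkQ (X.disp σ.top y x) := by
  rw [disp_eq, map_sub, map_smul, map_sub (Submodule.mkQ _), map_smul (Submodule.mkQ _)]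
  rfl

theorem vol_cons (σ : X.Flag) {y : P} (hy : X.IsVertex y) (L : List P) :
    X.vol σ (y :: L) = toCoef σ (contractLeft (Q := 0) (LinearMap.snd ℚ X.Family ℚ)
      ((y :: L).map fun x => ExteriorAlgebra.ι ℚ (X.point x)).prod) := by
  rw [ExteriorAlgebra.contract_prod_cons _ _ _ (height_of_isVertex hy), toCoef, map_list_prod,
    List.map_map, vol]
  congr 2
  funext x
  rw [Function.comp_apply, ExteriorAlgebra.map_apply_ι]
  exact congrArg _ (toTangent_point_sub σ y x).symm

/-- The sign sorts the elements of `A` and `q` into one increasing list; afterwards the volume no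
longer depends on a starting vertex. -/
theorem vol_sort_append (σ : X.Flag) {A q : Finset P} (hne : A.Nonempty)
    (hA : ∀ x ∈ A, X.IsVertex x) (hd : Disjoint A q) :
    X.vol σ (A.sort (· ≤ ·) ++ q.sort (· ≤ ·)) =
      (-1 : ℚ) ^ crossings A q • toCoef σ (X.hullVol (A ∪ q)) := by
  obtain ⟨y, L, hL⟩ : ∃ y L, A.sort (· ≤ ·) = y :: L := by
    refine List.exists_cons_of_ne_nil fun h => ?_
    have := congrArg List.length h
    rw [length_sort] at this
    exact hne.card_ne_zero this
  have hy : y ∈ A := by rw [← mem_sort (· ≤ ·), hL]; simp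
  rw [hL, List.cons_append, vol_cons σ (hA y hy), ← List.cons_append, ← hL, List.map_append,
    List.prod_append]
  change toCoef σ (contractLeft (Q := 0) _ (wedge X.point A * wedge X.point q)) = _
  rw [ExteriorAlgebra.wedge_mul_wedge _ hd, map_smul, map_smul]
  rfl

/-- A divisorial direction has height 0, so its vector survives contraction as a factor; if it
belongs to the sedentarity of the flag, this factor is zero in the quotient. -/
theorem toCoef_hullVol_eq_zero (σ : X.Flag) {S : Finset P} {x : P} (hS : x ∈ S)
    (hx : x ∈ σ.bot) (hv : ¬ X.IsVertex x) : toCoef σ (X.hullVol S) = 0 := by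
  have h0 : X.height x = 0 := if_neg hv
  have h1 : toTangent σ (X.point x) = 0 := by
    have := toTangent_point_sub σ x x
    rw [h0, zero_smul, sub_zero] at this
    rw [this, Submodule.mkQ_apply, Submodule.Quotient.mk_eq_zero]
    exact Submodule.subset_span ⟨x, hx, hv, rfl⟩
  rw [hullVol, ← insert_erase hS, ExteriorAlgebra.wedge_insert_eq _ (notMem_erase _ _), map_smul,
    ExteriorAlgebra.contract_ι_mul, map_smul, map_sub, map_smul, map_mul]
  rw [show LinearMap.snd ℚ X.Family ℚ (X.point x) = 0 from h0, toCoef,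
    ExteriorAlgebra.map_apply_ι, h1]
  simp

/-- Contracting twice with the same functional gives zero. This is the linear relation between the
volume elements of the facets of a simplex; facets opposite to a divisorial direction do not enter.
-/
theorem sum_hullVol_erase (S : Finset P) :
    ∑ x ∈ S, ((-1 : ℚ) ^ countLT S x * X.height x) • X.hullVol (S.erase x) = 0 := by
  have h := CliffordAlgebra.contractLeft_contractLeft (Q := 0) (LinearMap.snd ℚ X.Family ℚ)
    (wedge (R := ℚ) X.point S)
  rw [ExteriorAlgebra.contract_wedge, map_sum] at h
  rw [← h]
  refine sum_congr rfl fun x _ => ?_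
  rw [map_smul]
  rfl

/-! ### Orientations -/

/-- The number of the step in which a flag reaches `x`. -/
def Flag.level (σ : X.Flag) (x : P) : ℕ := (σ.1.filter fun F => x ∉ F).card

/-- The sign of the order in which the elements of `σ.top` appear in `σ`, for the factor of a pair. -/
def Flag.pairSign (σ : X.Flag) (z : P × P) : ℚ :=
  if z.1 ∈ σ.top ∧ z.2 ∈ σ.top ∧ σ.level z.2 < σ.level z.1 then -1 else 1

/-- The sign of the order in which the elements of `σ.top` appear in `σ`. -/
def Flag.orientation (σ : X.Flag) : ℚ :=
  ∏ z ∈ univ.filter (fun z : P × P => z.1 < z.2), σ.pairSign z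

/-- Writing a sign as a product over unordered pairs allows permutations to be compared pair by
pair. -/
theorem neg_one_pow_card_pairs (p : P → P → Prop) [DecidableRel p] (hp : ∀ x, ¬ p x x) :
    (-1 : ℚ) ^ (univ.filter fun z : P × P => p z.1 z.2).card =
      ∏ z ∈ univ.filter (fun z : P × P => z.1 < z.2),
        ((if p z.1 z.2 then -1 else 1) * (if p z.2 z.1 then -1 else 1)) := by
  rw [← prod_const, prod_filter, prod_mul_distrib,
    ← prod_filter_mul_prod_filter_not univ (fun z : P × P => z.1 < z.2)]
  congr 1
  rw [← prod_filter_mul_prod_filter_not (univ.filter fun z : P × P => ¬ z.1 < z.2)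
    (fun z : P × P => z.2 < z.1)]
  rw [prod_eq_one (s := filter (fun z : P × P => ¬ z.2 < z.1) _), mul_one]
  · refine prod_bij' (fun z _ => z.swap) (fun z _ => z.swap) ?_ ?_ ?_ ?_ ?_
    · intro z hz
      simpa using (mem_filter.1 hz).2
    · intro z hz
      have := (mem_filter.1 hz).2
      simpa using ⟨this.le, this⟩
    · intro z _; rfl
    · intro z _; rfl
    · intro z _; rfl
  · intro z hz
    rw [mem_filter, mem_filter] at hz
    have : z.1 = z.2 := le_antisymm (not_lt.1 hz.2) (not_lt.1 hz.1.2)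
    rw [this, if_neg (hp _)]

/-- Both orders are compared with the increasing one, where the order with `Δ` in front contributes
only the crossings. The dependence on `Δ` is thus separated from a sign that belongs to the flag. -/
theorem flagSign_eq (σ : X.Flag) {Δ : Finset P} (hΔ : Δ ⊆ σ.top) :
    X.flagSign Δ σ = (-1) ^ crossings Δ (σ.top \ Δ) * σ.orientation := by
  have h1 : ((σ.top ×ˢ σ.top).filter fun z =>
      X.flagBefore σ z.1 z.2 ∧ cellBefore P Δ z.2 z.1) =
      univ.filter fun z : P × P => (z.1 ∈ σ.top ∧ z.2 ∈ σ.top) ∧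
        X.flagBefore σ z.1 z.2 ∧ cellBefore P Δ z.2 z.1 := by
    ext z; simp
  have h2 : ((Δ ×ˢ (σ.top \ Δ)).filter fun z => z.2 < z.1) =
      univ.filter fun z : P × P => z.1 ∈ Δ ∧ z.2 ∈ σ.top ∧ z.2 ∉ Δ ∧ z.2 < z.1 := by
    ext z; simp [and_assoc]
  rw [flagSign, crossings, h1, h2,
    neg_one_pow_card_pairs fun x y => (x ∈ σ.top ∧ y ∈ σ.top) ∧
      X.flagBefore σ x y ∧ cellBefore P Δ y x,
    neg_one_pow_card_pairs fun x y => x ∈ Δ ∧ y ∈ σ.top ∧ y ∉ Δ ∧ y < x, Flag.orientation,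
    ← prod_mul_distrib]
  · refine prod_congr rfl fun z hz => ?_
    obtain ⟨a, b⟩ := z
    have hab : a < b := (mem_filter.1 hz).2
    have hba : ¬ b < a := hab.not_gt
    simp only [Flag.pairSign, flagBefore, cellBefore]
    change (if _ ∧ (σ.level a < σ.level b ∨ σ.level a = σ.level b ∧ _) ∧ _ then _ else _) *
      (if _ ∧ (σ.level b < σ.level a ∨ σ.level b = σ.level a ∧ _) ∧ _ then _ else _) = _
    by_cases ha : a ∈ Δ <;> by_cases hb : b ∈ Δ
    · have ha' := hΔ ha
      have hb' := hΔ hb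
      simp [ha, hb, ha', hb', hab, hba]
    · have ha' := hΔ ha
      simp only [ha, hb, ha', hab, hba]
      by_cases hb' : b ∈ σ.top <;> simp [hb']
    · have hb' := hΔ hb
      simp only [ha, hb, hb', hab, hba]
      by_cases ha' : a ∈ σ.top
      · rcases lt_trichotomy (σ.level a) (σ.level b) with h | h | h
        · simp [ha', h, h.not_gt]
        · simp [ha', h]
        · simp [ha', h, h.not_gt, h.ne']
      · simp [ha']
    · simp [ha, hb, hab, hba, and_assoc, and_left_comm (a := b ∈ σ.top)]
  · rintro x ⟨h3, -, h4, -⟩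
    exact h4 h3
  · rintro x ⟨-, -, h3⟩
    simp [cellBefore] at h3

/-! ### The chain of a propeller -/

/-- The simplices between two cells. -/
def between (B T : Finset P) : Finset (Finset P) := univ.filter fun Δ => B ⊆ Δ ∧ Δ ⊆ T

theorem mem_between {B T Δ : Finset P} : Δ ∈ between B T ↔ B ⊆ Δ ∧ Δ ⊆ T := by simp [between]

variable (X) in
/-- The coefficient of `c[-r]` at flags from `B` to `T`, in homogeneous coordinates. -/
def bracketCoef (c : Weights P) (B T : Finset P) : ExteriorAlgebra ℚ (X.Family × ℚ) :=
  ∑ Δ ∈ between B T,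
    ((-1 : ℚ) ^ crossings (Δ \ B) (T \ Δ) * c Δ (T \ Δ)) • X.hullVol (B ∪ (T \ Δ))

/-- A flag is saturated if it cannot be refined between its smallest and its largest cell. -/
def Flag.IsSaturated (σ : X.Flag) : Prop := σ.1.card + σ.bot.card = σ.top.card + 1

theorem framedDual_eq_zero {Δ q Δ' : Finset P} {σ : X.Flag} (h : ¬ X.IsDualFlag Δ' (Δ ∪ q) σ) :
    X.framedDual Δ q Δ' σ = 0 := if_neg h

theorem bracket_eq_sum (r : ℕ) (c : Weights P) (σ : X.Flag) :
    X.bracket r c σ = ∑ Δ : Finset P, ∑ q ∈ univ.filter (fun q => X.IsLink Δ q),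
      ∑ Δ' ∈ Δ.powersetCard (r + 1), c Δ q • X.framedDual Δ q Δ' σ := by
  simp only [bracket, LinearMap.coe_mk, AddHom.coe_mk, Finset.sum_apply, Pi.smul_apply]

/-- The orientation contributes the crossings of `Δ` with the remaining elements and the volume
those of `σ.bot`; together the crossings of `Δ \ σ.bot` are left. -/
theorem IsSimplex.framedDual_eq {σ : X.Flag} {Δ : Finset P} (hΔ : X.IsSimplex Δ)
    (hB : σ.bot ⊆ Δ) (hT : Δ ⊆ σ.top) (hsat : σ.IsSaturated) :
    X.framedDual Δ (σ.top \ Δ) σ.bot σ =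
      (σ.orientation * (-1) ^ ((σ.bot.card - 1) * (Δ.card - 1) + (σ.bot.card - 1).choose 2)) •
        (-1 : ℚ) ^ crossings (Δ \ σ.bot) (σ.top \ Δ) •
          toCoef σ (X.hullVol (σ.bot ∪ (σ.top \ Δ))) := by
  have h1 : Δ ∪ σ.top \ Δ = σ.top := union_sdiff_of_subset hT
  obtain ⟨v, hv, -⟩ := X.exists_vertex _ σ.bot_mem_cells
  rw [framedDual, h1, if_pos ⟨rfl, rfl, hsat⟩, flagSign_eq σ hT,
    vol_sort_append σ ⟨v, hv⟩ (fun x hx => hΔ.2 x (hB hx))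
      (disjoint_sdiff.mono_left hB), smul_smul, smul_smul]
  congr 1
  have h2 : crossings Δ (σ.top \ Δ) =
      crossings σ.bot (σ.top \ Δ) + crossings (Δ \ σ.bot) (σ.top \ Δ) := by
    rw [← crossings_union_left disjoint_sdiff, union_sdiff_of_subset hB]
  have h3 : (-1 : ℚ) ^ crossings σ.bot (σ.top \ Δ) * (-1) ^ crossings σ.bot (σ.top \ Δ) = 1 := by
    rw [← mul_pow]; simp
  rw [h2, pow_add _ (crossings _ _)]
  linear_combination ((-1) ^ ((σ.bot.card - 1) * (Δ.card - 1) + (σ.bot.card - 1).choose 2) *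
    (-1) ^ crossings (Δ \ σ.bot) (σ.top \ Δ) * σ.orientation) * h3

theorem bracket_apply {k r : ℕ} {c : Weights P}
    (hc : ∀ Δ q, c Δ q ≠ 0 → Δ.card = k + 1 ∧ X.IsLink Δ q) (σ : X.Flag) :
    X.bracket r c σ = if σ.bot.card = r + 1 ∧ σ.IsSaturated then
      (σ.orientation * (-1) ^ (r * k + r.choose 2)) • toCoef σ (X.bracketCoef c σ.bot σ.top)
      else 0 := by
  rw [bracket_eq_sum]
  split_ifs with h
  · rw [bracketCoef, map_sum, smul_sum, between, sum_filter]
    refine sum_congr rfl fun Δ _ => ?_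
    -- The ends of the flag determine the term: only `q = σ.top \ Δ` and `Δ' = σ.bot` can
    -- contribute.
    by_cases hΔ : (σ.bot ⊆ Δ ∧ Δ ⊆ σ.top) ∧ c Δ (σ.top \ Δ) ≠ 0
    · obtain ⟨hcard, hL⟩ := hc _ _ hΔ.2
      rw [if_pos hΔ.1, sum_eq_single_of_mem (σ.top \ Δ) (by simpa using hL),
        sum_eq_single_of_mem σ.bot (mem_powersetCard.2 ⟨hΔ.1.1, h.1⟩),
        hL.1.framedDual_eq hΔ.1.1 hΔ.1.2 h.2, h.1, hcard, map_smul, smul_smul, smul_smul,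
        smul_smul, Nat.add_sub_cancel, Nat.add_sub_cancel]
      · congr 1
        ring
      · intro Δ' _ hne
        rw [framedDual_eq_zero fun h' => hne h'.1.symm, smul_zero]
      · intro q hq hne
        refine sum_eq_zero fun Δ' _ => ?_
        rw [framedDual_eq_zero, smul_zero]
        rintro ⟨-, h', -⟩
        refine hne ?_
        rw [h', union_sdiff_cancel_left (mem_filter.1 hq).2.2.1]
    · rw [sum_eq_zero]
      · split_ifs with h1
        · rw [not_and, not_not] at hΔ
          rw [hΔ h1]; simp
        · rfl
      · intro q hq
        refine sum_eq_zero fun Δ' hΔ' => ?_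
        by_contra h0
        have h1 : X.IsDualFlag Δ' (Δ ∪ q) σ := by
          by_contra h1
          rw [framedDual_eq_zero h1, smul_zero] at h0
          exact h0 rfl
        obtain ⟨h2, h3, -⟩ := h1
        have h4 : σ.top \ Δ = q := by
          rw [h3, union_sdiff_cancel_left (mem_filter.1 hq).2.2.1]
        refine hΔ ⟨⟨h2 ▸ (mem_powersetCard.1 hΔ').1, h3 ▸ subset_union_left⟩, ?_⟩
        rw [h4]
        exact left_ne_zero_of_smul h0
  · refine sum_eq_zero fun Δ _ => sum_eq_zero fun q _ => sum_eq_zero fun Δ' hΔ' => ?_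
    rw [framedDual_eq_zero, smul_zero]
    rintro ⟨h1, h2, h3⟩
    refine h ⟨h1 ▸ (mem_powersetCard.1 hΔ').2, ?_⟩
    rw [Flag.IsSaturated, h1, h2, h3]

theorem vol_mem {σ : X.Flag} {p : ℕ} {y : P} (hy : y ∈ σ.top) (hv : X.IsVertex y) {L : List P}
    (hL : ∀ x ∈ L, x ∈ σ.top) (hp : L.length = p) : X.vol σ (y :: L) ∈ X.coefF p σ := by
  subst hp
  refine Submodule.subset_span ⟨σ.top, σ.top_mem_cells, Subset.rfl,
    fun i => X.disp σ.top y (L.get i), fun i => ?_, ?_⟩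
  · exact Submodule.subset_span ⟨y, hy, hv, _, hL _ (L.get_mem i), rfl⟩
  · rw [ExteriorAlgebra.ιMulti_apply, vol]
    congr 1
    refine List.ext_getElem (by simp) fun i h1 h2 => ?_
    simp

theorem framedDual_mem {σ : X.Flag} {Δ q Δ' : Finset P} {l r : ℕ} (hΔ : X.IsSimplex Δ)
    (hΔ' : Δ' ⊆ Δ) (hr : Δ'.card = r + 1) (hl : q.card = l) :
    X.framedDual Δ q Δ' σ ∈ X.coefF (l + r) σ := by
  rw [framedDual]
  split_ifs with h
  · refine Submodule.smul_mem _ _ ?_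
    obtain ⟨y, L, hL⟩ : ∃ y L, Δ'.sort (· ≤ ·) = y :: L := by
      refine List.exists_cons_of_ne_nil fun h => ?_
      have := congrArg List.length h
      rw [length_sort, hr] at this
      simp at this
    have hmem : ∀ x ∈ y :: L, x ∈ Δ' := fun x hx => by rwa [← mem_sort (· ≤ ·), hL]
    have hlen := congrArg List.length hL
    rw [length_sort, List.length_cons, hr, add_left_inj] at hlen
    rw [hL, List.cons_append]
    refine vol_mem ?_ (hΔ.2 y (hΔ' (hmem y (by simp)))) ?_ ?_
    · rw [h.2.1]
      exact mem_union_left _ (hΔ' (hmem y (by simp)))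
    · intro x hx
      rw [h.2.1]
      rcases List.mem_append.1 hx with hx | hx
      · exact mem_union_left _ (hΔ' (hmem x (by simp [hx])))
      · exact mem_union_right _ ((mem_sort _).1 hx)
    · rw [List.length_append, length_sort, hl, ← hlen, add_comm]
  · exact zero_mem _

theorem bracket_mem {l k r : ℕ} {c : Weights P} (hc : c ∈ X.propellers l k) :
    X.bracket r c ∈ X.barChains (l + r) (k + l - r) := by
  intro σ
  rw [bracket_eq_sum]
  constructor
  · refine sum_mem fun Δ _ => sum_mem fun q hq => sum_mem fun Δ' hΔ' => ?_
    by_cases h0 : c Δ q = 0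
    · rw [h0, zero_smul]; exact zero_mem _
    · obtain ⟨-, hl, hL⟩ := hc.1 _ _ h0
      rw [mem_powersetCard] at hΔ'
      exact Submodule.smul_mem _ _ (framedDual_mem hL.1 hΔ'.1 hΔ'.2 hl)
  · intro hσ
    refine sum_eq_zero fun Δ _ => sum_eq_zero fun q hq => sum_eq_zero fun Δ' hΔ' => ?_
    by_contra h0
    obtain ⟨hk, hl, hL⟩ := hc.1 _ _ (left_ne_zero_of_smul h0)
    rw [mem_powersetCard] at hΔ'
    have h1 : X.IsDualFlag Δ' (Δ ∪ q) σ := by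
      by_contra h1
      rw [framedDual_eq_zero h1, smul_zero] at h0
      exact h0 rfl
    have h2 := h1.2.2
    rw [card_union_of_disjoint hL.2.1, hΔ'.2, hk, hl] at h2
    have h3 := card_le_card hΔ'.1
    rw [hΔ'.2, hk] at h3
    omega

end UnimodularTropicalSpace

end

/-! ### How the orientation of a flag changes when a cell is added. -/

noncomputable section

namespace UnimodularTropicalSpace

variable {P : Type*} [Fintype P] [LinearOrder P] {X : UnimodularTropicalSpace P}

/-! ### Cofaces of a flag and orientations -/

theorem mem_ins {τ : X.Flag} {F G : Finset P} (h : IsCoface τ F) :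
    G ∈ (τ.ins F).1 ↔ G = F ∨ G ∈ τ.1 := by
  rw [h.ins_val, mem_insert]

theorem IsCoface.bot_of_subset {τ : X.Flag} {F : Finset P} (h : IsCoface τ F) (hF : F ⊆ τ.bot) :
    (τ.ins F).bot = F :=
  Flag.bot_eq ((mem_ins h).2 (Or.inl rfl)) fun G hG => by
    rcases (mem_ins h).1 hG with rfl | hG
    · rfl
    · exact hF.trans (Flag.bot_subset hG)

theorem IsCoface.bot_of_superset {τ : X.Flag} {F : Finset P} (h : IsCoface τ F)
    (hF : τ.bot ⊆ F) : (τ.ins F).bot = τ.bot :=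
  Flag.bot_eq ((mem_ins h).2 (Or.inr τ.bot_mem)) fun G hG => by
    rcases (mem_ins h).1 hG with rfl | hG
    · exact hF
    · exact Flag.bot_subset hG

theorem IsCoface.top_of_superset {τ : X.Flag} {F : Finset P} (h : IsCoface τ F)
    (hF : τ.top ⊆ F) : (τ.ins F).top = F :=
  Flag.top_eq ((mem_ins h).2 (Or.inl rfl)) fun G hG => by
    rcases (mem_ins h).1 hG with rfl | hG
    · rfl
    · exact (Flag.subset_top hG).trans hF

theorem IsCoface.top_of_subset {τ : X.Flag} {F : Finset P} (h : IsCoface τ F)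
    (hF : F ⊆ τ.top) : (τ.ins F).top = τ.top :=
  Flag.top_eq ((mem_ins h).2 (Or.inr τ.top_mem)) fun G hG => by
    rcases (mem_ins h).1 hG with rfl | hG
    · exact hF
    · exact Flag.subset_top hG

theorem IsCoface.cases {τ : X.Flag} {F : Finset P} (h : IsCoface τ F) :
    F ⊂ τ.bot ∨ τ.top ⊂ F ∨ (τ.bot ⊆ F ∧ F ⊆ τ.top) := by
  have h1 : F ≠ τ.bot := fun h' => h.1 (h' ▸ τ.bot_mem)
  have h2 : τ.top ≠ F := fun h' => h.1 (h' ▸ τ.top_mem)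
  rcases h.2.2 _ τ.bot_mem with h3 | h3
  · exact Or.inl (h3.ssubset_of_ne h1)
  · rcases h.2.2 _ τ.top_mem with h4 | h4
    · exact Or.inr (Or.inr ⟨h3, h4⟩)
    · exact Or.inr (Or.inl (h4.ssubset_of_ne h2))

theorem Flag.image_card_subset (σ : X.Flag) :
    σ.1.image Finset.card ⊆ Icc σ.bot.card σ.top.card := by
  intro m hm
  obtain ⟨F, hF, rfl⟩ := mem_image.1 hm
  exact mem_Icc.2 ⟨card_le_card (Flag.bot_subset hF), card_le_card (Flag.subset_top hF)⟩

/-- The cells of a flag have distinct sizes between those of its ends. Equality means that every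
size occurs, which is the content of `IsSaturated`. -/
theorem Flag.card_add_le (σ : X.Flag) : σ.1.card + σ.bot.card ≤ σ.top.card + 1 := by
  have h := card_le_card σ.image_card_subset
  rw [card_image_of_injOn σ.injOn_card, Nat.card_Icc] at h
  have := card_le_card σ.bot_subset_top
  omega

theorem Flag.IsSaturated.exists_card {σ : X.Flag} (h : σ.IsSaturated) {m : ℕ}
    (h1 : σ.bot.card ≤ m) (h2 : m ≤ σ.top.card) : ∃ F ∈ σ.1, F.card = m := by
  have h3 : σ.1.image Finset.card = Icc σ.bot.card σ.top.card := by
    refine eq_of_subset_of_card_le σ.image_card_subset ?_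
    rw [card_image_of_injOn σ.injOn_card, Nat.card_Icc]
    rw [Flag.IsSaturated] at h
    omega
  have h4 : m ∈ σ.1.image Finset.card := by rw [h3]; exact mem_Icc.2 ⟨h1, h2⟩
  simpa using h4

theorem Flag.level_lt {σ : X.Flag} {F : Finset P} (hF : F ∈ σ.1) {a b : P} (ha : a ∈ F)
    (hb : b ∉ F) : σ.level a < σ.level b := by
  refine card_lt_card (ssubset_iff_of_subset ?_ |>.2 ⟨F, by simp [hF, hb], by simp [ha]⟩)
  intro G hG
  obtain ⟨h1, h2⟩ := mem_filter.1 hG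
  refine mem_filter.2 ⟨h1, fun hbG => ?_⟩
  rcases Flag.subset_or h1 hF with h3 | h3
  · exact hb (h3 hbG)
  · exact h2 (h3 ha)

theorem Flag.level_eq_zero {σ : X.Flag} {a : P} (ha : a ∈ σ.bot) : σ.level a = 0 := by
  rw [Flag.level, card_eq_zero, filter_eq_empty_iff]
  intro F hF h
  exact h (Flag.bot_subset hF ha)

theorem IsCoface.level_ins {τ : X.Flag} {F : Finset P} (h : IsCoface τ F) (a : P) :
    (τ.ins F).level a = τ.level a + if a ∈ F then 0 else 1 := by
  rw [Flag.level, h.ins_val, filter_insert]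
  split_ifs with h1
  · rfl
  · rw [card_insert_of_notMem (by simp [h.1])]; rfl

theorem Flag.pairSign_mul_self (σ : X.Flag) (z : P × P) : σ.pairSign z * σ.pairSign z = 1 := by
  rw [Flag.pairSign]; split_ifs <;> norm_num

theorem Flag.orientation_mul_self (σ : X.Flag) : σ.orientation * σ.orientation = 1 := by
  rw [Flag.orientation, ← prod_mul_distrib]
  exact prod_eq_one fun z _ => σ.pairSign_mul_self z

theorem orientation_eq_mul {σ τ : X.Flag} (p : P × P → Prop) [DecidablePred p]
    (h : ∀ a b, a < b → σ.pairSign (a, b) * τ.pairSign (a, b) = if p (a, b) then -1 else 1) :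
    σ.orientation =
      τ.orientation * (-1) ^ (univ.filter fun z : P × P => z.1 < z.2 ∧ p z).card := by
  have h1 : σ.orientation * τ.orientation =
      (-1) ^ (univ.filter fun z : P × P => z.1 < z.2 ∧ p z).card := by
    rw [Flag.orientation, Flag.orientation, ← prod_mul_distrib, ← filter_filter, ← prod_const,
      prod_filter p]
    exact prod_congr rfl fun z hz => h z.1 z.2 (mem_filter.1 hz).2
  rw [← h1, mul_left_comm, τ.orientation_mul_self, mul_one]

theorem card_pairs_left (A : Finset P) (x : P) :
    (univ.filter fun z : P × P => z.1 < z.2 ∧ z.1 = x ∧ z.2 ∈ A).card = countGT A x := by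
  rw [← crossings_singleton_right, crossings, ← card_map (Equiv.prodComm P P).toEmbedding]
  congr 1
  ext ⟨a, b⟩
  simp only [mem_map, mem_filter, mem_univ, true_and, mem_product, mem_singleton]
  constructor
  · rintro ⟨⟨c, d⟩, ⟨h1, rfl, h2⟩, h3⟩
    cases h3
    exact ⟨⟨h2, rfl⟩, h1⟩
  · rintro ⟨⟨h1, rfl⟩, h2⟩
    exact ⟨(b, a), ⟨h2, rfl, h1⟩, rfl⟩

/-- With `τ.bot \ x` as the new first cell, `x` comes after all other elements of `τ.bot`, and
exactly those larger than `x` give new inversions. -/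
theorem orientation_ins_bot {τ : X.Flag} {x : P} (hx : x ∈ τ.bot)
    (h : IsCoface τ (τ.bot.erase x)) :
    (τ.ins (τ.bot.erase x)).orientation = τ.orientation * (-1) ^ countGT τ.bot x := by
  rw [orientation_eq_mul (τ := τ) (fun z => z.1 = x ∧ z.2 ∈ τ.bot), card_pairs_left]
  intro a b hab
  have hT := h.top_of_subset ((erase_subset _ _).trans τ.bot_subset_top)
  simp only [Flag.pairSign, hT, h.level_ins, mem_erase]
  by_cases ha : a ∈ τ.bot <;> by_cases hb : b ∈ τ.bot
  · have hb' := τ.bot_subset_top hb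
    by_cases hax : a = x
    · have hbx : b ≠ x := hax ▸ hab.ne'
      simp [hb, hb', hax, hbx, hx, τ.bot_subset_top hx, Flag.level_eq_zero]
    · simp [ha, hb, hax, Flag.level_eq_zero]
  · have h1 := Flag.level_lt τ.bot_mem ha hb
    have h2 : ¬ τ.level b + 1 < τ.level a + if a ≠ x then 0 else 1 := by split_ifs <;> omega
    simp [ha, hb, h1.not_gt]
    intro _ _ h3
    exact absurd h3 (by split_ifs <;> omega)
  · have h1 := Flag.level_lt τ.bot_mem hb ha
    have hax : a ≠ x := fun h => ha (h ▸ hx)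
    have h2 : τ.level b + (if b = x then 1 else 0) < τ.level a + 1 := by split_ifs <;> omega
    have h3 : τ.level b + (if ¬ b = x then 0 else 1) < τ.level a + 1 := by split_ifs <;> omega
    simp only [ha, hb, h1, hax, h3, ne_eq, and_true, and_false, if_false]
    split_ifs <;> norm_num
  · have hax : a ≠ x := fun h => ha (h ▸ hx)
    simp only [ha, hb, hax, and_false, if_false, add_lt_add_iff_right]
    split_ifs <;> norm_num

/-- The new element comes last and forms an inversion with each larger element of `τ.top`. -/
theorem orientation_ins_top {τ : X.Flag} {x : P} (hx : x ∉ τ.top)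
    (h : IsCoface τ (insert x τ.top)) :
    (τ.ins (insert x τ.top)).orientation = τ.orientation * (-1) ^ countGT τ.top x := by
  rw [orientation_eq_mul (τ := τ) (fun z => z.1 = x ∧ z.2 ∈ τ.top), card_pairs_left]
  intro a b hab
  have hT := h.top_of_superset (subset_insert _ _)
  simp only [Flag.pairSign, hT, h.level_ins, mem_insert]
  by_cases ha : a ∈ τ.top <;> by_cases hb : b ∈ τ.top
  · have hax : a ≠ x := fun h => hx (h ▸ ha)
    simp only [ha, hb, hax, or_true, true_and, false_and, if_true, if_false, add_zero]
    split_ifs <;> norm_num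
  · have hax : a ≠ x := fun h => hx (h ▸ ha)
    have h1 := Flag.level_lt τ.top_mem ha hb
    simp only [ha, hb, hax, or_true, or_false, true_and, false_and, and_false, if_true, if_false]
    rw [if_neg]
    · norm_num
    · rintro ⟨-, h2⟩
      split_ifs at h2 <;> omega
  · have h1 := Flag.level_lt τ.top_mem hb ha
    simp only [ha, hb, or_true, or_false, true_and, false_and, and_true, if_true, if_false]
    by_cases hax : a = x
    · rw [if_pos, if_pos hax]
      · norm_num
      · refine ⟨hax, ?_⟩
        split_ifs
        omega
    · rw [if_neg fun h => hax h.1, if_neg hax]; norm_num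
  · simp only [ha, hb, or_false, false_and, and_false, if_false]
    rw [if_neg]
    · norm_num
    · rintro ⟨rfl, rfl, -⟩
      exact lt_irrefl _ hab

/-- The two ways to fill a gap of length two in a flag have opposite orientations. -/
theorem orientation_ins_middle {τ : X.Flag} {F G : Finset P} (hF : F ∈ τ.1) (hG : G ∈ τ.1)
    (hgap : ∀ H ∈ τ.1, H ⊆ F ∨ G ⊆ H) {x y : P} (hxy : x < y) (hx : x ∉ F) (hy : y ∉ F)
    (hFG : G = insert x (insert y F)) (h1 : IsCoface τ (insert x F))
    (h2 : IsCoface τ (insert y F)) :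
    (τ.ins (insert x F)).orientation = -(τ.ins (insert y F)).orientation := by
  have hxG : x ∈ G := by simp [hFG]
  have hyG : y ∈ G := by simp [hFG]
  have hGT := Flag.subset_top hG
  have hFG' : F ⊆ G := fun z hz => by simp [hFG, hz]
  have hT1 := h1.top_of_subset ((insert_subset hxG hFG').trans hGT)
  have hT2 := h2.top_of_subset ((insert_subset hyG hFG').trans hGT)
  have hlev : τ.level x = τ.level y := by
    rw [Flag.level, Flag.level]
    congr 1
    refine filter_congr fun H hH => not_congr ?_
    rcases hgap H hH with h | h
    · exact ⟨fun h' => absurd (h h') hx, fun h' => absurd (h h') hy⟩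
    · exact ⟨fun _ => h hyG, fun _ => h hxG⟩
  rw [orientation_eq_mul (τ := τ.ins (insert y F)) (fun z => z = (x, y))]
  · have : (univ.filter fun z : P × P => z.1 < z.2 ∧ z = (x, y)) = {(x, y)} := by
      ext z
      simp only [mem_filter, mem_univ, true_and, mem_singleton]
      exact ⟨fun h => h.2, fun h => ⟨h ▸ hxy, h⟩⟩
    rw [this, card_singleton, pow_one, mul_neg_one]
  · intro a b hab
    simp only [Flag.pairSign, hT1, hT2, h1.level_ins, h2.level_ins, Prod.mk.injEq]
    by_cases hz : a = x ∧ b = y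
    · obtain ⟨rfl, rfl⟩ := hz
      have e1 : b ∉ insert a F := by simp [hy, hxy.ne']
      have e2 : a ∉ insert b F := by simp [hx, hxy.ne]
      rw [if_neg, if_pos, if_pos ⟨rfl, rfl⟩]
      · norm_num
      · rw [if_pos (mem_insert_self _ _), if_neg e2]
        exact ⟨hGT hxG, hGT hyG, by omega⟩
      · rw [if_pos (mem_insert_self _ _), if_neg e1]
        rintro ⟨-, -, h⟩
        omega
    · rw [if_neg hz]
      -- For every pair other than `(x, y)` the order of appearance is the same in both flags: `F`
      -- and `G` separate all elements except `x` and `y` from these two.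
      have key : (τ.level b + (if b ∈ insert x F then 0 else 1) <
          τ.level a + if a ∈ insert x F then 0 else 1) ↔
          (τ.level b + (if b ∈ insert y F then 0 else 1) <
          τ.level a + if a ∈ insert y F then 0 else 1) := by
        have hlt : ∀ u v, u ∈ F → v ∉ F → τ.level u < τ.level v := fun u v => Flag.level_lt hF
        have hlt' : ∀ u v, u ∈ G → v ∉ G → τ.level u < τ.level v := fun u v => Flag.level_lt hG
        have hGm : ∀ u, u ∉ G ↔ u ≠ x ∧ u ≠ y ∧ u ∉ F := fun u => by simp [hFG]
        have hval : ∀ u, (u ∈ F ∧ u ∈ insert x F ∧ u ∈ insert y F) ∨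
            (u = x ∧ u ∈ insert x F ∧ u ∉ insert y F) ∨
            (u = y ∧ u ∉ insert x F ∧ u ∈ insert y F) ∨
            (u ∉ G ∧ u ∉ insert x F ∧ u ∉ insert y F) := by
          intro u
          by_cases u1 : u ∈ F
          · simp [u1]
          · by_cases u2 : u = x
            · simp [u2, hx, hxy.ne]
            · by_cases u3 : u = y
              · simp [u3, hy, hxy.ne']
              · simp [hGm, u1, u2, u3]
        rcases hval a with ⟨a1, a2, a3⟩ | ⟨a1, a2, a3⟩ | ⟨a1, a2, a3⟩ | ⟨a1, a2, a3⟩ <;>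
        rcases hval b with ⟨b1, b2, b3⟩ | ⟨b1, b2, b3⟩ | ⟨b1, b2, b3⟩ | ⟨b1, b2, b3⟩ <;>
        simp only [a2, a3, b2, b3, if_true, if_false]
        · rw [b1]; have := hlt a x a1 hx; omega
        · rw [b1]; have := hlt a y a1 hy; omega
        · rw [a1]; have := hlt b x b1 hx; omega
        · rw [a1, b1]; simp
        · exact absurd ⟨a1, b1⟩ hz
        · rw [a1]; have := hlt' x b hxG b1; omega
        · rw [a1]; have := hlt b y b1 hy; omega
        · rw [a1, b1] at hab; exact absurd hab hxy.not_gt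
        · rw [a1, b1]; simp
        · rw [a1]; have := hlt' y b hyG b1; omega
        · rw [b1]; have := hlt' x a hxG a1; omega
        · rw [b1]; have := hlt' y a hyG a1; omega
      simp only [key]
      split_ifs <;> norm_num

end UnimodularTropicalSpace

end

/-! ### The boundary of `c[-r]` at a flag, by the position of the added cell. -/

noncomputable section

namespace UnimodularTropicalSpace

variable {P : Type*} [Fintype P] [LinearOrder P] {X : UnimodularTropicalSpace P}

/-- If some cell in the middle saturates the flag, exactly one size is missing. The neighbours `F ⊂
G` of the gap differ by two elements, and the two fillings have the same face sign and opposite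
orientations. -/
theorem sum_ins_middle (τ : X.Flag) :
    ∑ F ∈ univ.filter (fun F => IsCoface τ F ∧ τ.bot ⊆ F ∧ F ⊆ τ.top ∧ (τ.ins F).IsSaturated),
      X.faceSign (τ.ins F) τ * (τ.ins F).orientation = 0 := by
  by_cases hex : ∃ F, IsCoface τ F ∧ τ.bot ⊆ F ∧ F ⊆ τ.top ∧ (τ.ins F).IsSaturated
  swap
  · rw [filter_false_of_mem fun F _ hF => hex ⟨F, hF⟩, sum_empty]
  obtain ⟨F₀, hF₀, hB₀, hT₀, hs₀⟩ := hex
  have hbot := hF₀.bot_of_superset hB₀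
  have htop := hF₀.top_of_subset hT₀
  have hF₀m : F₀ ∈ (τ.ins F₀).1 := (mem_ins hF₀).2 (Or.inl rfl)
  have hτm : ∀ {G}, G ∈ τ.1 → G ∈ (τ.ins F₀).1 := fun hG => (mem_ins hF₀).2 (Or.inr hG)
  have hBlt : τ.bot.card < F₀.card := card_lt_card
    (hB₀.ssubset_of_ne fun h => hF₀.1 (h ▸ τ.bot_mem))
  have hTlt : F₀.card < τ.top.card := card_lt_card
    (hT₀.ssubset_of_ne fun h => hF₀.1 (h ▸ τ.top_mem))
  -- The cells just below and just above the gap; they exist because the completed flag has a cell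
  -- of every size.
  obtain ⟨F, hF, hFc⟩ := hs₀.exists_card (m := F₀.card - 1) (by rw [hbot]; omega)
    (by rw [htop]; omega)
  obtain ⟨G, hG, hGc⟩ := hs₀.exists_card (m := F₀.card + 1) (by rw [hbot]; omega)
    (by rw [htop]; omega)
  have hFτ : F ∈ τ.1 := ((mem_ins hF₀).1 hF).resolve_left fun h => by rw [h] at hFc; omega
  have hGτ : G ∈ τ.1 := ((mem_ins hF₀).1 hG).resolve_left fun h => by rw [h] at hGc; omega
  have hne : ∀ H ∈ τ.1, H.card ≠ F₀.card := fun H hH h =>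
    hF₀.1 ((τ.ins F₀).injOn_card (hτm hH) hF₀m h ▸ hH)
  have hgap : ∀ H ∈ τ.1, H ⊆ F ∨ G ⊆ H := by
    intro H hH
    have := hne H hH
    rcases le_or_gt H.card F.card with h | h
    · exact Or.inl (Flag.subset_of_card_le (hτm hH) hF h)
    · exact Or.inr (Flag.subset_of_card_le hG (hτm hH) (by omega))
  have hFG : F ⊆ G := Flag.subset_of_card_le hF hG (by omega)
  have hcard : (G \ F).card = 2 := by rw [card_sdiff_of_subset hFG]; omega
  obtain ⟨x, y, hxy, hGF⟩ : ∃ x y, x < y ∧ G \ F = {x, y} := by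
    obtain ⟨x, y, hne, h⟩ := card_eq_two.1 hcard
    rcases lt_or_gt_of_ne hne with h1 | h1
    · exact ⟨x, y, h1, h⟩
    · exact ⟨y, x, h1, by rw [h, pair_comm]⟩
  have hx : x ∈ G \ F := by rw [hGF]; simp
  have hy : y ∈ G \ F := by rw [hGF]; simp
  rw [mem_sdiff] at hx hy
  have hGeq : G = insert x (insert y F) := by
    rw [← sdiff_union_of_subset hFG, hGF]; ext; simp
  have hGT := Flag.subset_top hGτ
  have hBF := Flag.bot_subset hFτ
  have hcof : ∀ z ∈ G, z ∉ F → IsCoface τ (insert z F) := by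
    intro z hz hzF
    refine ⟨fun h => hne _ h ?_, ?_, fun H hH => ?_⟩
    · rw [card_insert_of_notMem hzF]; omega
    · obtain ⟨v, hv, hv'⟩ := X.exists_vertex _ τ.bot_mem_cells
      exact X.down_closed _ τ.top_mem_cells _ ((insert_subset hz hFG).trans hGT)
        ⟨v, mem_insert_of_mem (hBF hv), hv'⟩
    · rcases hgap H hH with h | h
      · exact Or.inr (h.trans (subset_insert _ _))
      · exact Or.inl ((insert_subset hz hFG).trans h)
  have hset : univ.filter (fun F => IsCoface τ F ∧ τ.bot ⊆ F ∧ F ⊆ τ.top ∧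
      (τ.ins F).IsSaturated) = {insert x F, insert y F} := by
    ext K
    simp only [mem_filter, mem_univ, true_and, mem_insert, mem_singleton]
    constructor
    · rintro ⟨hK, hBK, hTK, hsK⟩
      have hKm : K ∈ (τ.ins K).1 := (mem_ins hK).2 (Or.inl rfl)
      have hKc : K.card = F₀.card := by
        obtain ⟨H, hH, hHc⟩ := hsK.exists_card (m := F₀.card)
          (by rw [hK.bot_of_superset hBK]; omega) (by rw [hK.top_of_subset hTK]; omega)
        rcases (mem_ins hK).1 hH with rfl | hH
        · exact hHc
        · exact absurd hHc (hne H hH)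
      have h1 : F ⊆ K := Flag.subset_of_card_le ((mem_ins hK).2 (Or.inr hFτ)) hKm (by omega)
      have h2 : K ⊆ G := Flag.subset_of_card_le hKm ((mem_ins hK).2 (Or.inr hGτ)) (by omega)
      obtain ⟨z, hz, hzK⟩ := exists_eq_insert_iff.2 ⟨h1, by omega⟩
      have h3 : z ∈ G \ F := mem_sdiff.2 ⟨h2 (hzK ▸ mem_insert_self _ _), hz⟩
      rw [hGF, mem_insert, mem_singleton] at h3
      rcases h3 with rfl | rfl
      · exact Or.inl hzK.symm
      · exact Or.inr hzK.symm
    · have key : ∀ z ∈ G, z ∉ F → IsCoface τ (insert z F) ∧ τ.bot ⊆ insert z F ∧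
          insert z F ⊆ τ.top ∧ (τ.ins (insert z F)).IsSaturated := by
        intro z hz hzF
        have h1 := hcof z hz hzF
        have h2 := hBF.trans (subset_insert z F)
        have h3 := (insert_subset hz hFG).trans hGT
        refine ⟨h1, h2, h3, ?_⟩
        rw [Flag.IsSaturated, h1.bot_of_superset h2, h1.top_of_subset h3, h1.card_ins]
        rw [Flag.IsSaturated, hbot, htop, hF₀.card_ins] at hs₀
        exact hs₀
      rintro (rfl | rfl)
      · exact key x hx.1 hx.2
      · exact key y hy.1 hy.2
  have hcx := hcof x hx.1 hx.2
  have hcy := hcof y hy.1 hy.2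
  have hsign : ∀ z ∈ G, z ∉ F → (τ.1.filter fun H => H ⊂ insert z F) =
      τ.1.filter fun H => H ⊆ F := by
    intro z hz hzF
    refine filter_congr fun H hH => ⟨fun h => ?_, fun h => ?_⟩
    · rcases hgap H hH with h1 | h1
      · exact h1
      · exact absurd ((insert_subset hz hFG).trans h1) h.2
    · exact h.trans_ssubset (ssubset_insert hzF)
  rw [hset, sum_pair, hcx.faceSign_eq, hcy.faceSign_eq, hsign x hx.1 hx.2, hsign y hy.1 hy.2,
    orientation_ins_middle hFτ hGτ hgap hxy hx.2 hy.2 hGeq hcx hcy]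
  · ring
  · intro h
    have h1 : x ∈ insert y F := h ▸ mem_insert_self x F
    rcases mem_insert.1 h1 with h1 | h1
    · exact hxy.ne h1
    · exact hx.2 h1

theorem IsCoface.isSaturated_of_subset_bot {τ : X.Flag} {F : Finset P} (h : IsCoface τ F)
    (hF : F ⊂ τ.bot) : (τ.ins F).IsSaturated ↔ τ.IsSaturated ∧ F.card + 1 = τ.bot.card := by
  have h1 := τ.card_add_le
  have h2 := card_lt_card hF
  rw [Flag.IsSaturated, Flag.IsSaturated, h.card_ins, h.bot_of_subset hF.1,
    h.top_of_subset (hF.1.trans τ.bot_subset_top)]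
  omega

theorem IsCoface.isSaturated_of_top_subset {τ : X.Flag} {F : Finset P} (h : IsCoface τ F)
    (hF : τ.top ⊂ F) : (τ.ins F).IsSaturated ↔ τ.IsSaturated ∧ F.card = τ.top.card + 1 := by
  have h1 := τ.card_add_le
  have h2 := card_lt_card hF
  rw [Flag.IsSaturated, Flag.IsSaturated, h.card_ins, h.top_of_superset hF.1,
    h.bot_of_superset (τ.bot_subset_top.trans hF.1)]
  omega

theorem IsCoface.not_isSaturated_of_middle {τ : X.Flag} {F : Finset P} (h : IsCoface τ F)
    (hB : τ.bot ⊆ F) (hT : F ⊆ τ.top) (hs : (τ.ins F).IsSaturated) : ¬ τ.IsSaturated := by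
  rw [Flag.IsSaturated, h.card_ins, h.bot_of_superset hB, h.top_of_subset hT] at hs
  rw [Flag.IsSaturated]
  omega

theorem bracketCoef_eq_zero {k : ℕ} {c : Weights P}
    (hc : ∀ Δ q, c Δ q ≠ 0 → Δ.card = k + 1 ∧ X.IsLink Δ q) {B T : Finset P}
    (hne : B.Nonempty) (h : ¬ (X.IsSimplex B ∧ T ∈ X.cells)) : X.bracketCoef c B T = 0 := by
  refine sum_eq_zero fun Δ hΔ => ?_
  rw [mem_between] at hΔ
  have : c Δ (T \ Δ) = 0 := by
    by_contra h0
    have h1 := (hc _ _ h0).2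
    refine h ⟨h1.1.subset hΔ.1 hne, ?_⟩
    have h2 := h1.2.2
    rwa [union_sdiff_of_subset hΔ.2] at h2
  rw [this, mul_zero, zero_smul]

theorem boundary_bracket_apply {k r : ℕ} {c : Weights P}
    (hc : ∀ Δ q, c Δ q ≠ 0 → Δ.card = k + 1 ∧ X.IsLink Δ q) (τ : X.Flag) : X.boundary (X.bracket r c) τ =
    ∑ F ∈ univ.filter (IsCoface τ), if (τ.ins F).bot.card = r + 1 ∧ (τ.ins F).IsSaturated then
      (X.faceSign (τ.ins F) τ * (τ.ins F).orientation * (-1) ^ (r * k + r.choose 2)) •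
        toCoef τ (X.bracketCoef c (τ.ins F).bot (τ.ins F).top) else 0 := by
  rw [boundary_apply, ← sum_cofaces τ fun σ => if σ.bot.card = r + 1 ∧ σ.IsSaturated then
      (X.faceSign σ τ * σ.orientation * (-1) ^ (r * k + r.choose 2)) •
        toCoef τ (X.bracketCoef c σ.bot σ.top) else 0]
  refine sum_congr rfl fun σ _ => ?_
  rw [incidence]
  split_ifs with h1 h2
  · rw [bracket_apply hc, if_pos h2, map_smul, smul_smul, pushOrZero, dif_pos h1.1, push_toCoef,
      mul_assoc]
  · rw [bracket_apply hc, if_neg h2, map_zero, smul_zero]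
  · rw [zero_smul]

/-- A cell added at either end cannot close a gap, so only middle cofaces matter. They leave both
ends unchanged, hence share one coefficient, and the signs sum to zero. -/
theorem boundary_bracket_of_not_isSaturated {k r : ℕ} {c : Weights P}
    (hc : ∀ Δ q, c Δ q ≠ 0 → Δ.card = k + 1 ∧ X.IsLink Δ q) {τ : X.Flag}
    (hτ : ¬ τ.IsSaturated) : X.boundary (X.bracket r c) τ = 0 := by
  rw [boundary_bracket_apply hc]
  have h1 : ∀ F ∈ univ.filter (IsCoface τ),
      (if (τ.ins F).bot.card = r + 1 ∧ (τ.ins F).IsSaturated then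
        (X.faceSign (τ.ins F) τ * (τ.ins F).orientation * (-1) ^ (r * k + r.choose 2)) •
          toCoef τ (X.bracketCoef c (τ.ins F).bot (τ.ins F).top) else 0) =
      if τ.bot ⊆ F ∧ F ⊆ τ.top ∧ (τ.ins F).IsSaturated then
        (X.faceSign (τ.ins F) τ * (τ.ins F).orientation) •
        ((-1 : ℚ) ^ (r * k + r.choose 2) * if τ.bot.card = r + 1 then 1 else 0) •
          toCoef τ (X.bracketCoef c τ.bot τ.top) else 0 := by
    intro F hF
    have hF := (mem_filter.1 hF).2
    rcases hF.cases with h | h | ⟨hB, hT⟩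
    · rw [if_neg fun h' => hτ ((hF.isSaturated_of_subset_bot h).1 h'.2).1,
        if_neg fun h' => h.2 h'.1]
    · rw [if_neg fun h' => hτ ((hF.isSaturated_of_top_subset h).1 h'.2).1,
        if_neg fun h' => h.2 h'.2.1]
    · rw [hF.bot_of_superset hB, hF.top_of_subset hT]
      by_cases hs : (τ.ins F).IsSaturated <;> by_cases hr : τ.bot.card = r + 1 <;>
        simp [hs, hr, hB, hT, smul_smul]
  rw [sum_congr rfl h1, ← sum_filter, filter_filter, ← sum_smul, sum_ins_middle, zero_smul]

theorem boundary_bracket_of_bot {k r : ℕ} {c : Weights P}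
    (hc : ∀ Δ q, c Δ q ≠ 0 → Δ.card = k + 1 ∧ X.IsLink Δ q) {τ : X.Flag}
    (hτ : τ.IsSaturated) (hr : τ.bot.card = r + 2) : X.boundary (X.bracket r c) τ =
      (τ.orientation * (-1) ^ (r * k + r.choose 2)) • toCoef τ (∑ x ∈ τ.bot,
        (-1 : ℚ) ^ countGT τ.bot x • X.bracketCoef c (τ.bot.erase x) τ.top) := by
  rw [boundary_bracket_apply hc, map_sum, smul_sum]
  have hcof : ∀ x ∈ τ.bot, τ.bot.erase x ∈ X.cells → IsCoface τ (τ.bot.erase x) := by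
    intro x hx hE
    refine ⟨fun h => notMem_erase x _ (Flag.bot_subset h hx), hE, fun G hG => Or.inl ?_⟩
    exact (erase_subset _ _).trans (Flag.bot_subset hG)
  have hcard : ∀ x ∈ τ.bot, (τ.bot.erase x).card = r + 1 := fun x hx => by
    rw [card_erase_of_mem hx, hr]; rfl
  have hcell : ∀ x ∈ τ.bot, X.bracketCoef c (τ.bot.erase x) τ.top ≠ 0 →
      IsCoface τ (τ.bot.erase x) := by
    intro x hx h0
    by_contra h1
    refine h0 (bracketCoef_eq_zero hc (card_pos.1 (by rw [hcard x hx]; omega)) fun h2 => ?_)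
    exact h1 (hcof x hx h2.1.1)
  have hsub : ∀ x ∈ τ.bot, τ.bot.erase x ⊂ τ.bot := fun x hx => erase_ssubset hx
  -- Only nonzero terms correspond: `τ.bot.erase x` need not be a cell, and in that case its
  -- coefficient vanishes.
  refine (sum_bij_ne_zero (fun x _ _ => τ.bot.erase x) ?_ ?_ ?_ ?_).symm
  · intro x hx h0
    rw [map_smul, smul_smul] at h0
    have := hcell x hx fun h => h0 (by rw [h, map_zero, smul_zero])
    simpa using this
  · intro x hx _ y hy _ h
    by_contra hxy
    exact notMem_erase x τ.bot (h ▸ mem_erase.2 ⟨hxy, hx⟩)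
  · intro F hF h0
    have hF := (mem_filter.1 hF).2
    have h1 := (ite_ne_right_iff.1 h0).1
    rcases hF.cases with h | h | ⟨hB, hT⟩
    · have h2 := ((hF.isSaturated_of_subset_bot h).1 h1.2).2
      obtain ⟨x, hx, rfl⟩ : ∃ x ∈ τ.bot, τ.bot.erase x = F := by
        obtain ⟨x, hx, h3⟩ := exists_eq_insert_iff.2 ⟨h.1, h2⟩
        exact ⟨x, h3 ▸ mem_insert_self _ _, by rw [← h3, erase_insert hx]⟩
      refine ⟨x, hx, ?_, rfl⟩
      rw [if_pos h1, hF.bot_of_subset h.1, hF.top_of_subset (h.1.trans τ.bot_subset_top)] at h0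
      have h3 := right_ne_zero_of_smul h0
      rw [map_smul, smul_smul]
      refine smul_ne_zero ?_ h3
      have := left_ne_zero_of_mul_eq_one τ.orientation_mul_self
      positivity
    · have h2 := h1.1
      rw [hF.bot_of_superset (τ.bot_subset_top.trans h.1)] at h2
      omega
    · exact absurd hτ (hF.not_isSaturated_of_middle hB hT h1.2)
  · intro x hx h0
    rw [map_smul, smul_smul] at h0 ⊢
    have h1 := hcell x hx fun h => h0 (by rw [h, map_zero, smul_zero])
    have h2 := (h1.isSaturated_of_subset_bot (hsub x hx)).2 ⟨hτ, by rw [hcard x hx, hr]⟩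
    rw [h1.bot_of_subset (erase_subset _ _),
      h1.top_of_subset ((erase_subset _ _).trans τ.bot_subset_top), if_pos ⟨hcard x hx, h2⟩,
      -- The new cell is the first of the flag, so its face sign is `1`.
      orientation_ins_bot hx h1, h1.faceSign_eq, filter_false_of_mem]
    · congr 1
      simp only [card_empty]
      ring
    · intro G hG h3
      exact (h3.trans (hsub x hx)).2 (Flag.bot_subset hG)

theorem boundary_bracket_of_top {k r : ℕ} {c : Weights P}
    (hc : ∀ Δ q, c Δ q ≠ 0 → Δ.card = k + 1 ∧ X.IsLink Δ q) {τ : X.Flag}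
    (hτ : τ.IsSaturated) (hr : τ.bot.card = r + 1) : X.boundary (X.bracket r c) τ =
      ((-1) ^ τ.1.card * τ.orientation * (-1) ^ (r * k + r.choose 2)) •
        toCoef τ (∑ z ∈ univ.filter (fun z => z ∉ τ.top),
          (-1 : ℚ) ^ countGT τ.top z • X.bracketCoef c τ.bot (insert z τ.top)) := by
  rw [boundary_bracket_apply hc, map_sum, smul_sum]
  have hcell : ∀ z ∉ τ.top, X.bracketCoef c τ.bot (insert z τ.top) ≠ 0 →
      IsCoface τ (insert z τ.top) := by
    intro z hz h0
    by_contra h1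
    refine h0 (bracketCoef_eq_zero hc (card_pos.1 (by omega)) fun h2 => h1 ⟨?_, h2.2, ?_⟩)
    · exact fun h => hz (Flag.subset_top h (mem_insert_self _ _))
    · exact fun G hG => Or.inr ((Flag.subset_top hG).trans (subset_insert _ _))
  have hsub : ∀ z ∉ τ.top, τ.top ⊂ insert z τ.top := fun z hz => ssubset_insert hz
  refine (sum_bij_ne_zero (fun z _ _ => insert z τ.top) ?_ ?_ ?_ ?_).symm
  · intro z hz h0
    rw [map_smul, smul_smul] at h0
    have := hcell z (mem_filter.1 hz).2 fun h => h0 (by rw [h, map_zero, smul_zero])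
    simpa using this
  · intro x hx _ y hy _ h
    have h1 : x ∈ insert y τ.top := h ▸ mem_insert_self _ _
    exact (mem_insert.1 h1).resolve_right (mem_filter.1 hx).2
  · intro F hF h0
    have hF := (mem_filter.1 hF).2
    have h1 := (ite_ne_right_iff.1 h0).1
    rcases hF.cases with h | h | ⟨hB, hT⟩
    · have h2 := h1.1
      rw [hF.bot_of_subset h.1] at h2
      have := card_lt_card h
      omega
    · have h2 := ((hF.isSaturated_of_top_subset h).1 h1.2).2
      obtain ⟨z, hz, rfl⟩ := exists_eq_insert_iff.2 ⟨h.1, h2.symm⟩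
      refine ⟨z, by simpa using hz, ?_, rfl⟩
      rw [if_pos h1, hF.bot_of_superset (τ.bot_subset_top.trans h.1),
        hF.top_of_superset h.1] at h0
      have h3 := right_ne_zero_of_smul h0
      rw [map_smul, smul_smul]
      refine smul_ne_zero ?_ h3
      have := left_ne_zero_of_mul_eq_one τ.orientation_mul_self
      positivity
    · exact absurd hτ (hF.not_isSaturated_of_middle hB hT h1.2)
  · intro z hz h0
    have hz := (mem_filter.1 hz).2
    rw [map_smul, smul_smul] at h0 ⊢
    have h1 := hcell z hz fun h => h0 (by rw [h, map_zero, smul_zero])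
    have h2 := (h1.isSaturated_of_top_subset (hsub z hz)).2
      ⟨hτ, by rw [card_insert_of_notMem hz]⟩
    rw [h1.bot_of_superset (τ.bot_subset_top.trans (subset_insert _ _)),
      h1.top_of_superset (subset_insert _ _), if_pos ⟨hr, h2⟩,
      -- The new cell is the last of the flag, whence the face sign `(-1) ^ τ.1.card`.
      orientation_ins_top hz h1, h1.faceSign_eq, filter_true_of_mem]
    · congr 1
      ring
    · intro G hG
      exact (Flag.subset_top hG).trans_ssubset (hsub z hz)

theorem boundary_bracket_of_ne {k r : ℕ} {c : Weights P}
    (hc : ∀ Δ q, c Δ q ≠ 0 → Δ.card = k + 1 ∧ X.IsLink Δ q) {τ : X.Flag}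
    (h1 : τ.bot.card ≠ r + 1) (h2 : τ.bot.card ≠ r + 2) : X.boundary (X.bracket r c) τ = 0 := by
  rw [boundary_bracket_apply hc]
  refine sum_eq_zero fun F hF => if_neg fun h => ?_
  have hF := (mem_filter.1 hF).2
  have h3 := h.1
  rcases hF.cases with h' | h' | ⟨hB, hT⟩
  · have h4 := ((hF.isSaturated_of_subset_bot h').1 h.2).2
    rw [hF.bot_of_subset h'.1] at h3
    omega
  · rw [hF.bot_of_superset (τ.bot_subset_top.trans h'.1)] at h3
    exact h1 h3
  · rw [hF.bot_of_superset hB] at h3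
    exact h1 h3

end UnimodularTropicalSpace

end

/-! ### The contribution of a new smallest cell is `d''`. -/

noncomputable section

namespace UnimodularTropicalSpace

variable {P : Type*} [Fintype P] [LinearOrder P] {X : UnimodularTropicalSpace P}

/-! ### Removing the smallest cell of a flag -/

section Between

variable {M : Type*} [AddCommMonoid M]

theorem sum_between_erase {B T : Finset P} {x : P} (hx : x ∈ B) (hT : B ⊆ T)
    (f : Finset P → M) :
    ∑ Δ ∈ between (B.erase x) T, f Δ = ∑ Δ ∈ between B T, (f Δ + f (Δ.erase x)) := by
  rw [sum_add_distrib, ← sum_filter_add_sum_filter_not _ (fun Δ => x ∈ Δ)]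
  congr 1
  · refine sum_congr ?_ fun _ _ => rfl
    ext Δ
    simp only [mem_filter, mem_between]
    constructor
    · rintro ⟨⟨h1, h2⟩, h3⟩
      exact ⟨by rw [← insert_erase hx]; exact insert_subset h3 h1, h2⟩
    · rintro ⟨h1, h2⟩
      exact ⟨⟨(erase_subset _ _).trans h1, h2⟩, h1 hx⟩
  · refine sum_bij' (fun Δ _ => insert x Δ) (fun Δ _ => Δ.erase x) ?_ ?_ ?_ ?_ ?_
    · intro Δ hΔ
      simp only [mem_filter, mem_between] at hΔ ⊢
      exact ⟨by rw [← insert_erase hx]; exact insert_subset_insert _ hΔ.1.1,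
        insert_subset (hT hx) hΔ.1.2⟩
    · intro Δ hΔ
      simp only [mem_filter, mem_between] at hΔ ⊢
      exact ⟨⟨erase_subset_erase _ hΔ.1, (erase_subset _ _).trans hΔ.2⟩, notMem_erase _ _⟩
    · intro Δ hΔ
      exact erase_insert (mem_filter.1 hΔ).2
    · intro Δ hΔ
      exact insert_erase ((mem_between.1 hΔ).1 hx)
    · intro Δ hΔ
      rw [erase_insert (mem_filter.1 hΔ).2]

theorem sum_between_insert {B T : Finset P} {z : P} (hz : z ∉ T) (hT : B ⊆ T)
    (f : Finset P → M) :
    ∑ Δ ∈ between B (insert z T), f Δ = ∑ Δ ∈ between B T, (f (insert z Δ) + f Δ) := by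
  rw [sum_add_distrib, ← sum_filter_add_sum_filter_not _ (fun Δ => z ∈ Δ)]
  congr 1
  · refine sum_bij' (fun Δ _ => Δ.erase z) (fun Δ _ => insert z Δ) ?_ ?_ ?_ ?_ ?_
    · intro Δ hΔ
      simp only [mem_filter, mem_between] at hΔ ⊢
      exact ⟨fun y hy => mem_erase.2 ⟨fun h => hz (h ▸ hT hy), hΔ.1.1 hy⟩,
        fun y hy => (mem_insert.1 (hΔ.1.2 (mem_of_mem_erase hy))).resolve_left (ne_of_mem_erase hy)⟩
    · intro Δ hΔ
      simp only [mem_filter, mem_between] at hΔ ⊢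
      exact ⟨⟨hΔ.1.trans (subset_insert _ _), insert_subset_insert _ hΔ.2⟩, mem_insert_self _ _⟩
    · intro Δ hΔ
      exact insert_erase (mem_filter.1 hΔ).2
    · intro Δ hΔ
      exact erase_insert fun h => hz ((mem_between.1 hΔ).2 h)
    · intro Δ hΔ
      rw [insert_erase (mem_filter.1 hΔ).2]
  · refine sum_congr ?_ fun _ _ => rfl
    ext Δ
    simp only [mem_filter, mem_between]
    constructor
    · rintro ⟨⟨h1, h2⟩, h3⟩
      exact ⟨h1, fun y hy => (mem_insert.1 (h2 hy)).resolve_left fun h => h3 (h ▸ hy)⟩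
    · rintro ⟨h1, h2⟩
      exact ⟨⟨h1, h2.trans (subset_insert _ _)⟩, fun h => hz (h2 h)⟩

/-- Reindexes pairs of a simplex and one of its elements by removing that element, so that all terms
with the same weight of `c` are collected at one `Δ`. -/
theorem sum_between_sdiff (B T : Finset P) (f : Finset P → P → M) :
    ∑ Δ ∈ between B T, ∑ z ∈ Δ \ B, f Δ z =
      ∑ Δ ∈ between B T, ∑ z ∈ T \ Δ, f (insert z Δ) z := by
  rw [sum_sigma', sum_sigma']
  refine sum_bij' (fun p _ => ⟨p.1.erase p.2, p.2⟩) (fun p _ => ⟨insert p.2 p.1, p.2⟩)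
    ?_ ?_ ?_ ?_ ?_
  · rintro ⟨Δ, z⟩ h
    simp only [mem_sigma, mem_between, mem_sdiff] at h ⊢
    exact ⟨⟨fun y hy => mem_erase.2 ⟨fun e => h.2.2 (e ▸ hy), h.1.1 hy⟩,
      (erase_subset _ _).trans h.1.2⟩, h.1.2 h.2.1, notMem_erase _ _⟩
  · rintro ⟨Δ, z⟩ h
    simp only [mem_sigma, mem_between, mem_sdiff] at h ⊢
    exact ⟨⟨h.1.1.trans (subset_insert _ _), insert_subset h.2.1 h.1.2⟩,
      mem_insert_self _ _, fun e => h.2.2 (h.1.1 e)⟩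
  · rintro ⟨Δ, z⟩ h
    simp only [mem_sigma, mem_sdiff] at h
    simp only [insert_erase h.2.1]
  · rintro ⟨Δ, z⟩ h
    simp only [mem_sigma, mem_sdiff] at h
    simp only [erase_insert h.2.2]
  · rintro ⟨Δ, z⟩ h
    simp only [mem_sigma, mem_sdiff] at h
    simp only [insert_erase h.2.1]

end Between

/-- The factor `height` makes the formula valid for every `Δ` in `T`: if `Δ` contains a divisorial
direction, each summand has either height 0 or a set that is not a simplex. -/
theorem gysin_apply_sdiff {l k : ℕ} {c : Weights P} (hc : c ∈ X.propellers l k)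
    {Δ T : Finset P} (hT : T ∈ X.cells) (hΔ : Δ ⊆ T) (hne : Δ.Nonempty) :
    X.gysin c Δ (T \ Δ) = ∑ z ∈ Δ,
      X.height z * ((-1) ^ countLT Δ z * c (Δ.erase z) (insert z (T \ Δ))) := by
  by_cases hv : ∀ x ∈ Δ, X.IsVertex x
  · rw [gysin_apply hc (isSimplex_of_subset_cell hT hΔ hne hv) disjoint_sdiff]
    refine sum_congr rfl fun z hz => ?_
    rw [height_of_isVertex (hv z hz), one_mul]
    rfl
  · rw [gysin, if_neg fun h => hv h.1.2, eq_comm]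
    refine sum_eq_zero fun z hz => ?_
    by_cases hz' : X.IsVertex z
    · have : c (Δ.erase z) (insert z (T \ Δ)) = 0 := by
        by_contra h0
        have h1 := (hc.1 _ _ h0).2.2.1.2
        exact hv fun x hx => if h : x = z then h ▸ hz' else h1 x (mem_erase.2 ⟨h, hx⟩)
      rw [this, mul_zero, mul_zero]
    · rw [height, if_neg hz', zero_mul]

/-- The relation `sum_hullVol_erase` for `B ∪ (T \ Δ)`, split into the part that omits an element of
`B`, where all heights are 1, and the part that omits an element of `T \ Δ`. The rest is parity. -/
theorem stokes_between {k r : ℕ} {B T Δ : Finset P} (hB : B.card = r + 2)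
    (hBv : ∀ x ∈ B, X.IsVertex x) (hΔ : Δ ∈ between B T) (hk : Δ.card = k + 1) :
    ∑ x ∈ B, ((-1 : ℚ) ^ (r * k + r.choose 2) * (-1) ^ countGT B x *
        (-1) ^ crossings (Δ \ B.erase x) (T \ Δ)) • X.hullVol (B.erase x ∪ (T \ Δ)) =
      ∑ z ∈ T \ Δ, ((-1 : ℚ) ^ ((r + 1) * (k + 1) + (r + 1).choose 2) *
        (-1) ^ crossings (insert z Δ \ B) (T \ insert z Δ) *
        (X.height z * (-1) ^ countLT (insert z Δ) z)) •
          X.hullVol (B ∪ (T \ insert z Δ)) := by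
  rw [mem_between] at hΔ
  set q := T \ Δ with hq
  have hdΔ : Disjoint Δ q := disjoint_sdiff
  have hd : Disjoint B q := hdΔ.mono_left hΔ.1
  have hdB : Disjoint (Δ \ B) q := hdΔ.mono_left sdiff_subset
  have hchoose : (r + 1).choose 2 = r + r.choose 2 := by
    rw [Nat.choose_succ_succ' r 1, Nat.choose_one_right]
  have hrk : (r + 1) * (k + 1) = r * k + r + k + 1 := by ring
  have hcardΔ : (Δ \ B).card + (r + 2) = k + 1 := by
    rw [← hB, ← hk, card_sdiff_add_card_eq_card hΔ.1]
  have hS := sum_hullVol_erase (X := X) (B ∪ q)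
  rw [sum_union hd] at hS
  have e1 : ∑ x ∈ B, ((-1 : ℚ) ^ (r * k + r.choose 2) * (-1) ^ countGT B x *
      (-1) ^ crossings (Δ \ B.erase x) q) • X.hullVol (B.erase x ∪ q) =
      (-1 : ℚ) ^ (r * k + r.choose 2 + crossings (Δ \ B) q + r + 1) •
      ∑ x ∈ B, ((-1 : ℚ) ^ countLT (B ∪ q) x * X.height x) • X.hullVol ((B ∪ q).erase x) := by
    rw [smul_sum]
    refine sum_congr rfl fun x hx => ?_
    have hxq : x ∉ q := disjoint_left.1 hd hx
    have h1 : Δ \ B.erase x = insert x (Δ \ B) := sdiff_erase (hΔ.1 hx)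
    rw [h1, crossings_insert_left (by simp [hx]), erase_union_distrib,
      erase_eq_of_notMem hxq, height_of_isVertex (hBv x hx), smul_smul, mul_one, ← pow_add,
      ← pow_add, ← pow_add]
    congr 1
    have h2 := countLT_add_countGT (notMem_erase x B)
    rw [countLT_erase_self, countGT_erase_self, card_erase_of_mem hx, hB] at h2
    have h3 := countLT_union hd x
    exact neg_one_pow_eq_of_mod (by omega)
  have e2 : ∑ z ∈ q, ((-1 : ℚ) ^ ((r + 1) * (k + 1) + (r + 1).choose 2) *
        (-1) ^ crossings (insert z Δ \ B) (T \ insert z Δ) *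
        (X.height z * (-1) ^ countLT (insert z Δ) z)) • X.hullVol (B ∪ (T \ insert z Δ)) =
      -((-1 : ℚ) ^ (r * k + r.choose 2 + crossings (Δ \ B) q + r + 1) •
      ∑ x ∈ q, ((-1 : ℚ) ^ countLT (B ∪ q) x * X.height x) • X.hullVol ((B ∪ q).erase x)) := by
    rw [smul_sum, ← sum_neg_distrib]
    refine sum_congr rfl fun z hz => ?_
    have hzΔ : z ∉ Δ := disjoint_right.1 hdΔ hz
    have hzB : z ∉ B := fun h => hzΔ (hΔ.1 h)
    have h1 : T \ insert z Δ = q.erase z := by rw [hq, sdiff_insert]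
    have h2 : insert z Δ \ B = insert z (Δ \ B) := insert_sdiff_of_notMem _ hzB
    rw [h1, h2, crossings_insert_left (by simp [hzΔ]), erase_union_distrib,
      erase_eq_of_notMem hzB, smul_smul, ← neg_smul, countLT_insert_self, countLT_erase_self]
    congr 1
    have h3 := crossings_insert_right (Δ \ B) (notMem_erase z q)
    rw [insert_erase hz] at h3
    have h4 := countLT_union hd z
    have h5 := countLT_union (disjoint_sdiff (s := B) (t := Δ)) z
    rw [union_sdiff_of_subset hΔ.1] at h5
    have h6 := countLT_add_countGT (A := Δ \ B) (x := z) (by simp [hzΔ])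
    have h7 : (-1 : ℚ) ^ ((r + 1) * (k + 1) + (r + 1).choose 2 +
        (countLT q z + crossings (Δ \ B) (q.erase z)) + countLT Δ z) =
        (-1) ^ (r * k + r.choose 2 + crossings (Δ \ B) q + r + 1 + countLT (B ∪ q) z + 1) :=
      neg_one_pow_eq_of_mod (by omega)
    rw [pow_succ, pow_add, pow_add, pow_add _ _ (countLT (B ∪ q) z)] at h7
    linear_combination X.height z * h7
  rw [e1, e2, ← smul_neg]
  congr 1
  exact eq_neg_of_add_eq_zero_left hS

/-- A simplex between `B \ x` and `T` either omits `x` and gives the term of `d''c` at its union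
with `x`, or it contains `B`. In the latter case the terms with the common weight `c Δ (T \ Δ)` are
matched by `stokes_between`. -/
theorem bracketCoef_gysin {l k r : ℕ} {c : Weights P} (hc : c ∈ X.propellers l k)
    {B T : Finset P} (hB : B.card = r + 2) (hBv : ∀ x ∈ B, X.IsVertex x) (hT : T ∈ X.cells)
    (hBT : B ⊆ T) :
    (-1 : ℚ) ^ (r * k + r.choose 2) •
        ∑ x ∈ B, (-1 : ℚ) ^ countGT B x • X.bracketCoef c (B.erase x) T =
      (-1 : ℚ) ^ ((r + 1) * (k + 1) + (r + 1).choose 2) •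
        X.bracketCoef (X.gysin c) B T := by
  have hBne : B.Nonempty := card_pos.1 (by omega)
  have hchoose : (r + 1).choose 2 = r + r.choose 2 := by
    rw [Nat.choose_succ_succ' r 1, Nat.choose_one_right]
  have hrk : (r + 1) * (k + 1) = r * k + r + k + 1 := by ring
  set s : ℚ := (-1) ^ (r * k + r.choose 2) with hs
  set s' : ℚ := (-1) ^ ((r + 1) * (k + 1) + (r + 1).choose 2) with hs'
  let g : Finset P → P → ExteriorAlgebra ℚ (X.Family × ℚ) := fun Δ z =>
    (s' * (-1) ^ crossings (Δ \ B) (T \ Δ) *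
      (X.height z * ((-1) ^ countLT Δ z * c (Δ.erase z) (insert z (T \ Δ))))) •
        X.hullVol (B ∪ (T \ Δ))
  -- The terms of `d''c` with `z ∈ B` stay in place; those with `z ∈ Δ \ B` are regrouped at the
  -- simplex without `z`.
  have hR : s' • X.bracketCoef (X.gysin c) B T =
      ∑ Δ ∈ between B T, (∑ z ∈ B, g Δ z + ∑ z ∈ T \ Δ, g (insert z Δ) z) := by
    rw [sum_add_distrib, ← sum_between_sdiff B T g, ← sum_add_distrib, bracketCoef, smul_sum]
    refine sum_congr rfl fun Δ hΔ => ?_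
    rw [mem_between] at hΔ
    rw [gysin_apply_sdiff hc hT hΔ.2 (hBne.mono hΔ.1), add_comm, sum_sdiff hΔ.1, smul_smul,
      ← mul_assoc, mul_sum, sum_smul]
  have hL : s • ∑ x ∈ B, (-1 : ℚ) ^ countGT B x • X.bracketCoef c (B.erase x) T =
      ∑ Δ ∈ between B T, (∑ x ∈ B, g Δ x + ∑ x ∈ B, (s * (-1) ^ countGT B x *
        ((-1) ^ crossings (Δ \ B.erase x) (T \ Δ) * c Δ (T \ Δ))) •
          X.hullVol (B.erase x ∪ (T \ Δ))) := by
    have h1 : ∀ x ∈ B, s • (-1 : ℚ) ^ countGT B x • X.bracketCoef c (B.erase x) T =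
        ∑ Δ ∈ between B T, (g Δ x + (s * (-1) ^ countGT B x *
        ((-1) ^ crossings (Δ \ B.erase x) (T \ Δ) * c Δ (T \ Δ))) •
          X.hullVol (B.erase x ∪ (T \ Δ))) := by
      intro x hx
      rw [bracketCoef, sum_between_erase hx hBT, smul_smul, smul_sum]
      refine sum_congr rfl fun Δ hΔ => ?_
      rw [mem_between] at hΔ
      have hxΔ := hΔ.1 hx
      have e1 : T \ Δ.erase x = insert x (T \ Δ) := sdiff_erase (hΔ.2 hxΔ)
      have e2 : B.erase x ∪ insert x (T \ Δ) = B ∪ (T \ Δ) := by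
        rw [union_insert, ← insert_union, insert_erase hx]
      have e3 : Δ.erase x \ B.erase x = Δ \ B := by
        ext y
        simp only [mem_sdiff, mem_erase, not_and]
        constructor
        · rintro ⟨⟨h1, h2⟩, h3⟩; exact ⟨h2, h3 h1⟩
        · rintro ⟨h1, h2⟩; exact ⟨⟨fun h => h2 (h ▸ hx), h1⟩, fun _ => h2⟩
      rw [e1, e2, e3, smul_add, smul_smul, smul_smul, add_comm]
      congr 2
      by_cases h0 : c (Δ.erase x) (insert x (T \ Δ)) = 0
      · simp [h0]
      have hcard := (hc.1 _ _ h0).1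
      rw [card_erase_of_mem hxΔ] at hcard
      have hxq : x ∉ T \ Δ := fun h => (mem_sdiff.1 h).2 hxΔ
      rw [height_of_isVertex (hBv x hx), one_mul, crossings_insert_right _ hxq]
      have h2 := countLT_add_countGT (notMem_erase x Δ)
      rw [countLT_erase_self, countGT_erase_self, card_erase_of_mem hxΔ, hcard] at h2
      have h3 := countGT_union (disjoint_sdiff (s := B) (t := Δ)) x
      rw [union_sdiff_of_subset hΔ.1] at h3
      have h4 : (-1 : ℚ) ^ (r * k + r.choose 2 + countGT B x +
          (countGT (Δ \ B) x + crossings (Δ \ B) (T \ Δ))) =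
          (-1) ^ ((r + 1) * (k + 1) + (r + 1).choose 2 + crossings (Δ \ B) (T \ Δ) +
            countLT Δ x) := neg_one_pow_eq_of_mod (by omega)
      rw [pow_add _ (_ + _ + _) (_ + _), pow_add _ (_ + _) (countGT B x), ← hs,
        pow_add _ (_ + _ + _) (countLT Δ x), pow_add _ (_ + _) (crossings _ _), ← hs'] at h4
      linear_combination (c (Δ.erase x) (insert x (T \ Δ))) * h4
    rw [smul_sum, sum_congr rfl h1, sum_comm]
    simp only [sum_add_distrib]
  rw [hL, hR]
  refine sum_congr rfl fun Δ hΔ => ?_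
  congr 1
  have hins : ∀ z ∈ T \ Δ, (insert z Δ).erase z = Δ ∧ insert z (T \ insert z Δ) = T \ Δ := by
    intro z hz
    exact ⟨erase_insert (mem_sdiff.1 hz).2, by rw [sdiff_insert, insert_erase hz]⟩
  by_cases h0 : c Δ (T \ Δ) = 0
  · rw [sum_eq_zero, sum_eq_zero]
    · intro z hz
      simp only [g]
      rw [(hins z hz).1, (hins z hz).2, h0]
      simp
    · intro z _
      simp [h0]
  · have h1 := congrArg (c Δ (T \ Δ) • ·)
      (stokes_between (X := X) hB hBv hΔ (hc.1 _ _ h0).1)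
    simp only [smul_sum, smul_smul] at h1
    convert h1 using 2 with x hx z hz
    · congr 1
      ring
    · simp only [g]
      rename_i hz
      rw [(hins _ hz).1, (hins _ hz).2]
      congr 1
      ring

end UnimodularTropicalSpace

end

/-! ### The contribution of a new largest cell is `d'`. -/

noncomputable section

namespace UnimodularTropicalSpace

variable {P : Type*} [Fintype P] [LinearOrder P] {X : UnimodularTropicalSpace P}

open CliffordAlgebra (contractLeft)
open ExteriorAlgebra (wedge)

/-! ### Removing the largest cell of a flag -/

/-- The volume element of the cell spanned by `S` and one more point, as a function of that
point, with coefficients at a flag. -/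
def coneVol (τ : X.Flag) (S : Finset P) : X.Family × ℚ →ₗ[ℚ] X.Coef τ :=
  (toCoef τ).toLinearMap ∘ₗ contractLeft (Q := 0) (LinearMap.snd ℚ X.Family ℚ) ∘ₗ
    LinearMap.mulRight ℚ (wedge X.point S) ∘ₗ ExteriorAlgebra.ι ℚ

theorem coneVol_apply (τ : X.Flag) (S : Finset P) (u : X.Family × ℚ) :
    coneVol τ S u = toCoef τ (contractLeft (Q := 0) (LinearMap.snd ℚ X.Family ℚ)
      (ExteriorAlgebra.ι ℚ u * wedge X.point S)) := rfl

theorem coneVol_point_of_mem (τ : X.Flag) {S : Finset P} {x : P} (h : x ∈ S) :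
    coneVol τ S (X.point x) = 0 := by
  rw [coneVol_apply, ExteriorAlgebra.ι_mul_wedge_of_mem _ h, map_zero, map_zero]

theorem coneVol_point_of_notMem (τ : X.Flag) {S : Finset P} {x : P} (h : x ∉ S) :
    coneVol τ S (X.point x) = (-1 : ℚ) ^ countLT S x • toCoef τ (X.hullVol (insert x S)) := by
  rw [coneVol_apply, ExteriorAlgebra.ι_mul_wedge_of_notMem _ h, map_smul, map_smul]
  rfl

/-- Balancing relations hold only in the charts at the vertices of `τ.top`; the cone volume sees
nothing else. -/
theorem coneVol_eq_zero (τ : X.Flag) (S : Finset P) {u : X.Family × ℚ}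
    (h : (X.restrict τ.top).prodMap LinearMap.id u = 0) : coneVol τ S u = 0 := by
  have h1 : X.restrict τ.top u.1 = 0 := congrArg Prod.fst h
  have h2 : LinearMap.snd ℚ X.Family ℚ u = 0 := congrArg Prod.snd h
  have h3 : toTangent τ u = 0 := by
    change (X.divSpan τ.top τ.bot).mkQ (X.restrict τ.top u.1) = 0
    rw [h1, map_zero]
  rw [coneVol_apply, ExteriorAlgebra.contract_ι_mul, h2, zero_smul, zero_sub, map_neg, map_mul,
    toCoef, ExteriorAlgebra.map_apply_ι, h3, map_zero, zero_mul, neg_zero]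

/-- Multiplication by the product of the points of `B ∪ (τ.top \ Δ)` kills every term of the
balancing relation whose point lies in that set, and leaves the outer points together with `Δ \ B`.
-/
theorem sum_coneVol_of_balance {c : Weights P} {τ : X.Flag} {Δ B : Finset P} {a : P → ℚ}
    (hΔ : Δ ⊆ τ.top) (hB : B ⊆ Δ)
    (ha : ∑ x ∈ univ.filter (fun x => x ∉ τ.top),
        c Δ (insert x (τ.top \ Δ)) • X.pointAt τ.top x +
        ∑ w ∈ τ.top, a w • X.pointAt τ.top w = 0) :
    ∑ x ∈ univ.filter (fun x => x ∉ τ.top), (c Δ (insert x (τ.top \ Δ)) *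
        (-1) ^ countLT (B ∪ (τ.top \ Δ)) x) •
          toCoef τ (X.hullVol (insert x (B ∪ (τ.top \ Δ)))) +
      ∑ w ∈ Δ \ B, (a w * (-1) ^ countLT (B ∪ (τ.top \ Δ)) w) •
        toCoef τ (X.hullVol (insert w (B ∪ (τ.top \ Δ)))) = 0 := by
  have h1 : coneVol τ (B ∪ (τ.top \ Δ)) (∑ x ∈ univ.filter (fun x => x ∉ τ.top),
      c Δ (insert x (τ.top \ Δ)) • X.point x + ∑ w ∈ τ.top, a w • X.point w) = 0 := by
    refine coneVol_eq_zero τ _ ?_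
    rw [map_add, map_sum, map_sum]
    simp only [map_smul]
    exact ha
  have hS : B ∪ (τ.top \ Δ) ⊆ τ.top := union_subset (hB.trans hΔ) sdiff_subset
  have hsd : τ.top \ (B ∪ (τ.top \ Δ)) = Δ \ B := by
    ext y
    simp only [mem_sdiff, mem_union, not_or, not_and, not_not]
    exact ⟨fun h => ⟨h.2.2 h.1, h.2.1⟩, fun h => ⟨hΔ h.1, h.2, fun _ => h.1⟩⟩
  rw [map_add, map_sum, map_sum, ← sum_sdiff hS, hsd] at h1
  rw [sum_eq_zero (s := B ∪ (τ.top \ Δ)), add_zero] at h1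
  · rw [← h1]
    congr 1
    · refine sum_congr rfl fun x hx => ?_
      rw [map_smul, coneVol_point_of_notMem τ fun h => (mem_filter.1 hx).2 (hS h), smul_smul]
    · refine sum_congr rfl fun w hw => ?_
      rw [← hsd] at hw
      rw [map_smul, coneVol_point_of_notMem τ (mem_sdiff.1 hw).2, smul_smul]
  · intro w hw
    rw [map_smul, coneVol_point_of_mem τ hw, smul_zero]

variable (X) in
/-- The descent coefficient, extended by zero. -/
def descentOrZero (c : Weights P) (Δ : Finset P) (v : P) (r : Finset P) : ℚ :=
  if X.IsSimplex Δ then X.descent c Δ v r else 0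

theorem inclusion_apply_sdiff {l k : ℕ} {c : Weights P} (hc : c ∈ X.propellers l k)
    {Δ T : Finset P} (hT : T ∈ X.cells) (hΔ : Δ ⊆ T) (hne : Δ.Nonempty) :
    X.inclusion c Δ (T \ Δ) =
      ∑ v ∈ univ.filter (fun v => v ∉ T), (-1) ^ countLT Δ v * c (insert v Δ) (T \ Δ) +
      ∑ v ∈ T \ Δ, (-1) ^ countLT Δ v *
        X.descentOrZero c (insert v Δ) v ((T \ Δ).erase v) := by
  have hinsert : ∀ v, X.IsSimplex (insert v Δ) → X.IsSimplex Δ := fun v h =>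
    h.subset (subset_insert _ _) hne
  by_cases hs : X.IsSimplex Δ
  · have hu : univ.filter (fun v => v ∉ Δ) = univ.filter (fun v => v ∉ T) ∪ T \ Δ := by
      ext v
      simp only [mem_filter, mem_univ, true_and, mem_union, mem_sdiff]
      by_cases h1 : v ∈ T
      · simp [h1]
      · have h2 : v ∉ Δ := fun h => h1 (hΔ h)
        simp [h1, h2]
    rw [inclusion, if_pos hs, ← filter_filter, sum_filter, hu, sum_union]
    · congr 1
      · refine sum_congr rfl fun v hv => ?_
        have hvq : v ∉ T \ Δ := fun h => (mem_filter.1 hv).2 (mem_sdiff.1 h).1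
        rw [if_pos hvq, insertSign_insert]
        split_ifs with h
        · rfl
        · have : c (insert v Δ) (T \ Δ) = 0 := by
            by_contra h0
            exact h (hc.1 _ _ h0).2.2.1
          rw [this, mul_zero]
      · refine sum_congr rfl fun v hv => ?_
        obtain ⟨hvT, hvΔ⟩ := mem_sdiff.1 hv
        rw [if_neg (not_not.2 hv), insertSign_insert, descentOrZero]
        split_ifs with h1 h2
        · rfl
        · refine absurd ⟨h1, ?_, ?_⟩ h2
          · rw [← sdiff_insert]; exact disjoint_sdiff
          · rw [← sdiff_insert, union_sdiff_of_subset (insert_subset hvT hΔ)]; exact hT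
        · rw [mul_zero]
    · rw [disjoint_left]
      intro v hv h
      exact (mem_filter.1 hv).2 (mem_sdiff.1 h).1
  · rw [inclusion, if_neg hs, sum_eq_zero, sum_eq_zero, add_zero]
    · intro v _
      rw [descentOrZero, if_neg fun h => hs (hinsert v h), mul_zero]
    · intro v _
      have : c (insert v Δ) (T \ Δ) = 0 := by
        by_contra h0
        exact hs (hinsert v (hc.1 _ _ h0).2.2.1)
      rw [this, mul_zero]

/-- The terms from cells `T ∪ z` with `z ∉ Δ` are the outer half of `sum_coneVol_of_balance`; its
inner half consists of the descent coefficients at `w ∈ Δ \ B`, that is, of the second sum in `d'c`.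
-/
theorem balance_between {l k r : ℕ} {c : Weights P} (hc : c ∈ X.propellers l k) (hr : r ≤ k)
    {τ : X.Flag} (hτ : τ.IsSaturated) (hB : τ.bot.card = r + 1) {Δ : Finset P}
    (hΔ : Δ ∈ between τ.bot τ.top) :
    ∑ z ∈ univ.filter (fun z => z ∉ τ.top), ((-1 : ℚ) ^ τ.1.card *
        (-1) ^ (r * k + r.choose 2) * (-1) ^ countGT τ.top z *
        ((-1) ^ crossings (Δ \ τ.bot) (insert z (τ.top \ Δ)) * c Δ (insert z (τ.top \ Δ)))) •
          toCoef τ (X.hullVol (τ.bot ∪ insert z (τ.top \ Δ))) =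
      ∑ w ∈ Δ \ τ.bot, ((-1 : ℚ) ^ (r * (k - 1) + r.choose 2) *
        ((-1) ^ crossings (Δ.erase w \ τ.bot) (insert w (τ.top \ Δ)) *
          ((-1) ^ countLT Δ w * X.descentOrZero c Δ w (τ.top \ Δ)))) •
            toCoef τ (X.hullVol (τ.bot ∪ insert w (τ.top \ Δ))) := by
  rw [mem_between] at hΔ
  have hdΔ : Disjoint Δ (τ.top \ Δ) := disjoint_sdiff
  have hΔu : Δ ∪ (τ.top \ Δ) = τ.top := union_sdiff_of_subset hΔ.2
  have hBne : τ.bot.Nonempty := card_pos.1 (by omega)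
  have hdes : ∀ w ∈ Δ \ τ.bot, (Δ.erase w).Nonempty := fun w hw => by
    obtain ⟨b, hb⟩ := hBne
    exact ⟨b, mem_erase.2 ⟨fun h => (mem_sdiff.1 hw).2 (h ▸ hb), hΔ.1 hb⟩⟩
  by_cases hs : X.IsSimplex Δ ∧ Δ.card = k + 1
  swap
  · have h0 : ∀ q, c Δ q = 0 := fun q => by
      by_contra h0
      exact hs ⟨(hc.1 _ _ h0).2.2.1, (hc.1 _ _ h0).1⟩
    rw [sum_eq_zero, sum_eq_zero]
    · intro w hw
      rw [descentOrZero]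
      split_ifs with h
      · have hL : X.IsLink Δ (τ.top \ Δ) := ⟨h, hdΔ, by rw [hΔu]; exact τ.top_mem_cells⟩
        rw [descent_eq_zero hL (mem_sdiff.1 hw).1 (hdes w hw) fun x _ => h0 _]
        simp
      · simp
    · intro z _
      rw [h0]
      simp
  obtain ⟨hs, hk⟩ := hs
  have hL : X.IsLink Δ (τ.top \ Δ) := ⟨hs, hdΔ, by rw [hΔu]; exact τ.top_mem_cells⟩
  obtain ⟨a, ha⟩ := exists_balance hc hL
  have hdesc : ∀ w ∈ Δ \ τ.bot, X.descentOrZero c Δ w (τ.top \ Δ) = a w := fun w hw => by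
    rw [descentOrZero, if_pos hs]
    exact (isDescent_of_balance hL ha (mem_sdiff.1 hw).1 (hdes w hw)).descent_eq hL
      (mem_sdiff.1 hw).1 (hdes w hw)
  rw [hΔu] at ha
  have key := sum_coneVol_of_balance hΔ.2 hΔ.1 ha
  set q := τ.top \ Δ with hq
  set B := τ.bot with hBdef
  have hd : Disjoint B q := hdΔ.mono_left hΔ.1
  have hcT : τ.top.card = k + 1 + q.card := by
    rw [← hΔu, card_union_of_disjoint hdΔ, hk]
  have hsat : τ.1.card + (r + 1) = τ.top.card + 1 := by rw [← hB]; exact hτ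
  have hcS : (B ∪ q).card = r + 1 + q.card := by rw [card_union_of_disjoint hd, hB]
  -- Parity of the change from `r * k` to `r * (k - 1)`. When `k = 0` the subtraction is truncated,
  -- but then `r = 0`.
  have hrk : r * k + r * (k - 1) + r = 2 * (r * k) := by
    rcases Nat.eq_zero_or_pos k with h | h
    · have : r = 0 := by omega
      simp [this]
    · obtain ⟨k', rfl⟩ : ∃ k', k = k' + 1 := ⟨k - 1, by omega⟩
      rw [Nat.add_sub_cancel]; ring
  have hcardΔ : (Δ \ B).card + (r + 1) = k + 1 := by
    rw [← hB, ← hk, card_sdiff_add_card_eq_card hΔ.1]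
  set K : ℚ := (-1) ^ (r * k + r.choose 2 + k + crossings (Δ \ B) q) with hK
  have e1 : ∀ z ∈ univ.filter (fun z => z ∉ τ.top), ((-1 : ℚ) ^ τ.1.card *
        (-1) ^ (r * k + r.choose 2) * (-1) ^ countGT τ.top z *
        ((-1) ^ crossings (Δ \ B) (insert z q) * c Δ (insert z q))) •
          toCoef τ (X.hullVol (B ∪ insert z q)) =
      K • (c Δ (insert z q) * (-1) ^ countLT (B ∪ q) z) •
        toCoef τ (X.hullVol (insert z (B ∪ q))) := by
    intro z hz
    have hzT := (mem_filter.1 hz).2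
    have hzq : z ∉ q := fun h => hzT (mem_sdiff.1 h).1
    have hzS : z ∉ B ∪ q := fun h =>
      hzT (union_subset (hΔ.1.trans hΔ.2) sdiff_subset h)
    rw [union_insert, smul_smul]
    congr 1
    have h1 := crossings_insert_right (Δ \ B) hzq
    have h2 := countGT_union hdΔ z
    rw [hΔu] at h2
    have h3 := countGT_union (disjoint_sdiff (s := B) (t := Δ)) z
    rw [union_sdiff_of_subset hΔ.1] at h3
    have h4 := countGT_union hd z
    have h5 := countLT_add_countGT hzS
    have h6 : (-1 : ℚ) ^ (τ.1.card + (r * k + r.choose 2) + countGT τ.top z +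
        crossings (Δ \ B) (insert z q)) =
        (-1) ^ (r * k + r.choose 2 + k + crossings (Δ \ B) q + countLT (B ∪ q) z) :=
      neg_one_pow_eq_of_mod (by omega)
    rw [pow_add _ _ (crossings (Δ \ B) (insert z q)), pow_add _ _ (countGT τ.top z),
      pow_add _ τ.1.card, pow_add _ _ (countLT (B ∪ q) z), ← hK] at h6
    linear_combination c Δ (insert z q) * h6
  have e2 : ∀ w ∈ Δ \ B, ((-1 : ℚ) ^ (r * (k - 1) + r.choose 2) *
        ((-1) ^ crossings (Δ.erase w \ B) (insert w q) *
          ((-1) ^ countLT Δ w * X.descentOrZero c Δ w q))) •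
            toCoef τ (X.hullVol (B ∪ insert w q)) =
      -(K • (a w * (-1) ^ countLT (B ∪ q) w) •
        toCoef τ (X.hullVol (insert w (B ∪ q)))) := by
    intro w hw
    have hwΔ := (mem_sdiff.1 hw).1
    have hwq : w ∉ q := disjoint_left.1 hdΔ hwΔ
    rw [union_insert, smul_smul, ← neg_smul, hdesc w hw]
    congr 1
    have h1 : Δ.erase w \ B = (Δ \ B).erase w := by
      rw [erase_sdiff_comm]
    have h2 := crossings_insert_right ((Δ \ B).erase w) hwq
    rw [countGT_erase_self] at h2
    have h3 := crossings_insert_left (notMem_erase w (Δ \ B)) q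
    rw [insert_erase hw] at h3
    have h4 := countLT_union (disjoint_sdiff (s := B) (t := Δ)) w
    rw [union_sdiff_of_subset hΔ.1] at h4
    have h5 := countLT_union hd w
    have h6 := countLT_add_countGT (notMem_erase w (Δ \ B))
    rw [countLT_erase_self, countGT_erase_self, card_erase_of_mem hw] at h6
    have h7 : 0 < (Δ \ B).card := card_pos.2 ⟨w, hw⟩
    have h8 : (-1 : ℚ) ^ (r * (k - 1) + r.choose 2 +
        crossings ((Δ \ B).erase w) (insert w q) + countLT Δ w) =
        (-1) ^ (r * k + r.choose 2 + k + crossings (Δ \ B) q + countLT (B ∪ q) w + 1) :=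
      neg_one_pow_eq_of_mod (by omega)
    rw [pow_add _ _ (countLT Δ w), pow_add _ _ (crossings ((Δ \ B).erase w) _), pow_succ,
      pow_add _ _ (countLT (B ∪ q) w), ← hK] at h8
    rw [h1]
    linear_combination a w * h8
  rw [sum_congr rfl e1, sum_congr rfl e2, sum_neg_distrib, ← smul_sum, ← smul_sum, ← smul_neg]
  congr 1
  exact eq_neg_of_add_eq_zero_left key

/-- A simplex between `B` and `T ∪ z` either contains `z`, giving the terms of `d'c` that keep their
weight, or lies in `T`, where `balance_between` produces the descent terms. -/
theorem bracketCoef_inclusion {l k r : ℕ} {c : Weights P} (hc : c ∈ X.propellers l k)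
    (hr : r ≤ k) {τ : X.Flag} (hτ : τ.IsSaturated) (hB : τ.bot.card = r + 1) :
    ((-1 : ℚ) ^ τ.1.card * (-1) ^ (r * k + r.choose 2)) •
        toCoef τ (∑ z ∈ univ.filter (fun z => z ∉ τ.top),
          (-1 : ℚ) ^ countGT τ.top z • X.bracketCoef c τ.bot (insert z τ.top)) =
      (-1 : ℚ) ^ (r * (k - 1) + r.choose 2) •
        toCoef τ (X.bracketCoef (X.inclusion c) τ.bot τ.top) := by
  set B := τ.bot with hBdef
  set T := τ.top with hTdef
  have hBT : B ⊆ T := τ.bot_subset_top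
  have hBne : B.Nonempty := card_pos.1 (by omega)
  set s' : ℚ := (-1) ^ (r * (k - 1) + r.choose 2) with hs'
  let t : ℚ := (-1 : ℚ) ^ τ.1.card * (-1) ^ (r * k + r.choose 2)
  let f : Finset P → P → X.Coef τ := fun Δ z =>
    (s' * ((-1) ^ crossings (Δ \ B) (T \ Δ) * ((-1) ^ countLT Δ z *
      c (insert z Δ) (T \ Δ)))) • toCoef τ (X.hullVol (B ∪ (T \ Δ)))
  let g : Finset P → P → X.Coef τ := fun Δ v =>
    (s' * ((-1) ^ crossings (Δ \ B) (T \ Δ) * ((-1) ^ countLT Δ v *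
      X.descentOrZero c (insert v Δ) v ((T \ Δ).erase v)))) •
        toCoef τ (X.hullVol (B ∪ (T \ Δ)))
  have hR : s' • toCoef τ (X.bracketCoef (X.inclusion c) B T) =
      ∑ Δ ∈ between B T, (∑ z ∈ univ.filter (fun z => z ∉ T), f Δ z +
        ∑ w ∈ Δ \ B, g (Δ.erase w) w) := by
    rw [sum_add_distrib, sum_between_sdiff B T fun Δ w => g (Δ.erase w) w, ← sum_add_distrib,
      bracketCoef, map_sum, smul_sum]
    refine sum_congr rfl fun Δ hΔ => ?_
    rw [mem_between] at hΔ
    rw [inclusion_apply_sdiff hc τ.top_mem_cells hΔ.2 (hBne.mono hΔ.1), map_smul, smul_smul,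
      mul_add, mul_add, mul_sum, mul_sum, mul_sum, mul_sum, add_smul, sum_smul, sum_smul]
    congr 1
    refine sum_congr rfl fun v hv => ?_
    rw [erase_insert (mem_sdiff.1 hv).2]
  have hL : t • toCoef τ (∑ z ∈ univ.filter (fun z => z ∉ T),
      (-1 : ℚ) ^ countGT T z • X.bracketCoef c B (insert z T)) =
      ∑ Δ ∈ between B T, (∑ z ∈ univ.filter (fun z => z ∉ T), f Δ z +
        ∑ z ∈ univ.filter (fun z => z ∉ T), (t * (-1) ^ countGT T z *
        ((-1) ^ crossings (Δ \ B) (insert z (T \ Δ)) * c Δ (insert z (T \ Δ)))) •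
          toCoef τ (X.hullVol (B ∪ insert z (T \ Δ)))) := by
    have h1 : ∀ z ∈ univ.filter (fun z => z ∉ T),
        t • toCoef τ ((-1 : ℚ) ^ countGT T z • X.bracketCoef c B (insert z T)) =
        ∑ Δ ∈ between B T, (f Δ z + (t * (-1) ^ countGT T z *
        ((-1) ^ crossings (Δ \ B) (insert z (T \ Δ)) * c Δ (insert z (T \ Δ)))) •
          toCoef τ (X.hullVol (B ∪ insert z (T \ Δ)))) := by
      intro z hz
      have hzT := (mem_filter.1 hz).2
      rw [bracketCoef, sum_between_insert hzT hBT, map_smul, map_sum, smul_smul, smul_sum]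
      refine sum_congr rfl fun Δ hΔ => ?_
      rw [mem_between] at hΔ
      have hzΔ : z ∉ Δ := fun h => hzT (hΔ.2 h)
      have hzB : z ∉ B := fun h => hzT (hBT h)
      have e1 : insert z T \ insert z Δ = T \ Δ := by
        ext y
        simp only [mem_sdiff, mem_insert, not_or]
        constructor
        · rintro ⟨h1 | h1, h2, h3⟩
          · exact absurd h1 h2
          · exact ⟨h1, h3⟩
        · rintro ⟨h1, h2⟩
          exact ⟨Or.inr h1, fun h => hzT (h ▸ h1), h2⟩
      have e2 : insert z T \ Δ = insert z (T \ Δ) := insert_sdiff_of_notMem _ hzΔ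
      have e3 : insert z Δ \ B = insert z (Δ \ B) := insert_sdiff_of_notMem _ hzB
      rw [e1, e2, e3, map_add, map_smul, map_smul, smul_add, smul_smul, smul_smul]
      congr 2
      by_cases h0 : c (insert z Δ) (T \ Δ) = 0
      · simp [h0]
      have hcard := (hc.1 _ _ h0).1
      rw [card_insert_of_notMem hzΔ] at hcard
      have hcT : T.card = k + (T \ Δ).card := by
        rw [card_sdiff_of_subset hΔ.2]
        have := card_le_card hΔ.2
        omega
      have hsat : τ.1.card + (r + 1) = T.card + 1 := by rw [← hB]; exact hτ
      have hrk : r * k + r * (k - 1) + r = 2 * (r * k) := by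
        rcases Nat.eq_zero_or_pos k with h | h
        · have : r = 0 := by omega
          simp [this]
        · obtain ⟨k', rfl⟩ : ∃ k', k = k' + 1 := ⟨k - 1, by omega⟩
          rw [Nat.add_sub_cancel]; ring
      rw [crossings_insert_left (by simp [hzΔ])]
      have h2 := countGT_union (disjoint_sdiff (s := Δ) (t := T)) z
      rw [union_sdiff_of_subset hΔ.2] at h2
      have h3 := countLT_add_countGT hzΔ
      have h4 := countLT_add_countGT (A := T \ Δ) (x := z) (by simp [hzT])
      have h5 : (-1 : ℚ) ^ (τ.1.card + (r * k + r.choose 2) + countGT T z +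
          (countLT (T \ Δ) z + crossings (Δ \ B) (T \ Δ))) =
          (-1) ^ (r * (k - 1) + r.choose 2 + crossings (Δ \ B) (T \ Δ) + countLT Δ z) :=
        neg_one_pow_eq_of_mod (by omega)
      rw [pow_add _ (_ + _ + countGT T z) (_ + _), pow_add _ _ (countGT T z),
        pow_add _ τ.1.card, pow_add _ _ (countLT Δ z), pow_add _ (r * (k - 1) + r.choose 2) (crossings (Δ \ B) (T \ Δ)),
        ← hs'] at h5
      simp only [t]
      linear_combination (c (insert z Δ) (T \ Δ)) * h5
    rw [map_sum, smul_sum, sum_congr rfl h1, sum_comm]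
    simp only [sum_add_distrib]
  rw [hR]
  refine hL.trans (sum_congr rfl fun Δ hΔ => ?_)
  congr 1
  refine (balance_between hc hr hτ hB hΔ).trans (sum_congr rfl fun w hw => ?_)
  have hwΔ := (mem_sdiff.1 hw).1
  have hwq : w ∉ T \ Δ := fun h => (mem_sdiff.1 h).2 hwΔ
  simp only [g]
  rw [insert_erase hwΔ, countLT_erase_self, sdiff_erase ((mem_between.1 hΔ).2 hwΔ),
    erase_insert hwq]

end UnimodularTropicalSpace

end

/-! ### The boundary formula and the injectivity of `c ↦ c[-r]`. -/

noncomputable section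

namespace UnimodularTropicalSpace

variable {P : Type*} [Fintype P] [LinearOrder P] {X : UnimodularTropicalSpace P}

open CliffordAlgebra (contractLeft)
open ExteriorAlgebra (wedge)

/-! ### The boundary formula -/

theorem toCoef_bracketCoef_erase_eq_zero {l k : ℕ} {c : Weights P} (hc : c ∈ X.propellers l k)
    {τ : X.Flag} {w : P} (hw : w ∈ τ.bot) (hv : ¬ X.IsVertex w) (x : P) :
    toCoef τ (X.bracketCoef c (τ.bot.erase x) τ.top) = 0 := by
  rw [bracketCoef, map_sum]
  refine sum_eq_zero fun Δ _ => ?_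
  by_cases h0 : c Δ (τ.top \ Δ) = 0
  · rw [h0, mul_zero, zero_smul, map_zero]
  · have h1 := (hc.1 _ _ h0).2.2.1.2
    have hwΔ : w ∉ Δ := fun h => hv (h1 w h)
    rw [map_smul, toCoef_hullVol_eq_zero τ
      (mem_union_right _ (mem_sdiff.2 ⟨τ.bot_subset_top hw, hwΔ⟩)) hw hv, smul_zero]

theorem boundary_bracket {l k r : ℕ} (hr : r ≤ k) {c : Weights P} (hc : c ∈ X.propellers l k) :
    X.boundary (X.bracket r c) =
      X.bracket r (X.inclusion c) + X.bracket (r + 1) (X.gysin c) := by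
  have hc' : ∀ Δ q, c Δ q ≠ 0 → Δ.card = k + 1 ∧ X.IsLink Δ q := fun Δ q h =>
    ⟨(hc.1 Δ q h).1, (hc.1 Δ q h).2.2⟩
  -- For `k = 0` the form `k - 1 + 1` is harmless: the support would consist of empty simplices, and
  -- there are none.
  have hi : ∀ Δ q, X.inclusion c Δ q ≠ 0 → Δ.card = k - 1 + 1 ∧ X.IsLink Δ q := fun Δ q h => by
    obtain ⟨h1, -, h2⟩ := inclusion_support hc h
    have := h2.1.nonempty.card_pos
    exact ⟨by omega, h2⟩
  have hg : ∀ Δ q, X.gysin c Δ q ≠ 0 → Δ.card = k + 1 + 1 ∧ X.IsLink Δ q := fun Δ q h =>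
    ⟨(gysin_support hc h).1, (gysin_support hc h).2.2⟩
  funext τ
  rw [Pi.add_apply, bracket_apply hi, bracket_apply hg]
  by_cases hτ : τ.IsSaturated
  swap
  · rw [boundary_bracket_of_not_isSaturated hc' hτ, if_neg fun h => hτ h.2,
      if_neg fun h => hτ h.2, add_zero]
  by_cases h1 : τ.bot.card = r + 1
  · rw [boundary_bracket_of_top hc' hτ h1, if_pos ⟨h1, hτ⟩, if_neg (by omega), add_zero,
      mul_comm _ τ.orientation, mul_assoc, mul_smul, bracketCoef_inclusion hc hr hτ h1, mul_smul]
  by_cases h2 : τ.bot.card = r + 2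
  · rw [boundary_bracket_of_bot hc' hτ h2, if_neg fun h => h1 h.1, if_pos ⟨h2, hτ⟩, zero_add]
    by_cases hv : ∀ x ∈ τ.bot, X.IsVertex x
    · rw [mul_smul, ← map_smul, bracketCoef_gysin hc h2 hv τ.top_mem_cells τ.bot_subset_top,
        map_smul, mul_smul]
    -- The smallest cell contains a divisorial direction: the boundary vanishes in the quotient by
    -- it, and `d''c` has no simplex above such a cell.
    · push Not at hv
      obtain ⟨w, hw, hw'⟩ := hv
      rw [map_sum, sum_eq_zero, bracketCoef_eq_zero hg (card_pos.1 (by omega))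
        fun h => hw' (h.1.2 w hw), map_zero, smul_zero, smul_zero]
      intro x _
      rw [map_smul, toCoef_bracketCoef_erase_eq_zero hc hw hw', smul_zero]
  · rw [boundary_bracket_of_ne hc' h1 h2, if_neg fun h => h1 h.1, if_neg fun h => h2 h.1,
      add_zero]

/-! ### Injectivity -/

/-- Elements are added one at a time; each intermediate set contains a vertex of `B` and is
therefore a cell. -/
theorem exists_saturated {B T : Finset P} (hB : B ∈ X.cells) (hT : T ∈ X.cells) (h : B ⊆ T) :
    ∃ σ : X.Flag, σ.bot = B ∧ σ.top = T ∧ σ.IsSaturated := by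
  obtain ⟨v, hv, hv'⟩ := X.exists_vertex B hB
  suffices ∀ A : Finset P, Disjoint B A → B ∪ A ∈ X.cells →
      ∃ σ : X.Flag, σ.bot = B ∧ σ.top = B ∪ A ∧ σ.IsSaturated by
    have := this (T \ B) disjoint_sdiff
    rw [union_sdiff_of_subset h] at this
    exact this hT
  intro A
  induction A using Finset.induction_on with
  | empty =>
    intro _ _
    let σ : X.Flag := ⟨{B}, singleton_nonempty _, by simpa using hB, by simp⟩
    have hm : B ∈ σ.1 := mem_singleton_self B
    have h1 : σ.bot = B := Flag.bot_eq hm fun G hG => (mem_singleton.1 hG).symm ▸ Subset.rfl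
    have h2 : σ.top = B := Flag.top_eq hm fun G hG => (mem_singleton.1 hG).symm ▸ Subset.rfl
    refine ⟨σ, h1, by rw [union_empty, h2], ?_⟩
    rw [Flag.IsSaturated, h1, h2, add_comm]
    rfl
  | insert x A hx ih =>
    intro hd hA
    rw [disjoint_insert_right] at hd
    rw [union_insert] at hA ⊢
    obtain ⟨σ, h1, h2, h3⟩ := ih hd.2 (X.down_closed _ hA _ (subset_insert _ _)
      ⟨v, mem_union_left _ hv, hv'⟩)
    have hxT : x ∉ σ.top := by rw [h2]; simp [hd.1, hx]
    rw [← h2] at hA ⊢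
    have hcof : IsCoface σ (insert x σ.top) :=
      ⟨fun h => hxT (Flag.subset_top h (mem_insert_self _ _)), hA, fun G hG =>
        Or.inr ((Flag.subset_top hG).trans (subset_insert _ _))⟩
    refine ⟨σ.ins (insert x σ.top), ?_, hcof.top_of_superset (subset_insert _ _), ?_⟩
    · rw [hcof.bot_of_superset (σ.bot_subset_top.trans (subset_insert _ _)), h1]
    · exact (hcof.isSaturated_of_top_subset (ssubset_insert hxT)).2
        ⟨h3, card_insert_of_notMem hxT⟩

theorem toCoef_hullVol {σ : X.Flag} {S : Finset P} {y : P} (hy : y ∈ S) (hv : X.IsVertex y) :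
    toCoef σ (X.hullVol S) = (-1 : ℚ) ^ countLT (S.erase y) y •
      wedge (R := ℚ) (fun x => (X.divSpan σ.top σ.bot).mkQ (X.disp σ.top y x)) (S.erase y) := by
  have h1 := ExteriorAlgebra.contract_prod_cons X.point (LinearMap.snd ℚ X.Family ℚ) y
    (height_of_isVertex hv) ((S.erase y).sort (· ≤ ·))
  rw [List.map_cons, List.prod_cons] at h1
  rw [hullVol, ← insert_erase hy, ExteriorAlgebra.wedge_insert_eq _ (notMem_erase _ _),
    erase_insert (notMem_erase _ _), map_smul, map_smul]
  congr 1
  refine (congrArg (toCoef σ) h1).trans ?_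
  change toCoef σ (wedge (R := ℚ) (fun x => X.point x - X.height x • X.point y) (S.erase y)) = _
  rw [toCoef, ExteriorAlgebra.map_wedge]
  congr 1
  funext x
  exact toTangent_point_sub σ y x

theorem linearIndepOn_disp {E : Finset P} (hE : E ∈ X.cells) {y : P} (hy : y ∈ E)
    (hv : X.IsVertex y) : LinearIndepOn ℚ (X.disp E y) (E.erase y : Set P) := by
  have h1 := linearIndepOn_pointAt hE
  rw [linearIndepOn_finset_iff] at h1 ⊢
  intro g hg x hx
  -- The coefficient of `y` is chosen so that the heights cancel; a relation between displacements
  -- becomes one between points.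
  have h2 : ∑ x ∈ E, (if x = y then -∑ z ∈ E.erase y, g z * X.height z else g x) •
      X.pointAt E x = 0 := by
    rw [← add_sum_erase _ _ hy, if_pos rfl]
    have h3 : ∑ x ∈ E.erase y, (if x = y then -∑ z ∈ E.erase y, g z * X.height z else g x) •
        X.pointAt E x = ∑ x ∈ E.erase y, g x • X.pointAt E x :=
      sum_congr rfl fun z hz => by rw [if_neg (ne_of_mem_erase hz)]
    rw [h3]
    ext1
    · refine Eq.trans ?_ hg
      simp [Prod.fst_sum, disp_eq, smul_sub, sum_sub_distrib, smul_smul, sum_smul]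
      abel
    · simp [Prod.snd_sum, pointAt_snd, height_of_isVertex hv]
  have := h1 _ h2 x (mem_of_mem_erase hx)
  rwa [if_neg (ne_of_mem_erase hx)] at this

theorem divSpan_eq_bot {E B : Finset P} (h : ∀ x ∈ B, X.IsVertex x) : X.divSpan E B = ⊥ := by
  rw [divSpan, Submodule.span_eq_bot]
  rintro _ ⟨x, hx, hv, -⟩
  exact absurd (h x hx) hv

/-- A nonzero weight at `(Δ, q)` is seen at any saturated flag from `r + 1` vertices of `Δ` to `Δ ∪
q`. Since that smallest cell has no divisorial directions, no quotient is taken, and distinct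
simplices give products over distinct subsets of a basis of displacements. -/
theorem eq_zero_of_bracket_eq_zero {l k r : ℕ} (hr : r ≤ k) {c : Weights P}
    (hc : c ∈ X.propellers l k) (h : X.bracket r c = 0) : c = 0 := by
  funext Δ q
  by_contra h0
  obtain ⟨hk, hl, hL⟩ := hc.1 Δ q h0
  obtain ⟨B, hBΔ, hB⟩ := exists_subset_card_eq (show r + 1 ≤ Δ.card by omega)
  have hBs : X.IsSimplex B := hL.1.subset hBΔ (card_pos.1 (by omega))
  obtain ⟨σ, rfl, h2, h3⟩ := exists_saturated hBs.1 hL.2.2 (hBΔ.trans subset_union_left)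
  obtain ⟨y, hy⟩ := hBs.nonempty
  have hyv := hBs.2 y hy
  have h4 := congrFun h σ
  rw [bracket_apply (k := k) (fun Δ q h => ⟨(hc.1 Δ q h).1, (hc.1 Δ q h).2.2⟩),
    if_pos ⟨hB, h3⟩] at h4
  have h5 : σ.orientation * (-1 : ℚ) ^ (r * k + r.choose 2) ≠ 0 :=
    mul_ne_zero (left_ne_zero_of_mul_eq_one σ.orientation_mul_self)
      (pow_ne_zero _ (by norm_num))
  have h6 := (smul_eq_zero.1 h4).resolve_left h5
  set T := σ.top with hT
  have hBT : σ.bot ⊆ T := σ.bot_subset_top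
  have hyT : y ∈ T := hBT hy
  let s := (between σ.bot T).filter fun Δ => Δ.card = k + 1
  have h7 : ∑ Δ ∈ s, ((-1 : ℚ) ^ crossings (Δ \ σ.bot) (T \ Δ) * c Δ (T \ Δ) *
      (-1) ^ countLT ((σ.bot ∪ (T \ Δ)).erase y) y) • wedge (R := ℚ)
        (fun x => (X.divSpan σ.top σ.bot).mkQ (X.disp σ.top y x)) ((σ.bot ∪ (T \ Δ)).erase y) = 0 := by
    rw [bracketCoef, map_sum] at h6
    rw [← h6, sum_filter]
    refine sum_congr rfl fun Δ' _ => ?_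
    split_ifs with h8
    · rw [map_smul, toCoef_hullVol (mem_union_left _ hy) hyv, smul_smul]
    · have : c Δ' (σ.top \ Δ') = 0 := by
        by_contra h9
        exact h8 (hc.1 _ _ h9).1
      rw [this, mul_zero, zero_smul, map_zero]
  have hli : LinearIndepOn ℚ (fun x => (X.divSpan σ.top σ.bot).mkQ (X.disp σ.top y x))
      (T.erase y : Set P) := by
    refine (linearIndepOn_disp σ.top_mem_cells hyT hyv).linearIndependent.map' _ ?_
    rw [Submodule.ker_mkQ]
    exact divSpan_eq_bot hBs.2
  have h8 := ExteriorAlgebra.eq_zero_of_sum_wedge_eq_zero hli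
    (S := fun Δ => (σ.bot ∪ (T \ Δ)).erase y) (n := r + T.card - (k + 1)) ?_ ?_ _ h7 Δ ?_
  · have h9 : T \ Δ = q := by rw [h2, union_sdiff_cancel_left hL.2.1]
    rw [h9] at h8
    have h10 : ∀ n : ℕ, (-1 : ℚ) ^ n ≠ 0 := fun n => pow_ne_zero _ (by norm_num)
    exact mul_ne_zero (mul_ne_zero (h10 _) h0) (h10 _) h8
  · intro Δ' hΔ'
    obtain ⟨h9, h10⟩ := mem_filter.1 hΔ'
    rw [mem_between] at h9
    refine ⟨erase_subset_erase _ (union_subset hBT sdiff_subset), ?_⟩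
    have := card_le_card h9.2
    rw [card_erase_of_mem (mem_union_left _ hy),
      card_union_of_disjoint (disjoint_sdiff.mono_left h9.1), card_sdiff_of_subset h9.2, hB, h10]
    omega
  · intro Δ₁ hΔ₁ Δ₂ hΔ₂ he
    have h9 := mem_between.1 (mem_filter.1 hΔ₁).1
    have h10 := mem_between.1 (mem_filter.1 hΔ₂).1
    -- The simplex is recovered from the subset; erasing `y` loses nothing, since `y` belongs to
    -- every simplex in question.
    have key : ∀ D, σ.bot ⊆ D → D ⊆ T → D = σ.bot ∪ (T \ (σ.bot ∪ (T \ D)).erase y) := by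
      intro D hD hDT
      ext x
      simp only [mem_union, mem_sdiff, mem_erase, not_and, not_or, not_not]
      constructor
      · intro hx
        by_cases hxB : x ∈ σ.bot
        · exact Or.inl hxB
        · exact Or.inr ⟨hDT hx, fun _ => ⟨hxB, fun _ => hx⟩⟩
      · rintro (hx | ⟨hx, hx'⟩)
        · exact hD hx
        · by_cases hxy : x = y
          · rw [hxy]; exact hD hy
          · exact (hx' hxy).2 hx
    simp only at he
    rw [key Δ₁ h9.1 h9.2, key Δ₂ h10.1 h10.2, he]
  · exact mem_filter.2 ⟨mem_between.2 ⟨hBΔ, h2 ▸ subset_union_left⟩, hk⟩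

theorem bracket_injOn {l k r : ℕ} (hr : r ≤ k) :
    Set.InjOn (X.bracket r) (X.propellers l k) := by
  intro c hc c' hc' h
  rw [← sub_eq_zero]
  refine eq_zero_of_bracket_eq_zero hr (sub_mem hc hc') ?_
  rw [map_sub, sub_eq_zero]
  exact h

end UnimodularTropicalSpace

end

/-! ### The isomorphism of complexes. -/

noncomputable section

namespace UnimodularTropicalSpace

variable {P : Type*} [Fintype P] [LinearOrder P] {X : UnimodularTropicalSpace P}

/-! ### The comparison isomorphism -/

theorem bracket_apply_eq_zero {l k r : ℕ} {c : Weights P} (hc : c ∈ X.propellers l k)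
    {σ : X.Flag} (h : σ.bot.card ≠ r + 1) : X.bracket r c σ = 0 := by
  rw [bracket_apply (k := k) (fun Δ q h => ⟨(hc.1 Δ q h).1, (hc.1 Δ q h).2.2⟩),
    if_neg fun h' => h h'.1]

theorem inclusion_zero : X.inclusion 0 = 0 :=
  inclusion_eq_zero (l := 0) (zero_mem _)

theorem gysin_zero : X.gysin 0 = 0 :=
  gysin_eq_zero (k := 0) (zero_mem _)

variable (X) in
/-- The map `d'`, set to zero on simplices of dimension less than `r`. -/
def truncatedInclusion (r : ℕ) (c : Weights P) : Weights P := fun Δ q =>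
  if r + 1 ≤ Δ.card then X.inclusion c Δ q else 0

/-- A simplex with fewer than `r + 1` vertices has no face of dimension `r`, so the truncation of
`d'` is not seen by `c[-r]`. -/
theorem bracket_truncatedInclusion (r : ℕ) (c : Weights P) :
    X.bracket r (X.truncatedInclusion r c) = X.bracket r (X.inclusion c) := by
  refine sum_congr rfl fun Δ _ => sum_congr rfl fun q _ => sum_congr rfl fun Δ' h => ?_
  rw [mem_powersetCard] at h
  rw [truncatedInclusion, if_pos (h.2 ▸ card_le_card h.1)]

theorem siDiff_zero_apply (e : ℕ → Weights P) :
    X.siDiff e 0 = X.truncatedInclusion 0 (e 0) := by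
  funext Δ q
  simp [siDiff, truncatedInclusion]

theorem siDiff_succ_apply (e : ℕ → Weights P) (r : ℕ) :
    X.siDiff e (r + 1) = X.truncatedInclusion (r + 1) (e (r + 1)) + X.gysin (e r) := by
  funext Δ q
  simp [siDiff, truncatedInclusion]

theorem mem_siTerm {p q : ℕ} {e : ℕ → Weights P} :
    e ∈ X.siTerm p q ↔ ∀ r, (r ≤ p ∧ p ≤ q + r → e r ∈ X.propellers (p - r) (q + 2 * r - p)) ∧
      (¬ (r ≤ p ∧ p ≤ q + r) → e r = 0) := by
  rw [siTerm, Submodule.mem_pi]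
  refine forall_congr' fun r => ?_
  by_cases h : r ≤ p ∧ p ≤ q + r <;> simp [h]

theorem mem_propellers_of_mem_siTerm {p q : ℕ} {e : ℕ → Weights P} (he : e ∈ X.siTerm p q)
    (r : ℕ) : e r ∈ X.propellers (p - r) (q + 2 * r - p) := by
  by_cases h : r ≤ p ∧ p ≤ q + r
  · exact (mem_siTerm.1 he r).1 h
  · rw [(mem_siTerm.1 he r).2 h]
    exact zero_mem _

theorem truncatedInclusion_mem {p q r : ℕ} {e : ℕ → Weights P} (he : e ∈ X.siTerm p q)
    (h : r ≤ p ∧ p < q + r) :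
    X.truncatedInclusion r (e r) ∈ X.propellers (p - r) (q + 2 * r - p - 1) := by
  have h1 := mem_propellers_of_mem_siTerm he r
  have h2 : X.truncatedInclusion r (e r) = X.inclusion (e r) := by
    funext Δ s
    rw [truncatedInclusion]
    split_ifs with h3
    · rfl
    · by_contra h4
      have := (inclusion_support h1 (Ne.symm h4)).1
      omega
  rw [h2]
  refine inclusion_mem ?_
  rwa [show q + 2 * r - p - 1 + 1 = q + 2 * r - p by omega]

/-- On the boundary case `k = r` the image of `d'` is supported on simplices with `r` vertices,
exactly those that are cut off. -/
theorem truncatedInclusion_eq_zero {p q r : ℕ} {e : ℕ → Weights P} (he : e ∈ X.siTerm p q)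
    (h : ¬ (r ≤ p ∧ p < q + r)) : X.truncatedInclusion r (e r) = 0 := by
  funext Δ s
  rw [truncatedInclusion]
  split_ifs with h1
  · by_cases h2 : r ≤ p ∧ p ≤ q + r
    · by_contra h3
      have := (inclusion_support ((mem_siTerm.1 he r).1 h2) h3).1
      omega
    · rw [(mem_siTerm.1 he r).2 h2, inclusion_zero]
  · rfl

theorem gysin_mem_of_mem_siTerm {p q r : ℕ} {e : ℕ → Weights P} (he : e ∈ X.siTerm p q)
    (h : r + 1 ≤ p) : X.gysin (e r) ∈ X.propellers (p - (r + 1)) (q + 2 * r - p + 1) := by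
  refine gysin_mem ?_
  rw [show p - (r + 1) + 1 = p - r by omega]
  exact mem_propellers_of_mem_siTerm he r

theorem gysin_eq_zero_of_mem_siTerm {p q r : ℕ} {e : ℕ → Weights P} (he : e ∈ X.siTerm p q)
    (h : ¬ (r + 1 ≤ p ∧ p ≤ q + r)) : X.gysin (e r) = 0 := by
  by_cases h1 : r ≤ p ∧ p ≤ q + r
  · have h2 := (mem_siTerm.1 he r).1 h1
    rw [show p - r = 0 by omega] at h2
    exact gysin_eq_zero h2
  · rw [(mem_siTerm.1 he r).2 h1, gysin_zero]

theorem siDiff_mem {p q : ℕ} {e : ℕ → Weights P} (he : e ∈ X.siTerm p (q + 1)) :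
    X.siDiff e ∈ X.siTerm p q := by
  have key : ∀ r, r ≤ p ∧ p ≤ q + r →
      X.truncatedInclusion r (e r) ∈ X.propellers (p - r) (q + 2 * r - p) := fun r h => by
    have := truncatedInclusion_mem he (r := r) ⟨h.1, by omega⟩
    rwa [show q + 1 + 2 * r - p - 1 = q + 2 * r - p by omega] at this
  refine mem_siTerm.2 fun r => ⟨fun h => ?_, fun h => ?_⟩
  · cases r with
    | zero =>
      rw [siDiff_zero_apply]
      exact key 0 h
    | succ r =>
      rw [siDiff_succ_apply]
      refine add_mem (key _ h) ?_
      have := gysin_mem_of_mem_siTerm he h.1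
      rwa [show q + 1 + 2 * r - p + 1 = q + 2 * (r + 1) - p by omega] at this
  · cases r with
    | zero => rw [siDiff_zero_apply, truncatedInclusion_eq_zero he (by omega)]
    | succ r =>
      rw [siDiff_succ_apply, truncatedInclusion_eq_zero he (by omega),
        gysin_eq_zero_of_mem_siTerm he (by omega), add_zero]

theorem siDiff_eq_zero {p : ℕ} {e : ℕ → Weights P} (he : e ∈ X.siTerm p 0) : X.siDiff e = 0 := by
  funext r
  cases r with
  | zero =>
    rw [siDiff_zero_apply, truncatedInclusion_eq_zero he (by omega)]
    rfl
  | succ r =>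
    rw [siDiff_succ_apply, truncatedInclusion_eq_zero he (by omega),
      gysin_eq_zero_of_mem_siTerm he (by omega), add_zero]
    rfl

variable (X) in
/-- The map `(c_r)_r ↦ ∑ r, c_r[-r]`. -/
def totalBracket (p : ℕ) : (ℕ → Weights P) →ₗ[ℚ] X.Chain :=
  ∑ r ∈ range (p + 1), X.bracket r ∘ₗ LinearMap.proj r

theorem totalBracket_apply (p : ℕ) (e : ℕ → Weights P) :
    X.totalBracket p e = ∑ r ∈ range (p + 1), X.bracket r (e r) := by
  simp [totalBracket]

theorem boundary_totalBracket {p q : ℕ} {e : ℕ → Weights P} (he : e ∈ X.siTerm p q) :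
    X.boundary (X.totalBracket p e) = X.totalBracket p (X.siDiff e) := by
  have h1 : ∀ r, X.boundary (X.bracket r (e r)) =
      X.bracket r (X.truncatedInclusion r (e r)) + X.bracket (r + 1) (X.gysin (e r)) := by
    intro r
    rw [bracket_truncatedInclusion]
    by_cases h : r ≤ p ∧ p ≤ q + r
    · exact boundary_bracket (by omega) ((mem_siTerm.1 he r).1 h)
    · simp [(mem_siTerm.1 he r).2 h, inclusion_zero, gysin_zero]
  -- The `d''` terms are shifted by one in `r`. The term leaving the range comes from `r = p`, where
  -- `l = 0` and `d''` vanishes.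
  rw [totalBracket_apply, totalBracket_apply, map_sum, sum_congr rfl fun r _ => h1 r,
    sum_add_distrib, sum_range_succ' _ p, sum_range_succ _ p,
    gysin_eq_zero_of_mem_siTerm he (r := p) (by omega), map_zero, add_zero,
    sum_range_succ' _ p, siDiff_zero_apply]
  simp only [siDiff_succ_apply, map_add, sum_add_distrib]
  abel

theorem eq_zero_of_totalBracket_eq_zero {p q : ℕ} {e : ℕ → Weights P} (he : e ∈ X.siTerm p q)
    (h : X.totalBracket p e = 0) : e = 0 := by
  funext s
  by_cases hs : s ≤ p ∧ p ≤ q + s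
  swap
  · exact (mem_siTerm.1 he s).2 hs
  refine eq_zero_of_bracket_eq_zero (r := s) (by omega) ((mem_siTerm.1 he s).1 hs) ?_
  funext σ
  by_cases hσ : σ.bot.card = s + 1
  · have h1 := congrFun h σ
    -- At a flag whose smallest cell has `s + 1` elements only the summand with index `s` is
    -- nonzero, which separates the components.
    rwa [totalBracket_apply, Finset.sum_apply, sum_eq_single_of_mem s (mem_range.2 (by omega))
      fun r _ hr => bracket_apply_eq_zero (mem_propellers_of_mem_siTerm he r) (by omega)] at h1
  · exact bracket_apply_eq_zero (mem_propellers_of_mem_siTerm he s) hσ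

theorem bracket_mem_konstruktor {l k r p q : ℕ} (h : r ≤ k ∧ l + r = p ∧ k + l = q + r)
    {c : Weights P} (hc : c ∈ X.propellers l k) : X.bracket r c ∈ X.konstruktor p q :=
  Submodule.mem_iSup_of_mem l <| Submodule.mem_iSup_of_mem k <| Submodule.mem_iSup_of_mem r <|
    Submodule.mem_iSup_of_mem h <| Submodule.mem_map_of_mem hc

theorem map_totalBracket (p q : ℕ) : (X.siTerm p q).map (X.totalBracket p) = X.konstruktor p q := by
  apply le_antisymm
  · rintro _ ⟨e, he, rfl⟩
    rw [totalBracket_apply]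
    refine sum_mem fun r _ => ?_
    by_cases h : r ≤ p ∧ p ≤ q + r
    · exact bracket_mem_konstruktor (by omega) ((mem_siTerm.1 he r).1 h)
    · rw [(mem_siTerm.1 he r).2 h, map_zero]
      exact zero_mem _
  · refine iSup_le fun l => iSup_le fun k => iSup_le fun r => iSup_le ?_
    rintro ⟨h1, rfl, h3⟩ _ ⟨c, hc, rfl⟩
    refine ⟨Pi.single r c, mem_siTerm.2 fun s => ?_, ?_⟩
    · by_cases hs : s = r
      · subst hs
        rw [Pi.single_eq_same]
        refine ⟨fun _ => ?_, fun h => absurd ⟨by omega, by omega⟩ h⟩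
        rwa [show l + s - s = l by omega, show q + 2 * s - (l + s) = k by omega]
      · rw [Pi.single_eq_of_ne hs]
        exact ⟨fun _ => zero_mem _, fun _ => rfl⟩
    · rw [totalBracket_apply, sum_eq_single_of_mem r (mem_range.2 (by omega)) fun s _ hs => by
        rw [Pi.single_eq_of_ne hs, map_zero], Pi.single_eq_same]

theorem konstruktor_le_barChains (p q : ℕ) : X.konstruktor p q ≤ X.barChains p q := by
  refine iSup_le fun l => iSup_le fun k => iSup_le fun r => iSup_le ?_
  rintro ⟨-, rfl, h⟩ _ ⟨c, hc, rfl⟩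
  have := bracket_mem (r := r) hc
  rwa [show k + l - r = q by omega] at this

theorem boundary_mem_konstruktor {p q : ℕ} {a : X.Chain} (ha : a ∈ X.konstruktor p (q + 1)) :
    X.boundary a ∈ X.konstruktor p q := by
  rw [← map_totalBracket] at ha ⊢
  obtain ⟨e, he, rfl⟩ := ha
  rw [boundary_totalBracket he]
  exact Submodule.mem_map_of_mem (siDiff_mem he)

variable (X) in
/-- The isomorphism of the terms of degree `q` of the Steenbrink–Illusie complex and the
konstruktor. -/
def siTermEquiv (p q : ℕ) : X.siTerm p q ≃ₗ[ℚ] X.konstruktor p q :=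
  (LinearEquiv.ofInjective ((X.totalBracket p).domRestrict (X.siTerm p q)) <| by
    rw [← LinearMap.ker_eq_bot, LinearMap.ker_eq_bot']
    exact fun e h => Subtype.ext (eq_zero_of_totalBracket_eq_zero e.2 h)) ≪≫ₗ
  LinearEquiv.ofEq _ _ (by rw [LinearMap.range_domRestrict, map_totalBracket])

variable (X) in
/-- The boundary map of the konstruktor. -/
def konstruktorBoundary (p q : ℕ) : X.konstruktor p (q + 1) →ₗ[ℚ] X.konstruktor p q :=
  X.boundary.restrict fun _ => boundary_mem_konstruktor

theorem konstruktorBoundary_comp (p q : ℕ) :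
    X.konstruktorBoundary p q ∘ₗ X.konstruktorBoundary p (q + 1) = 0 :=
  LinearMap.ext fun a => Subtype.ext (boundary_boundary a.1)

theorem siTermEquiv_siDiff {p q : ℕ} (e : X.siTerm p (q + 1)) :
    X.siTermEquiv p q ⟨X.siDiff e, siDiff_mem e.2⟩ =
      X.konstruktorBoundary p q (X.siTermEquiv p (q + 1) e) :=
  Subtype.ext (boundary_totalBracket e.2).symm

end UnimodularTropicalSpace

end

/-! ### Assembly of the proposition. -/

theorem mainTheorem9 {P : Type*} [Fintype P] [LinearOrder P] (X : UnimodularTropicalSpace P) :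
    -- the barycentric chains form a complex
    (∀ p q, ∀ a ∈ X.barChains p (q + 1), X.boundary a ∈ X.barChains p q) ∧
    (∀ a, X.boundary (X.boundary a) = 0) ∧
    -- the coefficients in the definition of `d'` exist and are unique
    (∀ l k, ∀ c ∈ X.propellers (l + 1) (k + 1), ∀ Δ r, Δ.card = k + 2 → r.card = l →
      X.IsLink Δ r → ∀ v ∈ Δ, ∃! a, X.IsDescent c Δ v r a) ∧
    -- `d'` and `d''` map propellers to propellers
    (∀ l k, ∀ c ∈ X.propellers l (k + 1), X.inclusion c ∈ X.propellers l k) ∧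
    (∀ l, ∀ c ∈ X.propellers l 0, X.inclusion c = 0) ∧
    (∀ l k, ∀ c ∈ X.propellers (l + 1) k, X.gysin c ∈ X.propellers l (k + 1)) ∧
    (∀ k, ∀ c ∈ X.propellers 0 k, X.gysin c = 0) ∧
    -- `c ↦ c[-r]` is an injective map to the barycentric chains
    (∀ l k r, r ≤ k →
      (∀ c ∈ X.propellers l k, X.bracket r c ∈ X.barChains (l + r) (k + l - r)) ∧
      Set.InjOn (X.bracket r) (X.propellers l k)) ∧
    -- the boundary formula
    (∀ l k r, r ≤ k → ∀ c ∈ X.propellers l k,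
      X.boundary (X.bracket r c) =
        X.bracket r (X.inclusion c) + X.bracket (r + 1) (X.gysin c)) ∧
    -- the konstruktor is a subcomplex, isomorphic to the Steenbrink–Illusie complex
    (∀ p,
      (∀ q, X.konstruktor p q ≤ X.barChains p q) ∧
      (∀ e ∈ X.siTerm p 0, X.siDiff e = 0) ∧
      (∀ a ∈ X.konstruktor p 0, X.boundary a = 0) ∧
      ∃ (D : ∀ q, X.siTerm p (q + 1) →ₗ[ℚ] X.siTerm p q)
        (B : ∀ q, X.konstruktor p (q + 1) →ₗ[ℚ] X.konstruktor p q)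
        (Φ : ∀ q, X.siTerm p q ≃ₗ[ℚ] X.konstruktor p q),
        (∀ q e, (D q e : ℕ → UnimodularTropicalSpace.Weights P) = X.siDiff e) ∧
        (∀ q a, (B q a : X.Chain) = X.boundary a) ∧
        (∀ q, D q ∘ₗ D (q + 1) = 0) ∧
        (∀ q, B q ∘ₗ B (q + 1) = 0) ∧
        (∀ q e, (Φ q e : X.Chain) = ∑ r ∈ Finset.range (p + 1), X.bracket r (e.1 r)) ∧
        (∀ q e, Φ q (D q e) = B q (Φ (q + 1) e))) := by
  refine ⟨fun p q a => UnimodularTropicalSpace.boundary_mem,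
    UnimodularTropicalSpace.boundary_boundary, ?_,
    fun l k c => UnimodularTropicalSpace.inclusion_mem,
    fun l c => UnimodularTropicalSpace.inclusion_eq_zero,
    fun l k c => UnimodularTropicalSpace.gysin_mem,
    fun k c => UnimodularTropicalSpace.gysin_eq_zero,
    fun l k r hr => ⟨fun c => UnimodularTropicalSpace.bracket_mem,
      UnimodularTropicalSpace.bracket_injOn hr⟩,
    fun l k r hr c => UnimodularTropicalSpace.boundary_bracket hr, fun p => ?_⟩
  · intro l k c hc Δ r hΔ _ hL v hv
    refine UnimodularTropicalSpace.existsUnique_isDescent hc hL hv (card_pos.1 ?_)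
    rw [card_erase_of_mem hv]
    omega
  -- Linearity of `siDiff` is not visible from its definition, which contains a choice of descent
  -- coefficients. The differential is therefore transported from the konstruktor and identified
  -- with `siDiff` afterwards, by injectivity; `d² = 0` comes along.
  let D : ∀ q, X.siTerm p (q + 1) →ₗ[ℚ] X.siTerm p q := fun q =>
    (X.siTermEquiv p q).symm.toLinearMap ∘ₗ X.konstruktorBoundary p q ∘ₗ
      (X.siTermEquiv p (q + 1)).toLinearMap
  have hD : ∀ q e, X.siTermEquiv p q (D q e) =
      X.konstruktorBoundary p q (X.siTermEquiv p (q + 1) e) := fun q e =>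
    LinearEquiv.apply_symm_apply _ _
  refine ⟨UnimodularTropicalSpace.konstruktor_le_barChains p,
    fun e => UnimodularTropicalSpace.siDiff_eq_zero,
    fun a ha => UnimodularTropicalSpace.boundary_eq_zero
      (UnimodularTropicalSpace.konstruktor_le_barChains p 0 ha),
    D, X.konstruktorBoundary p, X.siTermEquiv p, fun q e => ?_, fun q a => rfl, fun q => ?_,
    UnimodularTropicalSpace.konstruktorBoundary_comp p,
    fun q e => UnimodularTropicalSpace.totalBracket_apply p e.1, hD⟩
  · exact congrArg Subtype.val ((X.siTermEquiv p q).injective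
      ((hD q e).trans (UnimodularTropicalSpace.siTermEquiv_siDiff e).symm))
  · refine LinearMap.ext fun e => (X.siTermEquiv p q).injective ?_
    rw [LinearMap.comp_apply, hD, hD, LinearMap.zero_apply, map_zero]
    exact LinearMap.congr_fun (UnimodularTropicalSpace.konstruktorBoundary_comp p q) _
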